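/- Words over an alphabet $\Sigma$ are elements of the free monoid $\Sigma^*$; $\varepsilon$ is the empty word. A word $w$ is primitive if $w=u^k$ with $u\neq\varepsilon$ implies $k=1$. The circular factors of a word $w$ are the factors of the rotations (conjugates) of $w$; for $L\subseteq\Sigma^*$, $\widetilde{\mathcal F}(L)$ denotes the set of all circular factors of words of $L$. Let $\mu:\{a,b\}^*\to\Gamma^*$ be an injective morphism and $L\subseteq\{a,b\}^*$. The morphism $\mu$ is primitivity-preserving if it maps primitive words to primitive words. A $\mu$-power word is a primitive word $w$ such that $\mu(w)=z^k$ for some primitive word $z$ and some integer $k>1$; $P^\mu$ is the set of all $\mu$-power words. For $u\in\widetilde{\mathcal F}(\mu(L))$, a pair $(u_1,u_2)$ is a synchronization pair of $u$ on $\mu(L)$ if $u=u_1u_2$ and, whenever $v_1uv_2=\mu(f)$ with $v_1,v_2\in\Gamma^*$ and $f\in\widetilde{\mathcal F}(L)$, there are $f_1,f_2\in\widetilde{\mathcal F}(L)$ with $f=f_1f_2$, $v_1u_1=\mu(f_1)$ and $u_2v_2=\mu(f_2)$. For an integer $k>0$ and $w\in\mu(L)$, $\mu$ is synchronizing with delay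 $k$ for $w$ if every circular factor of $w$ of length at least $k$ admits a synchronization pair on $\mu(L)$. The morphism $\mu$ is synchronizing with finite delay on $\mu(L)$ if for every $x\in L$ there is a least integer $k(x)>0$ such that $\mu$ is synchronizing with delay $k(x)$ for $\mu(x)$, and there is an integer $K>0$ with $\sup_{x\in L}k(x)\le K$. **Theorem.** Let $\mu:\{a,b\}^*\to\Gamma^*$ be an injective morphism that is not primitivity-preserving, and let $L\subseteq\{a,b\}^*$. Then $\mu$ is synchronizing with finite delay on $\mu(L)$ if and only if the set $$\widetilde{\mathcal F}(L)\cap\{w^n\mid w\in P^\mu,\ n\ge 0\}$$ is finite. -/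

import Mathlib

namespace WordSync

variable {A B : Type*}

/-- `u` is a factor of `w`. Words are elements of the free monoid, morphisms are monoid
homomorphisms, `1` is the empty word. -/
def IsFactor (u w : FreeMonoid A) : Prop := ∃ x y, w = x * u * y

/-- `w'` is a rotation (conjugate) of `w`. -/
def IsRotation (w' w : FreeMonoid A) : Prop := ∃ x y, w = x * y ∧ w' = y * x

/-- The circular factors of `w`: the factors of the rotations of `w`. -/
def circFactors (w : FreeMonoid A) : Set (FreeMonoid A) :=
  {u | ∃ w', IsRotation w' w ∧ IsFactor u w'}

/-- The circular factors of a language. -/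
def circFactorsOf (L : Set (FreeMonoid A)) : Set (FreeMonoid A) :=
  ⋃ w ∈ L, circFactors w

/-- A word is primitive if it is a power `u ^ k` of a non-empty word `u` only for `k = 1`. -/
def IsPrimitive (w : FreeMonoid A) : Prop :=
  ∀ u : FreeMonoid A, u ≠ 1 → ∀ k : ℕ, w = u ^ k → k = 1

/-- `μ` maps primitive words to primitive words. -/
def PrimitivityPreserving (μ : FreeMonoid A →* FreeMonoid B) : Prop :=
  ∀ w, IsPrimitive w → IsPrimitive (μ w)

/-- The set of `μ`-power words. -/
def powerWords (μ : FreeMonoid A →* FreeMonoid B) : Set (FreeMonoid A) :=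
  {w | IsPrimitive w ∧ ∃ z : FreeMonoid B, IsPrimitive z ∧ ∃ k : ℕ, 1 < k ∧ μ w = z ^ k}

/-- All the powers of words of `P`. -/
def powersOf (P : Set (FreeMonoid A)) : Set (FreeMonoid A) :=
  {x | ∃ w ∈ P, ∃ n : ℕ, x = w ^ n}

/-- `(u₁, u₂)` is a synchronization pair of `u` on `μ(L)` (used for circular factors `u` of
`μ(L)`). -/
def IsSyncPair (μ : FreeMonoid A →* FreeMonoid B) (L : Set (FreeMonoid A))
    (u u₁ u₂ : FreeMonoid B) : Prop :=
  u = u₁ * u₂ ∧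
    ∀ v₁ v₂ : FreeMonoid B, ∀ f ∈ circFactorsOf L, v₁ * u * v₂ = μ f →
      ∃ f₁ ∈ circFactorsOf L, ∃ f₂ ∈ circFactorsOf L,
        v₁ * u₁ = μ f₁ ∧ u₂ * v₂ = μ f₂ ∧ f₁ * f₂ = f

/-- `μ` is synchronizing with delay `k > 0` for the word `w`, a member of `μ(L)`: every circular
factor of `w` of length at least `k` admits a synchronization pair on `μ(L)`. -/
def SyncWordWithDelay (μ : FreeMonoid A →* FreeMonoid B) (L : Set (FreeMonoid A))
    (k : ℕ) (w : FreeMonoid B) : Prop :=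
  0 < k ∧ ∀ u ∈ circFactors w, k ≤ u.length → ∃ u₁ u₂, IsSyncPair μ L u u₁ u₂

/-- The least delay with which `μ` is synchronizing for `w` (`⊤` if there is none). -/
noncomputable def minDelay (μ : FreeMonoid A →* FreeMonoid B) (L : Set (FreeMonoid A))
    (w : FreeMonoid B) : ℕ∞ :=
  ⨅ (k : ℕ) (_ : SyncWordWithDelay μ L k w), (k : ℕ∞)

/-- `μ` is synchronizing with delay `K > 0` for `μ(L)`: it has a finite delay for every word of
`μ(L)` and the supremum of the least delays is at most `K`. -/
def SyncWithDelay (μ : FreeMonoid A →* FreeMonoid B) (L : Set (FreeMonoid A)) (K : ℕ) : Prop :=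
  0 < K ∧ (∀ x ∈ L, ∃ k, SyncWordWithDelay μ L k (μ x)) ∧
    (⨆ x ∈ L, minDelay μ L (μ x)) ≤ (K : ℕ∞)

/-- `μ` is synchronizing with finite delay on `μ(L)`. -/
def SyncWithFiniteDelay (μ : FreeMonoid A →* FreeMonoid B) (L : Set (FreeMonoid A)) : Prop :=
  ∃ K : ℕ, SyncWithDelay μ L K

end WordSync

/-!
Synchronization with finite delay for an injective, not primitivity-preserving morphism `μ` on
words over two letters with images `x` and `y`.

Suppose that the circular factors of `L` that are powers of power words have bounded length. Two
interpretations of a long word `u` as a factor of an image, by circular factors of `L`, have a cut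
in common (`exists_common_cut`). Otherwise, among sufficiently many widely spaced cuts of the
first one, the pigeonhole principle yields two between which the interpretations contain long
words `g`, `g'` with `σ μ(g) = μ(g') σ`; then a two-sided infinite periodic word is a repetition
of `μ(g)` and of `μ(g')`, without a common cut. The main point is that in this case the primitive
root of `g` or of `g'` is a power word (`mem_powerWords_of_disjoint`). Once two interpretations
have a cut in common, they agree up to a bounded distance from the right end of `u`, because
products that begin with `x` and with `y` differ after a fixed common prefix
(`exists_mul_of_common_prefix`). So a cut of one interpretation near the right end of `u` gives a
synchronization pair (`exists_isSyncPair`).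

The main point rests on `shiftOrConst_of_disj`: two factorizations of a periodic word into blocks
`x` and `y` without a common cut are shifts of each other, or one consists of blocks `x` and the
other of blocks `y`. Let `x` be the longer block. If a square `xx` occurs in one factorization,
the other one covers it by `y ⋯ y`, by `y ⋯ y x`, by `x y ⋯ y` or by `x y ⋯ y x`, or has a block
`x` strictly inside. The second and third cases are impossible, and the other ones are analysed by
periods: in the fourth there is a single `y` with the same centre as the square, and this forces
both factorizations to be repetitions of `xxy` (`shiftOrConst_of_square`). If no square `xx`
occurs, every `x` is followed by `y`, and the pair `(x, y)` is replaced by `(x y, y)`. This comes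
to an end because blocks are not longer than the period. Blocks are handled together with the
context that every occurrence has, so that comparisons may extend beyond the block; this is the
role of `G` in `Blocks` and `Reading`.

Now let the periodic word be a repetition of `μ(r)` and of `μ(r')` with `r` and `r'` primitive but
not power words. Then `μ(r)` and `μ(r')` are primitive. If the factorizations are shifts of each
other, the shift is a period of the word, hence a multiple of `|μ(r)|`, and the cuts agree, a
contradiction. Otherwise `r` and `r'` are the two letters, and `x` and `y` are primitive and
conjugate. In that case `μ` preserves primitivity (`primitivityPreserving_of_conjugate`), which is
excluded by hypothesis.

Conversely, let `w` be a power word with `μ(w) = z ^ k`, `k > 1`. In `μ(w ^ n)` the word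
`z ^ (k n - 1)` occurs at two places at the distance `|z|`. A synchronization pair would cut both
occurrences at corresponding places and make `w` a conjugate of a proper power
(`not_isSyncPair_of_power`). So the length of `w ^ n` is bounded in terms of the delay
(`length_lt_of_syncWithDelay`).
-/

namespace WordSync

/-! ### A square overlapping a power of another word -/

theorem periodic_eq_of_dvd_sub {Γ : Type*} {V : ℤ → Γ} {P : ℤ} (hV : Function.Periodic V P)
    {s t : ℤ} (h : P ∣ s - t) : V s = V t := by
  obtain ⟨n, hn⟩ := h
  have h1 := hV.int_mul n t
  rw [← h1]
  congr 1
  simp only [Int.cast_id]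
  linarith [mul_comm P n]

/-- Let `V` have the period `2h`, and let `u` and `u'` be the words of the same odd number of half
periods that are read in `V` at `0` and at `h`. If `u` is a proper conjugate of `u'`, then `V` has
equal letters at `0` and `h`. The hypotheses `h1` and `h2` compare the two parts of `u`. -/
theorem eq_of_half_periods {Γ : Type*} {V : ℤ → Γ} {h D s : ℤ} {j : ℕ} (hj : 1 ≤ j)
    (hV : Function.Periodic V (2 * h)) (hh : 0 < h) (hD : D = (2 * j + 1) * h)
    (hs0 : 0 < s) (hsD : s < D)
    (h1 : ∀ t, 0 ≤ t → t < D - s → V t = V (t + s + h))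
    (h2 : ∀ t, D - s ≤ t → t < D → V t = V (t + s)) : V 0 = V h := by
  have full : ∀ (k : ℤ) (a : ℤ), (∀ t, a ≤ t → t < a + 2 * h → V t = V (t + k)) →
      ∀ t, V t = V (t + k) := by
    intro k a H t
    set r := (t - a) % (2 * h) with hr
    have hr0 : 0 ≤ r := Int.emod_nonneg _ (by omega)
    have hr1 : r < 2 * h := Int.emod_lt_of_pos _ (by omega)
    have hd : 2 * h ∣ t - (a + r) := by
      have : 2 * h ∣ (t - a) - r := Int.dvd_self_sub_emod
      rwa [sub_sub] at this
    rw [periodic_eq_of_dvd_sub hV hd, H (a + r) (by omega) (by omega)]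
    apply periodic_eq_of_dvd_sub hV
    obtain ⟨n, hn⟩ := hd
    exact ⟨-n, by linarith⟩
  have key : ∀ n : ℤ, V (2 * h * n) = V 0 := fun n =>
    periodic_eq_of_dvd_sub hV ⟨n, by ring⟩
  have key' : ∀ n : ℤ, V (2 * h * n + h) = V h := fun n =>
    periodic_eq_of_dvd_sub hV ⟨n, by ring⟩
  -- One of the two parts contains a whole period, unless `D = 3 h` and both are shorter.
  by_cases c1 : 2 * h ≤ D - s
  · have H := full (s + h) 0 (fun t ht ht' => by
      rw [h1 t ht (by omega)]; congr 1; ring)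
    have e1 := h2 (D - s) le_rfl (by omega)
    have e2 := H (D - s)
    have e3 := key' j
    have e4 := key (j + 1)
    rw [show D - s + s = 2 * h * j + h by rw [hD]; ring] at e1
    rw [show D - s + (s + h) = 2 * h * (j + 1) by rw [hD]; ring] at e2
    rw [← e4, ← e2, e1, e3]
  by_cases c2 : 2 * h ≤ s
  · have H := full s (D - s) (fun t ht ht' => h2 t ht (by omega))
    have e1 := h1 0 le_rfl (by omega)
    have e2 := H h
    rw [e1, e2]; congr 1; ring
  · have hj1 : j = 1 := by
      by_contra hne
      have : (2 : ℤ) ≤ j := by exact_mod_cast (by omega : 2 ≤ j)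
      nlinarith
    subst hj1
    have hD' : D = 3 * h := by rw [hD]; push_cast; ring
    have e1 := h1 h hh.le (by omega)
    have e2 := h2 (2 * h) (by omega) (by omega)
    have e3 := key 1
    have e4 : V (h + s + h) = V (2 * h + s) := by congr 1; ring
    rw [mul_one] at e3
    rw [← e3, e2, e1, e4]

/-- The overlap of the square `xx` with `x y ^ k x`, where the centre of the square lies inside
`y ^ k`, at the distance `E` from its beginning and `D` from its end, so that `E + D = k Y`. The
word `x` is given by the values of `xs` on `[0, X)`, and `yp` is the periodic continuation of `y`.
The occurrences of `x` in the two factorizations overlap, so that `x` has the periods `E` and `D`,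
and a suffix of `x` is a prefix of `y ^ k`, and a prefix of `x` a suffix. The words `x` and `y`
begin with different letters. -/
structure Overlap {Γ : Type*} (xs yp : ℤ → Γ) (X Y E D : ℤ) : Prop where
  posY : 0 < Y
  posE : 0 < E
  posD : 0 < D
  ltE : E < X
  ltD : D < X
  per : Function.Periodic yp Y
  mark : xs 0 ≠ yp 0
  perE : ∀ t, 0 ≤ t → t + E < X → xs t = xs (t + E)
  perD : ∀ t, 0 ≤ t → t + D < X → xs t = xs (t + D)
  suff : ∀ t, 0 ≤ t → t < E → xs (X - E + t) = yp t
  pref : ∀ t, 0 ≤ t → t < D → xs t = yp (t + E)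

/-- For `k ≥ 2` the centre of the square is not to the right of the centre of `y ^ k`. -/
theorem Overlap.false_of_gt {Γ : Type*} {xs yp : ℤ → Γ} {X Y E D : ℤ}
    (H : Overlap xs yp X Y E D) {k : ℕ} (hk : 2 ≤ k) (hED : E + D = k * Y) (hgt : D < E) :
    False := by
  have hY := H.posY
  have hE := H.posE
  have hD := H.posD
  have hEX := H.ltE
  have hDX := H.ltD
  set p := E % Y with hp
  have hp0 : 0 ≤ p := Int.emod_nonneg _ (by omega)
  have hpY : p < Y := Int.emod_lt_of_pos _ (by omega)
  have hEp : Y ∣ E - p := Int.dvd_self_sub_emod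
  have x0 : xs 0 = yp E := by simpa using H.pref 0 le_rfl hD
  have x0p : xs 0 = yp p := by rw [x0]; exact periodic_eq_of_dvd_sub H.per hEp
  have hpne : p ≠ 0 := by
    intro h; rw [h] at x0p; exact H.mark x0p
  obtain ⟨i, hi⟩ := hEp
  have hyD : yp (D + p) = yp 0 := by
    apply periodic_eq_of_dvd_sub H.per
    exact ⟨k - i, by rw [mul_sub, ← hi]; linarith [mul_comm (k : ℤ) Y]⟩
  -- The first letters of `x` and `y` are the letters `p` and `D + p` of `yp`. If both places lie in
  -- the suffix of `x` of length `E`, the period `D` of `x` identifies them.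
  by_cases c : D + p < E
  · have e1 := H.suff (D + p) (by omega) c
    have e2 := H.suff p hp0 (by omega)
    have e3 := H.perD (X - E + p) (by omega) (by omega)
    apply H.mark
    rw [x0p, ← e2, e3, ← hyD, ← e1]; congr 1; ring
  · have hD2 : D = Y * i + Y - p := by
      have hDe : D + p = Y * (k - i) := by rw [mul_sub, ← hi]; linarith [mul_comm (k : ℤ) Y]
      have a1 : i < k - i := by
        by_contra hc
        have : Y * (k - i) ≤ Y * i := mul_le_mul_of_nonneg_left (by omega) hY.le
        omega
      have a2 : (k : ℤ) - i < i + 2 := by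
        by_contra hc
        have : Y * (i + 2) ≤ Y * (k - i) := mul_le_mul_of_nonneg_left (by omega) hY.le
        have : Y * (i + 2) = Y * i + 2 * Y := by ring
        omega
      have : (k : ℤ) - i = i + 1 := by omega
      rw [this] at hDe
      have : Y * (i + 1) = Y * i + Y := by ring
      omega
    have hi1 : 1 ≤ i := by
      by_contra hc
      have h0 : Y * i ≤ 0 := mul_nonpos_of_nonneg_of_nonpos hY.le (by omega)
      have : Y * 2 ≤ Y * k := mul_le_mul_of_nonneg_left (by exact_mod_cast hk) hY.le
      have := mul_comm (k : ℤ) Y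
      omega
    have hYi : Y ≤ Y * i := le_mul_of_one_le_right hY.le hi1
    set q := Y - p with hq
    have hf : X - D > p := by
      by_contra hc
      have e1 := H.suff (D - Y - (X - E)) (by omega) (by omega)
      have e2 := H.suff (D - (X - E)) (by omega) (by omega)
      have e3 := H.pref (D - Y) (by omega) (by omega)
      have e4 := H.perD 0 le_rfl (by omega)
      have e5 : yp (D - Y - (X - E)) = yp (D - (X - E)) :=
        periodic_eq_of_dvd_sub H.per ⟨-1, by ring⟩
      have e6 : yp (D - Y + E) = yp 0 :=
        periodic_eq_of_dvd_sub H.per ⟨k - 1, by rw [mul_sub]; linarith [mul_comm (k : ℤ) Y]⟩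
      rw [show X - E + (D - Y - (X - E)) = D - Y by ring] at e1
      rw [show X - E + (D - (X - E)) = D by ring] at e2
      apply H.mark
      rw [e4, zero_add, e2, ← e5, ← e1, e3, e6]
    -- the common prefix and suffix of length `X - D` has the period `E - D`
    set δ := E - D with hδ
    set f := X - D with hf'
    set V : ℤ → Γ := fun t => xs (t % δ) with hV
    have hVper : Function.Periodic V δ := fun t => by simp [hV]
    have hδ0 : 0 < δ := by omega
    have stepT : ∀ t, 0 ≤ t → t + δ < f → xs t = xs (t + δ) := by
      intro t ht ht'
      rw [H.perE t ht (by omega), H.perD (t + δ) (by omega) (by omega)]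
      congr 1; omega
    have hVx : ∀ n : ℕ, ∀ t, 0 ≤ t → t < f → t ≤ n → xs t = V t := by
      intro n
      induction n with
      | zero => intro t h0 _ h2; simp [hV, show t = 0 by omega]
      | succ n ih =>
        intro t h0 h1 h2
        by_cases hc : t < δ
        · simp [hV, Int.emod_eq_of_lt h0 hc]
        · have := stepT (t - δ) (by omega) (by omega)
          rw [sub_add_cancel] at this
          rw [← this, ih (t - δ) (by omega) (by omega) (by omega)]
          exact periodic_eq_of_dvd_sub hVper ⟨-1, by ring⟩
    have hVx' : ∀ t, 0 ≤ t → t < f → xs t = V t := fun t h0 h1 =>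
      hVx t.toNat t h0 h1 (by omega)
    -- three occurrences of the beginning of `y` in this border
    have o1 : ∀ t, 0 ≤ t → t < δ → V (q + t) = yp t := by
      intro t h0 h1
      rw [← hVx' (q + t) (by omega) (by omega), H.pref (q + t) (by omega) (by omega)]
      exact periodic_eq_of_dvd_sub H.per ⟨i + 1, by rw [mul_add]; omega⟩
    have o2 : ∀ t, 0 ≤ t → t < δ → V (f - p + t) = yp t := by
      intro t h0 h1
      rw [← hVx' (f - p + t) (by omega) (by omega),
        H.perD (f - p + t) (by omega) (by omega)]
      have := H.suff (E - p + t) (by omega) (by omega)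
      rw [show f - p + t + D = X - E + (E - p + t) by omega, this]
      exact periodic_eq_of_dvd_sub H.per ⟨i, by omega⟩
    have o3 : ∀ t, 0 ≤ t → t < δ → V (X - E + t) = yp t := by
      intro t h0 h1
      rw [← hVx' (X - E + t) (by omega) (by omega), H.suff t h0 (by omega)]
    have ext : ∀ a b, (∀ t, 0 ≤ t → t < δ → V (a + t) = yp t) →
        (∀ t, 0 ≤ t → t < δ → V (b + t) = yp t) → ∀ t, V (a + t) = V (b + t) := by
      intro a b ha hb t
      have hr0 : 0 ≤ t % δ := Int.emod_nonneg _ (by omega)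
      have hr1 : t % δ < δ := Int.emod_lt_of_pos _ (by omega)
      have hd : δ ∣ t - t % δ := Int.dvd_self_sub_emod
      have u : ∀ a, V (a + t) = V (a + t % δ) := fun a =>
        periodic_eq_of_dvd_sub hVper (by simpa using hd)
      rw [u a, u b, ha _ hr0 hr1, hb _ hr0 hr1]
    have c12 := ext _ _ o1 o2
    have c13 := ext _ _ o1 o3
    have xq : xs q = yp 0 := by
      rw [H.pref q (by omega) (by omega)]
      exact periodic_eq_of_dvd_sub H.per ⟨i + 1, by rw [mul_add]; omega⟩
    apply H.mark
    rw [← xq, hVx' 0 le_rfl (by omega), hVx' q (by omega) (by omega)]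
    -- `f - p - q` and `X - E - q` are periods of `V`, and so is their difference modulo `δ`
    have s1 := c13 (- q + δ + p - f)
    have s2 := c12 (- q + δ + p - f + q)
    have s3 := hVper 0
    have s4 : V (q + (-q + δ + p - f)) = V (δ + p - f) := by congr 1; ring
    have s5 : V (X - E + (-q + δ + p - f)) = V (p - q) := by congr 1; omega
    have s6 : V (q + (-q + δ + p - f + q)) = V (δ + p - f + q) := by congr 1; ring
    have s7 : V (f - p + (-q + δ + p - f + q)) = V δ := by congr 1; ring
    have s8 := c13 (δ + p - f)
    have s9 : V (X - E + (δ + p - f)) = V p := by congr 1; omega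
    have s10 : V (q + (δ + p - f)) = V (δ + p - f + q) := by congr 1; ring
    have s11 : V p = V q := periodic_eq_of_dvd_sub hVper ⟨1, by omega⟩
    rw [zero_add] at s3
    rw [← s3, ← s7, ← s2, s6, ← s10, s8, s9, s11]

/-- For `k ≥ 2` the centre of the square is not the centre of `y ^ k`. For even `k` it would be a
cut of `y ^ k`. For odd `k` the word `y` has even length `2p`, and the prefix and the suffix of
`x` of length `E`, which are conjugate by the period `E` of `x`, are read in `yp` at the distance
`p`. -/
theorem Overlap.false_of_eq {Γ : Type*} {xs yp : ℤ → Γ} {X Y E : ℤ}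
    (H : Overlap xs yp X Y E E) {k : ℕ} (hk : 2 ≤ k) (hED : E + E = k * Y) : False := by
  have hY := H.posY
  have hE := H.posE
  have hEX := H.ltE
  have x0 : xs 0 = yp E := by simpa using H.pref 0 le_rfl hE
  obtain ⟨i, hi⟩ | ⟨i, hi⟩ := Nat.even_or_odd k
  · apply H.mark
    rw [x0]
    refine periodic_eq_of_dvd_sub H.per ⟨i, ?_⟩
    subst hi
    push_cast at hED
    linarith
  · subst hi
    push_cast at hED
    obtain ⟨p, hp⟩ : ∃ p, Y = 2 * p := by
      refine ⟨E - i * Y, ?_⟩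
      linarith
    have hEp : E = (2 * i + 1) * p := by
      have : 2 * E = 2 * ((2 * i + 1) * p) := by rw [two_mul, hED, hp]; ring
      omega
    have hp0 : 0 < p := by omega
    have hper : Function.Periodic yp (2 * p) := hp ▸ H.per
    set z : ℤ → Γ := fun t => xs (t % E) with hz
    have hzper : Function.Periodic z E := fun t => by simp [hz]
    have hzx : ∀ n : ℕ, ∀ t, 0 ≤ t → t < X → t ≤ n → xs t = z t := by
      intro n
      induction n with
      | zero => intro t h0 _ h2; simp [hz, show t = 0 by omega]
      | succ n ih =>
        intro t h0 h1 h2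
        by_cases hc : t < E
        · simp [hz, Int.emod_eq_of_lt h0 hc]
        · have := H.perE (t - E) (by omega) (by omega)
          rw [sub_add_cancel] at this
          rw [← this, ih (t - E) (by omega) (by omega) (by omega)]
          exact periodic_eq_of_dvd_sub hzper ⟨-1, by ring⟩
    have hzx' : ∀ t, 0 ≤ t → t < X → z t = xs t := fun t h0 h1 =>
      (hzx t.toNat t h0 h1 (by omega)).symm
    set s := (X - E) % E with hs
    have hs0 : 0 ≤ s := Int.emod_nonneg _ (by omega)
    have hs1 : s < E := Int.emod_lt_of_pos _ (by omega)
    have hsd : E ∣ (X - E) - s := Int.dvd_self_sub_emod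
    have zpre : ∀ t, 0 ≤ t → t < E → z t = yp (t + p) := by
      intro t h0 h1
      rw [hzx' t h0 (by omega), H.pref t h0 h1]
      exact periodic_eq_of_dvd_sub hper ⟨i, by rw [hEp]; ring⟩
    have zsuf : ∀ t, 0 ≤ t → t < E → z (s + t) = yp t := by
      intro t h0 h1
      rw [← H.suff t h0 h1, ← hzx' _ (by omega) (by omega)]
      obtain ⟨n, hn⟩ := hsd
      exact periodic_eq_of_dvd_sub hzper ⟨-n, by linarith⟩
    have x0p : xs 0 = yp p := by
      rw [← hzx' 0 le_rfl (by omega), zpre 0 le_rfl hE, zero_add]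
    apply H.mark
    rw [x0p]
    symm
    have hi1 : 1 ≤ i := by omega
    refine eq_of_half_periods hi1 hper hp0 hEp (s := s) ?_ hs1 ?_ ?_
    · rcases hs0.lt_or_eq with h | h
      · exact h
      · exfalso
        have := zsuf 0 le_rfl hE
        rw [← h, add_zero, hzx' 0 le_rfl (by omega)] at this
        exact H.mark this
    · intro t h0 h1
      rw [← zsuf t h0 (by omega), zpre (s + t) (by omega) (by omega)]
      congr 1; ring
    · intro t h0 h1
      rw [← zsuf t (by omega) (by omega)]
      have : z (s + t) = z (s + t - E) := periodic_eq_of_dvd_sub hzper ⟨1, by ring⟩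
      rw [this, zpre (s + t - E) (by omega) (by omega)]
      exact periodic_eq_of_dvd_sub hper ⟨-i, by rw [hEp]; ring⟩

/-! ### Readings of a two-sided infinite word -/

/-- Two blocks `x` and `y` of lengths `X` and `Y` together with the context that surrounds every
occurrence of them in a product of blocks. The functions `xs` and `ys` matter only on `[-G, X)` and
`[-G, Y)`. The origin is placed at the first letter in which products starting with `x` differ from
products starting with `y`, and `G` is the length of the context common to both; hence the
conditions `first` and, for the other direction, `last`. -/
structure Blocks {Γ : Type*} (xs ys : ℤ → Γ) (X Y G : ℤ) : Prop where
  posX : 0 < X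
  posY : 0 < Y
  nonnegG : 0 ≤ G
  first : xs 0 ≠ ys 0
  last : xs (X - G - 1) ≠ ys (Y - G - 1)

/-- A factorization of the two-sided infinite word `W` into the blocks `x` and `y`. The sets `A`
and `B` consist of the cuts that are followed by `x` and by `y` (with the shift of the origin chosen
in `Blocks`); both are invariant under translation by `N`. -/
structure Reading {Γ : Type*} (xs ys : ℤ → Γ) (X Y G : ℤ) (W : ℤ → Γ) (N : ℤ)
    (A B : ℤ → Prop) : Prop where
  readA : ∀ c, A c → ∀ t, -G ≤ t → t < X → W (c + t) = xs t
  readB : ∀ c, B c → ∀ t, -G ≤ t → t < Y → W (c + t) = ys t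
  nextA : ∀ c, A c → A (c + X) ∨ B (c + X)
  nextB : ∀ c, B c → A (c + Y) ∨ B (c + Y)
  prev : ∀ c, A c ∨ B c → A (c - X) ∨ B (c - Y)
  gapA : ∀ c, A c → ∀ t, 0 < t → t < X → ¬ A (c + t) ∧ ¬ B (c + t)
  gapB : ∀ c, B c → ∀ t, 0 < t → t < Y → ¬ A (c + t) ∧ ¬ B (c + t)
  perA : ∀ c, A (c + N) ↔ A c
  perB : ∀ c, B (c + N) ↔ B c
  ne : ∃ c, A c ∨ B c
  posN : 0 < N

section
variable {Γ : Type*} {xs ys : ℤ → Γ} {X Y G : ℤ} {W : ℤ → Γ} {N : ℤ} {A B A' B' : ℤ → Prop}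

theorem Blocks.swap (M : Blocks xs ys X Y G) : Blocks ys xs Y X G :=
  ⟨M.posY, M.posX, M.nonnegG, M.first.symm, M.last.symm⟩

theorem Reading.swap (R : Reading xs ys X Y G W N A B) : Reading ys xs Y X G W N B A where
  readA := R.readB
  readB := R.readA
  nextA c h := (R.nextB c h).symm
  nextB c h := (R.nextA c h).symm
  prev c h := (R.prev c h.symm).symm
  gapA c h t h0 h1 := (R.gapB c h t h0 h1).symm
  gapB c h t h0 h1 := (R.gapA c h t h0 h1).symm
  perA := R.perB
  perB := R.perA
  ne := R.ne.imp fun _ h => h.symm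
  posN := R.posN

theorem Blocks.reflect (M : Blocks xs ys X Y G) :
    Blocks (fun t => xs (X - G - 1 - t)) (fun t => ys (Y - G - 1 - t)) X Y G where
  posX := M.posX
  posY := M.posY
  nonnegG := M.nonnegG
  first := by simpa using M.last
  last := by simpa using M.first

/-- The same reading from right to left. The block at a cut `c` of the reflected word is the block
at `G - c - X` or `G - c - Y` of the original one. -/
theorem Reading.reflect (R : Reading xs ys X Y G W N A B) :
    Reading (fun t => xs (X - G - 1 - t)) (fun t => ys (Y - G - 1 - t)) X Y G
      (fun t => W (-t - 1)) N (fun c => A (G - c - X)) (fun c => B (G - c - Y)) where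
  readA c h t h0 h1 := by
    rw [← R.readA _ h _ (by omega) (by omega)]; congr 1; ring
  readB c h t h0 h1 := by
    rw [← R.readB _ h _ (by omega) (by omega)]; congr 1; ring
  nextA c h := by
    convert R.prev _ (Or.inl h) using 2 <;> ring
  nextB c h := by
    convert R.prev _ (Or.inr h) using 2 <;> ring
  prev c h := by
    rcases h with h | h
    · convert R.nextA _ h using 2 <;> ring
    · convert R.nextB _ h using 2 <;> ring
  gapA c h t h0 h1 := by
    constructor
    · intro h'
      refine (R.gapA _ h' t h0 h1).1 ?_
      convert h using 1; ring
    · intro h'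
      have h2 := R.nextB _ h'
      have h3 := R.gapA _ h (X - t) (by omega) (by omega)
      rw [show G - (c + t) - Y + Y = G - c - X + (X - t) by ring] at h2
      tauto
  gapB c h t h0 h1 := by
    constructor
    · intro h'
      have h2 := R.nextA _ h'
      have h3 := R.gapB _ h (Y - t) (by omega) (by omega)
      rw [show G - (c + t) - X + X = G - c - Y + (Y - t) by ring] at h2
      tauto
    · intro h'
      refine (R.gapB _ h' t h0 h1).2 ?_
      convert h using 1; ring
  perA c := by
    rw [← R.perA]; apply iff_of_eq; congr 1; ring
  perB c := by
    rw [← R.perB]; apply iff_of_eq; congr 1; ring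
  ne := by
    obtain ⟨c, h | h⟩ := R.ne
    · exact ⟨G - X - c, Or.inl (by convert h using 1; ring)⟩
    · exact ⟨G - Y - c, Or.inr (by convert h using 1; ring)⟩
  posN := R.posN

theorem Reading.perA_mul (R : Reading xs ys X Y G W N A B) (n c : ℤ) : A (c + n * N) ↔ A c := by
  have := (Function.Periodic.int_mul (f := A) (c := N) (fun c => propext (R.perA c)) n c)
  simp only [Int.cast_id] at this
  rw [this]

theorem Reading.perB_mul (R : Reading xs ys X Y G W N A B) (n c : ℤ) : B (c + n * N) ↔ B c :=
  R.swap.perA_mul n c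

/-- A cut that is followed by `x` in one reading is not followed by `y` in another. -/
theorem Reading.notB (M : Blocks xs ys X Y G) (R : Reading xs ys X Y G W N A B)
    (R' : Reading xs ys X Y G W N A' B') {c : ℤ} (h : A c) : ¬ B' c := by
  intro h'
  have h1 := R.readA c h 0 (by linarith [M.nonnegG]) M.posX
  have h2 := R'.readB c h' 0 (by linarith [M.nonnegG]) M.posY
  exact M.first (h1.symm.trans h2)

theorem Reading.A_of (R : Reading xs ys X Y G W N A B) (M : Blocks xs ys X Y G) {c : ℤ}
    (h : A c ∨ B c) (hW : W c = xs 0) : A c := by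
  rcases h with h | h
  · exact h
  · have h2 := R.readB c h 0 (by linarith [M.nonnegG]) M.posY
    rw [add_zero, hW] at h2
    exact (M.first h2).elim

theorem Reading.B_of (R : Reading xs ys X Y G W N A B) (M : Blocks xs ys X Y G) {c : ℤ}
    (h : A c ∨ B c) (hW : W c = ys 0) : B c :=
  R.swap.A_of M.swap h.symm hW

theorem Reading.le_of_lt (R : Reading xs ys X Y G W N A B) {c c' : ℤ} (h : A c)
    (h' : A c' ∨ B c') (hlt : c < c') : c + X ≤ c' := by
  by_contra hc
  have := R.gapA c h (c' - c) (by omega) (by omega)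
  rw [add_sub_cancel] at this
  tauto

theorem Reading.le_of_lt' (R : Reading xs ys X Y G W N A B) {c c' : ℤ} (h : B c)
    (h' : A c' ∨ B c') (hlt : c < c') : c + Y ≤ c' :=
  R.swap.le_of_lt h h'.symm hlt

theorem Reading.exists_cut_le (R : Reading xs ys X Y G W N A B) (t : ℤ) :
    ∃ c, c ≤ t ∧ (A c ∨ B c) := by
  obtain ⟨c0, h⟩ := R.ne
  refine ⟨c0 + (-|t - c0|) * N, ?_, ?_⟩
  · have := R.posN
    have h2 := neg_abs_le (t - c0)
    have h3 := abs_nonneg (t - c0)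
    nlinarith
  · rwa [R.perA_mul, R.perB_mul]

/-- Every place lies in a block. -/
theorem Reading.cover (R : Reading xs ys X Y G W N A B) (M : Blocks xs ys X Y G) (t : ℤ) :
    ∃ c, c ≤ t ∧ ((A c ∧ t < c + X) ∨ (B c ∧ t < c + Y)) := by
  have hX := M.posX
  have hY := M.posY
  obtain ⟨c, ⟨hc1, hc2⟩, hc3⟩ := Int.exists_greatest_of_bdd
    (P := fun c => c ≤ t ∧ (A c ∨ B c)) ⟨t, fun z hz => hz.1⟩ (R.exists_cut_le t)
  refine ⟨c, hc1, ?_⟩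
  rcases hc2 with h | h
  · refine Or.inl ⟨h, ?_⟩
    by_contra hc
    have h1 := hc3 (c + X) ⟨by omega, R.nextA c h⟩
    omega
  · refine Or.inr ⟨h, ?_⟩
    by_contra hc
    have h1 := hc3 (c + Y) ⟨by omega, R.nextB c h⟩
    omega

/-- By periodicity, a block that does not occur from some place on does not occur at all. -/
theorem Reading.forall_not_of_ge (R : Reading xs ys X Y G W N A B) {c0 : ℤ}
    (h : ∀ c, c0 ≤ c → ¬ B c) (c : ℤ) : ¬ B c := by
  intro hc
  refine h (c + |c0 - c| * N) ?_ ((R.perB_mul _ _).2 hc)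
  have := R.posN
  have h2 := le_abs_self (c0 - c)
  have h3 := abs_nonneg (c0 - c)
  nlinarith

/-- In a run of blocks `x`, the word read has the period `X`. -/
theorem Reading.shift (R : Reading xs ys X Y G W N A B) (M : Blocks xs ys X Y G) {c0 t : ℤ}
    (h : A c0) (hb : ∀ c, c0 ≤ c → c ≤ t → ¬ B c) (ht : c0 + X ≤ t) : W t = W (t - X) := by
  have hX := M.posX
  have hY := M.posY
  have hG := M.nonnegG
  obtain ⟨c, hct, hc⟩ := R.cover M t
  have hc0 : c0 < c := by
    by_contra hlt
    rcases hc with ⟨h1, h2⟩ | ⟨h1, h2⟩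
    · omega
    · rcases (show c ≤ c0 by omega).lt_or_eq with h3 | h3
      · have := R.le_of_lt' h1 (Or.inl h) h3
        have := R.le_of_lt h (R.nextB c h1)
        omega
      · subst h3; exact Reading.notB M R R h h1
  rcases hc with ⟨h1, h2⟩ | ⟨h1, h2⟩
  · have h3 : A (c - X) := by
      rcases R.prev c (Or.inl h1) with h3 | h3
      · exact h3
      · exfalso
        by_cases h4 : c0 ≤ c - Y
        · exact hb _ h4 (by omega) h3
        · have := R.le_of_lt' h3 (Or.inl h) (by omega)
          omega
    have e1 := R.readA _ h1 (t - c) (by omega) (by omega)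
    have e2 := R.readA _ h3 (t - c) (by omega) (by omega)
    rw [add_sub_cancel] at e1
    rw [e1, ← e2]; congr 1; ring
  · exact (hb c (by omega) hct h1).elim

/-- In a square `xx` the two occurrences of `x` have the same context on the left. -/
theorem Reading.shift_left (R : Reading xs ys X Y G W N A B) {c t : ℤ} (M : Blocks xs ys X Y G)
    (h : A c) (h' : A (c + X)) (h0 : c + X - G ≤ t) (h1 : t < c + X) : W t = W (t - X) := by
  have hX := M.posX
  have e1 := R.readA _ h' (t - c - X) (by omega) (by omega)
  have e2 := R.readA _ h (t - c - X) (by omega) (by omega)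
  rw [show t = c + X + (t - c - X) by ring, e1, ← e2]
  congr 1; ring

/-- Between two cuts the reading is a power of `y` if no block `x` begins there. -/
theorem Reading.run (R : Reading xs ys X Y G W N A B) (M : Blocks xs ys X Y G) {d0 d : ℤ}
    (h : A d0 ∨ B d0) (h' : A d ∨ B d) (hle : d0 ≤ d)
    (hA : ∀ c, d0 ≤ c → c < d → ¬ A c) :
    ∃ k : ℕ, d = d0 + k * Y ∧ ∀ m : ℕ, m < k → B (d0 + m * Y) := by
  have hY := M.posY
  obtain ⟨n, hn⟩ : ∃ n : ℕ, d - d0 ≤ n := ⟨(d - d0).toNat, by omega⟩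
  induction n generalizing d with
  | zero => exact ⟨0, by simp; omega, by simp⟩
  | succ n ih =>
    rcases hle.eq_or_lt with h1 | h1
    · exact ⟨0, by simp [h1], by simp⟩
    · have h2 : B (d - Y) ∧ d0 ≤ d - Y := by
        rcases R.prev d h' with h2 | h2
        · exfalso
          by_cases h3 : d0 ≤ d - X
          · exact hA _ h3 (by have := M.posX; omega) h2
          · have := R.le_of_lt h2 h (by omega)
            omega
        · refine ⟨h2, ?_⟩
          by_contra h3
          have := R.le_of_lt' h2 h (by omega)
          omega
      obtain ⟨k, hk, hk'⟩ := ih (Or.inr h2.1) h2.2 (fun c h3 h4 => hA c h3 (by omega)) (by omega)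
      refine ⟨k + 1, by push_cast; linarith, fun m hm => ?_⟩
      rcases Nat.lt_succ_iff_lt_or_eq.1 hm with h3 | h3
      · exact hk' m h3
      · rw [h3, ← hk]; exact h2.1

theorem Reading.read_run (R : Reading xs ys X Y G W N A B) (M : Blocks xs ys X Y G) {d0 : ℤ}
    {k : ℕ} (h : ∀ m : ℕ, m < k → B (d0 + m * Y)) {t : ℤ} (h0 : 0 ≤ t) (h1 : t < k * Y) :
    W (d0 + t) = ys (t % Y) := by
  have hY := M.posY
  have hG := M.nonnegG
  have a1 : 0 ≤ t % Y := Int.emod_nonneg _ (by omega)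
  have a2 : t % Y < Y := Int.emod_lt_of_pos _ (by omega)
  have a3 := Int.emod_add_mul_ediv t Y
  have a4 : 0 ≤ t / Y := Int.ediv_nonneg h0 hY.le
  have a5 : t / Y < k := Int.ediv_lt_of_lt_mul hY h1
  have := R.readB _ (h (t / Y).toNat (by omega)) (t % Y) (by omega) a2
  rw [← this]
  congr 1
  rw [Int.toNat_of_nonneg a4]
  linarith [mul_comm Y (t / Y)]

/-- Two readings of the same word without a common cut. -/
def Disj (A B A' B' : ℤ → Prop) : Prop := ∀ c, (A c ∨ B c) → ¬ (A' c ∨ B' c)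

theorem Disj.symm (h : Disj A B A' B') : Disj A' B' A B := fun c h1 h2 => h c h2 h1

theorem Disj.swap (h : Disj A B A' B') : Disj B A B' A' := fun c h1 h2 => h c h1.symm h2.symm

theorem Disj.reflect (h : Disj A B A' B') (R : Reading xs ys X Y G W N A B)
    (R' : Reading xs ys X Y G W N A' B') :
    Disj (fun c => A (G - c - X)) (fun c => B (G - c - Y)) (fun c => A' (G - c - X))
      (fun c => B' (G - c - Y)) := by
  intro c h1 h2
  have e1 : A (G - c) ∨ B (G - c) := by
    rcases h1 with h1 | h1
    · simpa using R.nextA _ h1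
    · simpa using R.nextB _ h1
  have e2 : A' (G - c) ∨ B' (G - c) := by
    rcases h2 with h2 | h2
    · simpa using R'.nextA _ h2
    · simpa using R'.nextB _ h2
  exact h _ e1 e2

/-- A square `xx` inside a run of blocks `y` forces the two readings to be constant. -/
theorem const_of_square_in_run (M : Blocks xs ys X Y G) (R : Reading xs ys X Y G W N A B)
    (R' : Reading xs ys X Y G W N A' B') (hd : Disj A B A' B') (hYX : Y ≤ X) {c0 e : ℤ}
    (h0 : A c0) (h1 : A (c0 + X)) (he : B' e) (hec : e < c0)
    (hrun : ∀ c, e ≤ c → c < c0 + 2 * X → ¬ A' c) :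
    (∀ c, ¬ B c) ∧ ∀ c, ¬ A' c := by
  have hX := M.posX
  have hY := M.posY
  have hG := M.nonnegG
  -- As long as one reading goes on with `x` and the other with `y`, the word has both periods `X`
  -- and `Y`. The reading that changes first, at `p`, contradicts the equation
  -- `W p = W (p - Y) = W (p - Y - X) = W (p - X)` or the same with `X` and `Y` exchanged.
  have key : ∀ n : ℕ, ∀ p, p ≤ c0 + n → (c0 ≤ p → ¬ B p) ∧ (e ≤ p → ¬ A' p) := by
    intro n
    induction n with
    | zero =>
      intro p hp
      refine ⟨fun h => ?_, fun h => hrun p h (by simp at hp; omega)⟩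
      obtain rfl : p = c0 := by simp at hp; omega
      exact Reading.notB M R R h0
    | succ n ih =>
      intro p hp
      rcases (show p ≤ c0 + n ∨ p = c0 + n + 1 by push_cast at hp; omega) with h | hpn
      · exact ih p h
      by_cases hp2 : p < c0 + 2 * X
      · refine ⟨fun h hb => ?_, fun h => hrun p h hp2⟩
        have := R.le_of_lt h0 (Or.inr hb) (by omega)
        rcases this.eq_or_lt with h2 | h2
        · rw [h2] at h1; exact Reading.notB M R R h1 hb
        · have := R.le_of_lt h1 (Or.inr hb) h2
          omega
      · have ihA : ∀ c, c0 ≤ c → c < p → ¬ B c := fun c h2 h3 => (ih c (by omega)).1 h2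
        have ihB : ∀ c, e ≤ c → c < p → ¬ A' c := fun c h2 h3 => (ih c (by omega)).2 h2
        refine ⟨fun h hb => ?_, fun h ha => ?_⟩
        · have e1 := R'.swap.shift M.swap he (t := p) (fun c h2 h3 ha => by
            rcases h3.eq_or_lt with h4 | h4
            · subst h4; exact hd _ (Or.inr hb) (Or.inl ha)
            · exact ihB c h2 h4 ha) (by omega)
          have e2 := R.shift M h0 (t := p - Y) (fun c h2 h3 => ihA c h2 (by omega)) (by omega)
          have e3 := R'.swap.shift M.swap he (t := p - X) (fun c h2 h3 => ihB c h2 (by omega))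
            (by omega)
          have e4 : A (p - X) := by
            rcases R.prev p (Or.inr hb) with h2 | h2
            · exact h2
            · exact (ihA _ (by omega) (by omega) h2).elim
          have e5 := R.readA _ e4 0 (by omega) hX
          have e6 := R.readB _ hb 0 (by omega) hY
          rw [add_zero] at e5 e6
          apply M.first
          rw [← e5, ← e6, e1, e2, e3]
          congr 1; ring
        · have e1 := R.shift M h0 (t := p) (fun c h2 h3 hb => by
            rcases h3.eq_or_lt with h4 | h4
            · subst h4; exact hd _ (Or.inr hb) (Or.inl ha)
            · exact ihA c h2 h4 hb) (by omega)
          have e2 := R'.swap.shift M.swap he (t := p - X) (fun c h2 h3 => ihB c h2 (by omega))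
            (by omega)
          have e3 := R.shift M h0 (t := p - Y) (fun c h2 h3 => ihA c h2 (by omega)) (by omega)
          have e4 : B' (p - Y) := by
            rcases R'.prev p (Or.inl ha) with h2 | h2
            · exact (ihB _ (by omega) (by omega) h2).elim
            · exact h2
          have e5 := R'.readB _ e4 0 (by omega) hY
          have e6 := R'.readA _ ha 0 (by omega) hX
          rw [add_zero] at e5 e6
          apply M.first
          rw [← e5, ← e6, e1, e2, e3]
          congr 1; ring
  exact ⟨R.forall_not_of_ge (c0 := c0) fun c hc => (key (c - c0).toNat c (by omega)).1 hc,
    R'.swap.forall_not_of_ge (c0 := c0) fun c hc =>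
      (key (c - c0).toNat c (by omega)).2 (by omega)⟩

/-- A block `x` strictly inside a square `xx` forces both readings to consist of blocks `x`. -/
theorem const_of_block_in_square (M : Blocks xs ys X Y G) (R : Reading xs ys X Y G W N A B)
    (R' : Reading xs ys X Y G W N A' B') (hd : Disj A B A' B') {c0 a : ℤ}
    (h0 : A c0) (h1 : A (c0 + X)) (ha : A' a) (hca : c0 < a) (hac : a < c0 + X) :
    (∀ c, ¬ B c) ∧ ∀ c, ¬ B' c := by
  have hX := M.posX
  have hY := M.posY
  have hG := M.nonnegG
  -- As long as one reading goes on with `x`, the word has the period `X`, and a change to `y` in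
  -- the other reading would violate it.
  have key : ∀ n : ℕ, ∀ p, p ≤ c0 + n → (c0 ≤ p → ¬ B p) ∧ (a ≤ p → ¬ B' p) := by
    intro n
    induction n with
    | zero =>
      intro p hp
      refine ⟨fun h => ?_, fun h => by simp at hp; omega⟩
      obtain rfl : p = c0 := by simp at hp; omega
      exact Reading.notB M R R h0
    | succ n ih =>
      intro p hp
      rcases (show p ≤ c0 + n ∨ p = c0 + n + 1 by push_cast at hp; omega) with h | hpn
      · exact ih p h
      have ihA : ∀ c, c0 ≤ c → c < p → ¬ B c := fun c h2 h3 => (ih c (by omega)).1 h2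
      have ihB : ∀ c, a ≤ c → c < p → ¬ B' c := fun c h2 h3 => (ih c (by omega)).2 h2
      refine ⟨fun h hb => ?_, fun h hb => ?_⟩
      · have h5 := R.le_of_lt h0 (Or.inr hb) (by omega)
        rcases h5.eq_or_lt with h2 | h2
        · rw [h2] at h1; exact Reading.notB M R R h1 hb
        · have h6 := R.le_of_lt h1 (Or.inr hb) h2
          have e1 := R'.shift M ha (t := p) (fun c h2 h3 hb' => by
            rcases h3.eq_or_lt with h4 | h4
            · subst h4; exact hd _ (Or.inr hb) (Or.inr hb')
            · exact ihB c h2 h4 hb') (by omega)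
          have e4 : A (p - X) := by
            rcases R.prev p (Or.inr hb) with h2 | h2
            · exact h2
            · exfalso
              by_cases h7 : c0 ≤ p - Y
              · exact ihA _ h7 (by omega) h2
              · have := R.le_of_lt' h2 (Or.inl h0) (by omega)
                omega
          have e5 := R.readA _ e4 0 (by omega) hX
          have e6 := R.readB _ hb 0 (by omega) hY
          rw [add_zero] at e5 e6
          apply M.first
          rw [← e5, ← e6, e1]
      · have hpa : a < p := by
          rcases h.eq_or_lt with h2 | h2
          · subst h2; exact (Reading.notB M R' R' ha hb).elim
          · exact h2
        have h5 := R'.le_of_lt ha (Or.inr hb) hpa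
        have e1 := R.shift M h0 (t := p) (fun c h2 h3 hb' => by
            rcases h3.eq_or_lt with h4 | h4
            · subst h4; exact hd _ (Or.inr hb') (Or.inr hb)
            · exact ihA c h2 h4 hb') (by omega)
        have e4 : A' (p - X) := by
          rcases R'.prev p (Or.inr hb) with h2 | h2
          · exact h2
          · exfalso
            by_cases h7 : a ≤ p - Y
            · exact ihB _ h7 (by omega) h2
            · have := R'.le_of_lt' h2 (Or.inl ha) (by omega)
              omega
        have e5 := R'.readA _ e4 0 (by omega) hX
        have e6 := R'.readB _ hb 0 (by omega) hY
        rw [add_zero] at e5 e6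
        apply M.first
        rw [← e5, ← e6, e1]
  exact ⟨R.forall_not_of_ge (c0 := c0) fun c hc => (key (c - c0).toNat c (by omega)).1 hc,
    R'.forall_not_of_ge (c0 := a) fun c hc =>
      (key (c - c0).toNat c (by omega)).2 (by omega)⟩

/-- A square `xx` is not covered by `y ^ k x`, where `y ^ k` starts left of the square and ends
inside its second half. -/
theorem false_of_run_block (M : Blocks xs ys X Y G) (R : Reading xs ys X Y G W N A B)
    (R' : Reading xs ys X Y G W N A' B') (hd : Disj A B A' B') (hYX : Y ≤ X) {c0 e d : ℤ}
    (h0 : A c0) (h1 : A (c0 + X)) (he : B' e) (hec : e < c0) (hec' : c0 < e + Y)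
    (hrun : ∀ c, e ≤ c → c < d → ¬ A' c) (h2 : A' d) (hd1 : c0 + X < d) (hd2 : d < c0 + 2 * X) :
    False := by
  have hX := M.posX
  have hY := M.posY
  have hG := M.nonnegG
  obtain ⟨r, hr, hr'⟩ := R'.cover M (c0 + X)
  have hcut : ∀ c, A' c ∨ B' c → c ≠ c0 + X := fun c h h3 => by
    subst h3; exact hd _ (Or.inl h1) h
  have prevB : ∀ c, (A' c ∨ B' c) → e < c → c ≤ d → B' (c - Y) ∧ e ≤ c - Y := by
    intro c h3 h4 h5
    rcases R'.prev c h3 with h6 | h6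
    · exfalso
      by_cases h7 : e ≤ c - X
      · exact hrun _ h7 (by omega) h6
      · have := R'.le_of_lt h6 (Or.inr he) (by omega)
        omega
    · refine ⟨h6, ?_⟩
      by_contra h7
      have := R'.le_of_lt' h6 (Or.inr he) (by omega)
      omega
  obtain ⟨hrB, hrlt⟩ : B' r ∧ c0 + X < r + Y := by
    rcases hr' with ⟨h3, h4⟩ | h3
    · exfalso
      by_cases h5 : e ≤ r
      · exact hrun r h5 (by omega) h3
      · have := R'.le_of_lt h3 (Or.inr he) (by omega)
        omega
    · exact h3
  have her : e + Y ≤ r := by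
    by_contra h3
    have := R'.le_of_lt' hrB (R'.nextB e he) (by omega)
    omega
  have hrne := hcut r (Or.inr hrB)
  have hrd := R'.le_of_lt' hrB (Or.inl h2) (by omega)
  have hB := fun t => R'.swap.shift M.swap he (t := t)
  have rd := R'.readA _ h2 0 (by omega) hX
  rw [add_zero] at rd
  by_cases hj : r + Y < d
  · obtain ⟨h3, h4⟩ := prevB d (Or.inl h2) (by omega) le_rfl
    have h5 : r + Y ≤ d - Y := by
      have := R'.le_of_lt' h3 (R'.nextB r hrB)
      by_contra h6
      omega
    have e1 := R.readA _ h1 (d - c0 - X) (by omega) (by omega)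
    have e2 := R.readA _ h1 (d - c0 - X - Y) (by omega) (by omega)
    have e3 := R.readA _ h0 (d - c0 - X) (by omega) (by omega)
    have e4 := R.readA _ h0 (d - c0 - X - Y) (by omega) (by omega)
    have e5 := hB (d - X) (fun c h3 h4 => hrun c h3 (by omega)) (by omega)
    have e6 := R'.readB _ h3 0 (by omega) hY
    rw [show c0 + X + (d - c0 - X) = d by ring] at e1
    rw [show c0 + X + (d - c0 - X - Y) = d - Y by ring] at e2
    rw [show c0 + (d - c0 - X) = d - X by ring] at e3
    rw [show c0 + (d - c0 - X - Y) = d - X - Y by ring] at e4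
    rw [add_zero] at e6
    apply M.first
    rw [← rd, e1, ← e3, e5, e4, ← e2, e6]
  · have hdr : d = r + Y := by omega
    by_cases hXY : Y < X
    · obtain ⟨h3, h4⟩ := prevB r (Or.inr hrB) (by omega) (by omega)
      have e1 := R'.readB _ h3 (Y - G - 1) (by omega) (by omega)
      have e2 := R.readA _ h0 (r - G - 1 - c0) (by omega) (by omega)
      have e3 := R.readA _ h1 (r - G - 1 - c0) (by omega) (by omega)
      have e4 := R'.readA _ h2 (X - Y - G - 1) (by omega) (by omega)
      have e5 := R.readA _ h0 (X - Y - G - 1) (by omega) (by omega)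
      have e6 := R.readA _ h0 (X - G - 1) (by omega) (by omega)
      have e7 : W (c0 + X - G - 1) = W (c0 + X - G - 1 - Y) := by
        by_cases h5 : e + Y ≤ c0 + X - G - 1
        · exact hB _ (fun c h3 h4 => hrun c h3 (by omega)) h5
        · refine R'.swap.shift_left M.swap he ?_ (by omega) (by omega)
          rcases R'.nextB e he with h6 | h6
          · exact (hrun _ (by omega) (by omega) h6).elim
          · exact h6
      apply M.last
      rw [← e6, ← e1, show c0 + (X - G - 1) = c0 + X - G - 1 by ring, e7,
        show c0 + X - G - 1 - Y = c0 + (X - Y - G - 1) by ring, e5, ← e4,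
        show r - Y + (Y - G - 1) = c0 + (r - G - 1 - c0) by ring, e2, ← e3]
      congr 1; omega
    · have hXY' : X = Y := by omega
      have e1 := R'.readB _ hrB 0 (by omega) hY
      have e2 := R.readA _ h0 (r - c0) (by omega) (by omega)
      have e3 := R.readA _ h1 (r - c0) (by omega) (by omega)
      apply M.first
      rw [← rd, ← e1, show r + 0 = c0 + (r - c0) by ring, e2, ← e3]
      congr 1; omega

end

/-! ### Disjoint readings with a square -/

section
variable {Γ : Type*} {xs ys : ℤ → Γ} {X Y G : ℤ} {W : ℤ → Γ} {N : ℤ} {A B A' B' : ℤ → Prop}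

/-- The square `xx` at `c0` is covered by `x y ^ k x`, with `y ^ k` at `d0`. -/
structure Covered (X Y : ℤ) (A A' B' : ℤ → Prop) (c0 d0 : ℤ) (k : ℕ) : Prop where
  fst : A c0
  snd : A (c0 + X)
  left : A' (d0 - X)
  right : A' (d0 + k * Y)
  mid : ∀ m : ℕ, m < k → B' (d0 + m * Y)
  lt0 : c0 < d0
  lt1 : d0 < c0 + X
  lt2 : c0 + X < d0 + k * Y
  lt3 : d0 + k * Y < c0 + 2 * X

theorem Covered.reflect {c0 d0 : ℤ} {k : ℕ} (C : Covered X Y A A' B' c0 d0 k) :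
    Covered X Y (fun c => A (G - c - X)) (fun c => A' (G - c - X)) (fun c => B' (G - c - Y))
      (G - (c0 + 2 * X)) (G - (d0 + k * Y)) k where
  fst := by convert C.snd using 1; ring
  snd := by convert C.fst using 1; ring
  left := by convert C.right using 1; ring
  right := by convert C.left using 1; ring
  mid m hm := by
    convert C.mid (k - 1 - m) (by omega) using 1
    have : ((k - 1 - m : ℕ) : ℤ) = k - 1 - m := by omega
    rw [this]; ring
  lt0 := by linarith [C.lt3]
  lt1 := by linarith [C.lt2]
  lt2 := by linarith [C.lt1]
  lt3 := by linarith [C.lt0]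

theorem Covered.overlap (M : Blocks xs ys X Y G) (R : Reading xs ys X Y G W N A B)
    (R' : Reading xs ys X Y G W N A' B') {c0 d0 : ℤ} {k : ℕ}
    (C : Covered X Y A A' B' c0 d0 k) :
    Overlap xs (fun t => ys (t % Y)) X Y (c0 + X - d0) (d0 + k * Y - (c0 + X)) := by
  have hX := M.posX
  have hG := M.nonnegG
  obtain ⟨h1, h2, h3, h4, h5, l0, l1, l2, l3⟩ := C
  have hrun := fun t => R'.read_run M h5 (t := t)
  refine ⟨M.posY, by omega, by omega, by omega, by omega, fun t => by simp, ?_, ?_, ?_, ?_, ?_⟩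
  · simpa using M.first
  · intro t ht ht'
    rw [← R.readA _ h1 t (by omega) (by omega), ← R'.readA _ h3 _ (by omega) ht']
    congr 1; ring
  · intro t ht ht'
    rw [← R'.readA _ h4 t (by omega) (by omega), ← R.readA _ h2 _ (by omega) ht']
    congr 1; ring
  · intro t ht ht'
    rw [← hrun t ht (by omega), ← R.readA _ h1 _ (by omega) (by omega)]
    congr 1; ring
  · intro t ht ht'
    rw [← hrun (t + (c0 + X - d0)) (by omega) (by omega), ← R.readA _ h2 _ (by omega) (by omega)]
    congr 1; ring

/-- The case of a single block `y` with its centre right of the centre of the square: the periods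
of `x` force a block `y` after the square, and a comparison of the two blocks `y` shows that `x`
and `y` begin with the same letter. -/
theorem Covered.false_of_one (M : Blocks xs ys X Y G) (R : Reading xs ys X Y G W N A B)
    (R' : Reading xs ys X Y G W N A' B') (hYX : Y ≤ X) {c0 d0 : ℤ}
    (C : Covered X Y A A' B' c0 d0 1) (hlt : c0 + X - d0 < d0 + Y - (c0 + X)) : False := by
  have hX := M.posX
  have hY := M.posY
  have hG := M.nonnegG
  have O := C.overlap M R R'
  obtain ⟨h1, h2, h3, h4, h5, l0, l1, l2, l3⟩ := C
  rw [Nat.cast_one, one_mul] at *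
  have hb : B' d0 := by simpa using h5 0 one_pos
  have rd := R'.readB _ hb 0 (by omega) hY
  rw [add_zero] at rd
  have e1 := O.perE (c0 + 2 * X - d0 - Y - (c0 + X - d0)) (by omega) (by omega)
  have e2 := O.perD (c0 + 2 * X - d0 - Y - (c0 + X - d0)) (by omega) (by omega)
  have e3 := R'.readA _ h4 (c0 + 2 * X - d0 - Y) (by omega) (by omega)
  have e4 := R.readA _ h1 (d0 - c0) (by omega) (by omega)
  have a0 : xs (c0 + 2 * X - d0 - Y) = ys 0 := by
    rw [← rd, show d0 = c0 + (d0 - c0) by ring, e4]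
    rw [sub_add_cancel] at e1
    rw [show c0 + 2 * X - d0 - Y - (c0 + X - d0) + (d0 + Y - (c0 + X)) = d0 - c0 by ring] at e2
    rw [show c0 + 2 * X - (c0 + (d0 - c0)) - Y = c0 + 2 * X - d0 - Y by ring, ← e1, e2]
  rw [show d0 + Y + (c0 + 2 * X - d0 - Y) = c0 + X + X by ring, a0] at e3
  have hb2 : B (c0 + X + X) := R.B_of M (R.nextA _ h2) e3
  have e5 := R.readB _ hb2 (c0 + X - d0) (by omega) (by omega)
  have e6 := R'.readB _ hb (c0 + X - d0) (by omega) (by omega)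
  have e7 := R.readA _ h2 0 (by omega) hX
  have e8 := O.perE (c0 + 2 * X - d0 - Y) (by omega) (by omega)
  have e9 := R'.readA _ h4 (c0 + 2 * X - d0 - Y + (c0 + X - d0)) (by omega) (by omega)
  apply M.first
  rw [add_zero] at e7
  rw [← e7, show c0 + X = d0 + (c0 + X - d0) by ring, e6, ← e5, ← a0, e8, ← e9]
  congr 1; ring

/-- The centre of the square cannot differ from the centre of `y ^ k`. -/
theorem Covered.false_of_ne (M : Blocks xs ys X Y G) (R : Reading xs ys X Y G W N A B)
    (R' : Reading xs ys X Y G W N A' B') (hYX : Y ≤ X) {c0 d0 : ℤ} {k : ℕ}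
    (C : Covered X Y A A' B' c0 d0 k) (hne : d0 + k * Y - (c0 + X) ≠ c0 + X - d0) : False := by
  have O := C.overlap M R R'
  have O' := C.reflect.overlap M.reflect R.reflect R'.reflect
  have hk : k ≠ 0 := by
    rintro rfl
    have := C.lt1
    have := C.lt2
    simp at this
    omega
  rcases lt_or_gt_of_ne hne with hlt | hgt
  · by_cases hk2 : 2 ≤ k
    · exact O.false_of_gt hk2 (by ring) hlt
    · obtain rfl : k = 1 := by omega
      refine C.reflect.false_of_one (G := G) M.reflect R.reflect R'.reflect hYX ?_
      simp only [Nat.cast_one, one_mul] at *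
      linarith
  · by_cases hk2 : 2 ≤ k
    · exact O'.false_of_gt hk2 (by ring) (by linarith)
    · obtain rfl : k = 1 := by omega
      refine C.false_of_one M R R' hYX ?_
      simp only [Nat.cast_one, one_mul] at *
      linarith

/-- A square `xx` covered by `x y ^ k x` has `k = 1`, and its centre is the centre of `y`. -/
theorem Covered.eq_one (M : Blocks xs ys X Y G) (R : Reading xs ys X Y G W N A B)
    (R' : Reading xs ys X Y G W N A' B') (hYX : Y ≤ X) {c0 d0 : ℤ} {k : ℕ}
    (C : Covered X Y A A' B' c0 d0 k) : k = 1 ∧ Y = 2 * (c0 + X - d0) := by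
  have hE : d0 + k * Y - (c0 + X) = c0 + X - d0 := by
    by_contra h
    exact C.false_of_ne M R R' hYX h
  have hk : k ≠ 0 := by
    rintro rfl
    have := C.lt1
    have := C.lt2
    simp at this
    omega
  have O := C.overlap M R R'
  rw [hE] at O
  have hk1 : k = 1 := by
    by_contra h
    exact O.false_of_eq (k := k) (by omega) (by linarith)
  refine ⟨hk1, ?_⟩
  subst hk1
  simp only [Nat.cast_one, one_mul] at *
  linarith

/-- The centre `c` of a square `xx` is the centre of a block `y` of the other reading, which is
preceded and followed by `x`. -/
structure Centred (X p : ℤ) (A A' B' : ℤ → Prop) (c : ℤ) : Prop where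
  fst : A (c - X)
  snd : A c
  left : A' (c - p - X)
  mid : B' (c - p)
  right : A' (c + p)

/-- The configuration at a centred square propagates, with the readings exchanged: the first
reading goes on with `y`, the second with `x`, and the square `xx` of the second reading is
centred in it. -/
theorem Centred.next (M : Blocks xs ys X Y G) (R : Reading xs ys X Y G W N A B)
    (R' : Reading xs ys X Y G W N A' B') {p c : ℤ} (hp : 0 < p) (hpX : p < X) (hY : Y = 2 * p)
    (C : Centred X p A A' B' c) : Centred X p A' A B (c + X + p) := by
  have hG := M.nonnegG
  obtain ⟨h1, h2, h3, h4, h5⟩ := C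
  have r2 := R.readA _ h2 0 (by omega) (by omega)
  have r5 := R'.readA _ h5 0 (by omega) (by omega)
  rw [add_zero] at r2 r5
  have hb : B (c + X) := by
    refine R.B_of M (R.nextA _ h2) ?_
    have e1 := R'.readA _ h5 (X - p) (by omega) (by omega)
    have e2 := R.readA _ h1 (X - p) (by omega) (by omega)
    have e3 := R'.readB _ h4 0 (by omega) (by omega)
    rw [← e3, show c + X = c + p + (X - p) by ring, e1, ← e2]
    congr 1; ring
  have ha : A' (c + p + X) := by
    refine R'.A_of M (R'.nextA _ h5) ?_
    have e1 := R.readB _ hb p (by omega) (by omega)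
    have e2 := R'.readB _ h4 p (by omega) (by omega)
    rw [← r2, show c + p + X = c + X + p by ring, e1, ← e2]
    congr 1; ring
  have ha2 : A (c + X + Y) := by
    refine R.A_of M (R.nextB _ hb) ?_
    have e1 := R'.readA _ ha p (by omega) (by omega)
    have e2 := R.readA _ h2 p (by omega) (by omega)
    rw [← r5, e2, ← e1]; congr 1; omega
  refine ⟨?_, ?_, ?_, ?_, ?_⟩
  · convert h5 using 1; ring
  · convert ha using 1; ring
  · convert h2 using 1; ring
  · convert hb using 1; ring
  · convert ha2 using 1; omega

theorem Centred.iterate (M : Blocks xs ys X Y G) (R : Reading xs ys X Y G W N A B)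
    (R' : Reading xs ys X Y G W N A' B') {p c : ℤ} (hp : 0 < p) (hpX : p < X) (hY : Y = 2 * p)
    (C : Centred X p A A' B' c) (n : ℕ) : Centred X p A A' B' (c + n * (2 * X + Y)) := by
  induction n with
  | zero => simpa using C
  | succ n ih =>
    convert (ih.next M R R' hp hpX hY).next M R' R hp hpX hY using 1
    push_cast
    rw [hY]; ring

/-- Over one period `xxy` starting at a centred square, the first reading is `x`, `x`, `y`. -/
theorem Centred.pattern (M : Blocks xs ys X Y G) (R : Reading xs ys X Y G W N A B)
    (R' : Reading xs ys X Y G W N A' B') {p c : ℤ} (hp : 0 < p) (hpX : p < X) (hY : Y = 2 * p)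
    (C : Centred X p A A' B' c) {s : ℤ} (h0 : 0 ≤ s) (h1 : s < 2 * X + Y) :
    (A (c - X + s) ↔ s = 0 ∨ s = X) ∧ (B (c - X + s) ↔ s = 2 * X) := by
  have hX := M.posX
  have hb : B (c + X) := by
    have := (C.next M R R' hp hpX hY).mid
    convert this using 1; ring
  have cut : ∀ s, 0 ≤ s → s < 2 * X + Y → A (c - X + s) ∨ B (c - X + s) →
      s = 0 ∨ s = X ∨ s = 2 * X := by
    intro s h0 h1 h
    by_contra hne
    push Not at hne
    obtain ⟨n1, n2, n3⟩ := hne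
    have := R.le_of_lt C.fst h (by omega)
    have := R.le_of_lt C.snd h (by omega)
    have := R.le_of_lt' hb h (by omega)
    omega
  constructor
  · constructor
    · intro h
      rcases cut s h0 h1 (Or.inl h) with h | h | h
      · exact Or.inl h
      · exact Or.inr h
      · subst h
        exfalso
        refine Reading.notB M R R h ?_
        convert hb using 1; ring
    · rintro (h | h)
      · subst h; simpa using C.fst
      · subst h; simpa using C.snd
  · constructor
    · intro h
      rcases cut s h0 h1 (Or.inr h) with h' | h' | h'
      · subst h'
        exfalso
        refine Reading.notB M R R C.fst ?_
        simpa using h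
      · subst h'
        exfalso
        refine Reading.notB M R R C.snd ?_
        simpa using h
      · exact h'
    · rintro rfl
      convert hb using 1; ring

/-- The two readings are shifts of each other, or one of them consists of the one block and the
other of the other block. -/
def ShiftOrConst (A B A' B' : ℤ → Prop) : Prop :=
  (∃ k, ∀ c, (A' c ↔ A (c + k)) ∧ (B' c ↔ B (c + k))) ∨
    ((∀ c, ¬ B c) ∧ ∀ c, ¬ A' c) ∨ ((∀ c, ¬ A c) ∧ ∀ c, ¬ B' c)

theorem ShiftOrConst.symm (h : ShiftOrConst A B A' B') : ShiftOrConst A' B' A B := by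
  rcases h with ⟨k, h⟩ | h | h
  · refine Or.inl ⟨-k, fun c => ?_⟩
    have := h (c + -k)
    simp only [neg_add_cancel_right] at this
    exact ⟨this.1.symm, this.2.symm⟩
  · exact Or.inr (Or.inr ⟨h.2, h.1⟩)
  · exact Or.inr (Or.inl ⟨h.2, h.1⟩)

theorem ShiftOrConst.swap (h : ShiftOrConst A B A' B') : ShiftOrConst B A B' A' := by
  rcases h with ⟨k, h⟩ | h | h
  · exact Or.inl ⟨k, fun c => (h c).symm⟩
  · exact Or.inr (Or.inr h)
  · exact Or.inr (Or.inl h)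

theorem shift_of_forall_ge (R : Reading xs ys X Y G W N A B)
    (R' : Reading xs ys X Y G W N A' B') {a k : ℤ}
    (h : ∀ c, a ≤ c → (A' c ↔ A (c + k)) ∧ (B' c ↔ B (c + k))) :
    ShiftOrConst A B A' B' := by
  refine Or.inl ⟨k, fun c => ?_⟩
  have hN := R.posN
  have h1 := h (c + |a - c| * N) (by
    have h2 := le_abs_self (a - c)
    have h3 := abs_nonneg (a - c)
    nlinarith)
  rw [R'.perA_mul, R'.perB_mul] at h1
  rwa [show c + |a - c| * N + k = c + k + |a - c| * N by ring, R.perA_mul, R.perB_mul] at h1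

/-- With a centred square both readings are repetitions of `xxy`, hence shifts of each other. -/
theorem Centred.shift (M : Blocks xs ys X Y G) (R : Reading xs ys X Y G W N A B)
    (R' : Reading xs ys X Y G W N A' B') {p c : ℤ} (hp : 0 < p) (hpX : p < X) (hY : Y = 2 * p)
    (C : Centred X p A A' B' c) : ShiftOrConst A B A' B' := by
  have hX := M.posX
  refine shift_of_forall_ge R R' (a := c + p) (k := -X - p) fun t ht => ?_
  set P := 2 * X + Y with hP
  have hP0 : 0 < P := by omega
  have a1 : 0 ≤ (t - c - p) % P := Int.emod_nonneg _ (by omega)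
  have a2 : (t - c - p) % P < P := Int.emod_lt_of_pos _ (by omega)
  have a3 := Int.emod_add_mul_ediv (t - c - p) P
  have a4 : 0 ≤ (t - c - p) / P := Int.ediv_nonneg (by omega) hP0.le
  have C1 := C.iterate M R R' hp hpX hY ((t - c - p) / P).toNat
  rw [Int.toNat_of_nonneg a4] at C1
  have b1 := C1.pattern M R R' hp hpX hY a1 a2
  have b2 := (C1.next M R R' hp hpX hY).pattern M R' R hp hpX hY a1 a2
  rw [show c + (t - c - p) / P * P - X + (t - c - p) % P = t + (-X - p) by
    linarith [mul_comm P ((t - c - p) / P)]] at b1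
  rw [show c + (t - c - p) / P * P + X + p - X + (t - c - p) % P = t by
    linarith [mul_comm P ((t - c - p) / P)]] at b2
  exact ⟨b2.1.trans b1.1.symm, b2.2.trans b1.2.symm⟩

theorem Reading.iff_dvd (M : Blocks xs ys X Y G) (R : Reading xs ys X Y G W N A B)
    (h : ∀ c, ¬ B c) {c0 : ℤ} (h0 : A c0) (c : ℤ) : A c ↔ X ∣ c - c0 := by
  have hX := M.posX
  have up : ∀ c, A c → A (c + X) := fun c hc => (R.nextA c hc).resolve_right (h _)
  have down : ∀ c, A c → A (c - X) := fun c hc =>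
    (R.prev c (Or.inl hc)).resolve_right (h _)
  have mul : ∀ n : ℤ, A (c0 + X * n) := by
    intro n
    induction n using Int.induction_on with
    | zero => simpa using h0
    | succ n ih => convert up _ ih using 1; ring
    | pred n ih => convert down _ ih using 1; ring
  constructor
  · intro hc
    have a1 : 0 ≤ (c - c0) % X := Int.emod_nonneg _ (by omega)
    have a2 : (c - c0) % X < X := Int.emod_lt_of_pos _ (by omega)
    have a3 := Int.emod_add_mul_ediv (c - c0) X
    by_contra hnd
    have a4 : (c - c0) % X ≠ 0 := fun h => hnd (Int.dvd_of_emod_eq_zero h)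
    have := R.gapA _ (mul ((c - c0) / X)) _ (by omega) a2
    apply this.1
    convert hc using 1; linarith
  · rintro ⟨n, hn⟩
    convert mul n using 1; linarith

theorem shift_of_const (M : Blocks xs ys X Y G) (R : Reading xs ys X Y G W N A B)
    (R' : Reading xs ys X Y G W N A' B') (h : ∀ c, ¬ B c) (h' : ∀ c, ¬ B' c) :
    ShiftOrConst A B A' B' := by
  obtain ⟨c, hc⟩ := R.ne
  obtain ⟨c', hc'⟩ := R'.ne
  have e := R.iff_dvd M h (hc.resolve_right (h c))
  have e' := R'.iff_dvd M h' (hc'.resolve_right (h' c'))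
  refine Or.inl ⟨c - c', fun t => ⟨?_, ?_⟩⟩
  · rw [e, e']; apply iff_of_eq; congr 1; ring
  · exact iff_of_false (h' _) (h _)

/-- Disjoint readings, one of which contains the square `xx` of the longer block. The second reading
covers the square by a power of `y`, by `y ^ k x` or its mirror image, by `x y ^ k x`, or in such a
way that a block `x` starts inside the square before the last cut. -/
theorem shiftOrConst_of_square (M : Blocks xs ys X Y G) (R : Reading xs ys X Y G W N A B)
    (R' : Reading xs ys X Y G W N A' B') (hd : Disj A B A' B') (hYX : Y ≤ X) {c0 : ℤ}
    (h0 : A c0) (h1 : A (c0 + X)) : ShiftOrConst A B A' B' := by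
  have hX := M.posX
  have hY := M.posY
  have ncut : ∀ c, A' c ∨ B' c → ¬ (A c ∨ B c) := fun c h h' => hd c h' h
  -- the block of the second reading that contains the beginning of the square
  obtain ⟨e, he, he'⟩ := R'.cover M c0
  -- the last cut of the second reading inside the square
  obtain ⟨d, ⟨hd1, hd2⟩, hd3⟩ := Int.exists_greatest_of_bdd
    (P := fun c => c < c0 + 2 * X ∧ (A' c ∨ B' c)) ⟨c0 + 2 * X, fun z hz => hz.1.le⟩ (by
      obtain ⟨c, hc, hc'⟩ := R'.exists_cut_le (c0 + 2 * X - 1)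
      exact ⟨c, by omega, hc'⟩)
  have hnext : ∀ c, A' c ∨ B' c → ∃ c', c < c' ∧ c' ≤ c + X ∧ (A' c' ∨ B' c') := by
    rintro c (h | h)
    · exact ⟨_, by omega, le_rfl, R'.nextA c h⟩
    · exact ⟨_, by omega, by omega, R'.nextB c h⟩
  have hsq2 : A (c0 + 2 * X) ∨ B (c0 + 2 * X) := by
    have := R.nextA _ h1
    rwa [show c0 + X + X = c0 + 2 * X by ring] at this
  have hdgt : c0 + X < d := by
    obtain ⟨c', h2, h3, h4⟩ := hnext d hd2
    have h5 : ¬ c' < c0 + 2 * X := fun h => by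
      have := hd3 c' ⟨h, h4⟩
      omega
    have h6 : c' ≠ c0 + 2 * X := fun h => ncut c' h4 (h ▸ hsq2)
    omega
  have hecut : A' e ∨ B' e := by tauto
  have hec : e < c0 := by
    rcases he.eq_or_lt with h | h
    · exact (ncut e hecut (Or.inl (h ▸ h0))).elim
    · exact h
  -- the first cut of the second reading inside the square
  obtain ⟨d0, hd0, hd0cut, hd0c, hdX⟩ : ∃ d0, ((A' e ∧ d0 = e + X) ∨ (B' e ∧ d0 = e + Y)) ∧
      (A' d0 ∨ B' d0) ∧ c0 < d0 ∧ d0 < c0 + X := by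
    rcases he' with ⟨h, h2⟩ | ⟨h, h2⟩
    · exact ⟨_, Or.inl ⟨h, rfl⟩, R'.nextA e h, h2, by omega⟩
    · exact ⟨_, Or.inr ⟨h, rfl⟩, R'.nextB e h, h2, by omega⟩
  by_cases hfull : ∃ a, d0 ≤ a ∧ a < d ∧ A' a
  · obtain ⟨a, ha1, ha2, ha⟩ := hfull
    have := R'.le_of_lt ha hd2 ha2
    obtain ⟨h2, h3⟩ := const_of_block_in_square M R R' hd h0 h1 ha (by omega) (by omega)
    exact shift_of_const M R R' h2 h3
  · push Not at hfull
    obtain ⟨k, hk, hk'⟩ := R'.run M hd0cut hd2 (by omega) hfull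
    have last : A' d → ∀ c, d ≤ c → c < c0 + 2 * X → A' c ∨ B' c → c = d := fun _ c h2 h3 h4 =>
      le_antisymm (hd3 c ⟨h3, h4⟩) h2
    have noA : B' e → ∀ c, e ≤ c → c < d → ¬ A' c := by
      intro hb c h2 h3 h4
      by_cases h5 : d0 ≤ c
      · exact hfull c h5 h3 h4
      · rcases h2.eq_or_lt with h6 | h6
        · subst h6; exact Reading.notB M R' R' h4 hb
        · have := R'.le_of_lt' hb (Or.inl h4) h6
          rcases hd0 with ⟨h7, -⟩ | ⟨-, h7⟩
          · exact Reading.notB M R' R' h7 hb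
          · omega
    rcases hd0 with ⟨hea, hd0e⟩ | ⟨heb, hd0e⟩
    · rcases hd2 with hda | hdb
      · have C : Covered X Y A A' B' c0 d0 k := by
          refine ⟨h0, h1, ?_, ?_, hk', hd0c, hdX, ?_, ?_⟩
          · rw [hd0e, add_sub_cancel_right]; exact hea
          · rw [← hk]; exact hda
          · rw [← hk]; exact hdgt
          · rw [← hk]; exact hd1
        obtain ⟨rfl, hp⟩ := C.eq_one M R R' hYX
        have C' : Centred X (c0 + X - d0) A A' B' (c0 + X) := by
          refine ⟨?_, h1, ?_, ?_, ?_⟩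
          · simpa using h0
          · convert C.left using 1; ring
          · convert C.mid 0 one_pos using 1; simp
          · convert C.right using 1; push_cast; omega
        exact C'.shift M R R' (by omega) (by omega) hp
      · -- the mirror image of a covering by `y ^ k x`
        exfalso
        refine false_of_run_block M.reflect R.reflect R'.reflect (hd.reflect R R') hYX
          (c0 := G - (c0 + 2 * X)) (e := G - d - Y) (d := G - d0) ?_ ?_ ?_ ?_ ?_ ?_ ?_ ?_ ?_
        · convert h1 using 1; ring
        · convert h0 using 1; ring
        · convert hdb using 1; ring
        · have h5 : ¬ d + Y < c0 + 2 * X := fun h => by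
            have := hd3 _ ⟨h, R'.nextB d hdb⟩
            omega
          have h6 : d + Y ≠ c0 + 2 * X := fun h => ncut _ (R'.nextB d hdb) (h ▸ hsq2)
          omega
        · omega
        · intro c h2 h3 h4
          by_cases h5 : G - c - X < d0
          · have := R'.le_of_lt h4 hd0cut h5
            omega
          · refine hfull _ (by omega) ?_ h4
            rcases lt_trichotomy (G - c - X) d with h6 | h6 | h6
            · exact h6
            · rw [h6] at h4; exact (Reading.notB M R' R' h4 hdb).elim
            · have := R'.le_of_lt' hdb (Or.inl h4) h6
              omega
        · convert hea using 1; omega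
        · omega
        · omega
    · rcases hd2 with hda | hdb
      · exact (false_of_run_block M R R' hd hYX h0 h1 heb hec (by omega) (noA heb) hda hdgt
          hd1).elim
      · have := const_of_square_in_run M R R' hd hYX h0 h1 heb hec (fun c h2 h3 h4 => by
          by_cases h5 : c < d
          · exact noA heb c h2 h5 h4
          · have : c = d := le_antisymm (hd3 c ⟨h3, Or.inl h4⟩) (by omega)
            subst this
            exact Reading.notB M R' R' h4 hdb)
        exact Or.inr (Or.inl this)

end

/-! ### Disjoint readings in general -/

section
variable {Γ : Type*} {xs ys : ℤ → Γ} {X Y G : ℤ} {W : ℤ → Γ} {N : ℤ} {A B A' B' : ℤ → Prop}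

/-- The block `x y` with the context of an occurrence that is preceded by `y`, so that the context
is longer by `Y` on the left. -/
def glueX (xs ys : ℤ → Γ) (X Y G : ℤ) (t : ℤ) : Γ :=
  if t < -G then ys (t + Y) else if t < X then xs t else ys (t - X)

/-- The block `y` with the context of an occurrence that is preceded by `y`. -/
def glueY (ys : ℤ → Γ) (Y G : ℤ) (t : ℤ) : Γ := if t < -G then ys (t + Y) else ys t

theorem Blocks.glue (M : Blocks xs ys X Y G) :
    Blocks (glueX xs ys X Y G) (glueY ys Y G) (X + Y) Y (G + Y) where
  posX := by linarith [M.posX, M.posY]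
  posY := M.posY
  nonnegG := by linarith [M.nonnegG, M.posY]
  first := by
    have := M.nonnegG
    have := M.posX
    simpa [glueX, glueY, not_lt.2 M.nonnegG, M.posX] using M.first
  last := by
    have h1 := M.nonnegG
    have h2 := M.posX
    rw [glueX, if_neg (by omega), if_pos (by omega), glueY, if_pos (by omega)]
    convert M.last using 2 <;> ring_nf

/-- If `xx` does not occur, every `x` is followed by `y`, and the word can be read in the blocks
`x y` and `y`: the cuts followed by `y` that are ends of blocks `x` are dropped. -/
theorem Reading.glue (M : Blocks xs ys X Y G) (R : Reading xs ys X Y G W N A B)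
    (hA : ∀ c, A c → ¬ A (c + X)) (hne : ∃ c, A c) :
    Reading (glueX xs ys X Y G) (glueY ys Y G) (X + Y) Y (G + Y) W N A
      (fun c => B c ∧ ¬ A (c - X)) := by
  have hX := M.posX
  have hY := M.posY
  have hG := M.nonnegG
  have nb : ∀ c, A c → B (c + X) := fun c h => (R.nextA c h).resolve_left (hA c h)
  have pb : ∀ c, A c → B (c - Y) := fun c h => (R.prev c (Or.inl h)).resolve_left fun h' =>
    hA _ h' (by simpa using h)
  have aft : ∀ c, B c → ¬ A (c + Y - X) := by
    intro c h h'
    rcases lt_trichotomy c (c + Y - X) with h1 | h1 | h1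
    · have := R.le_of_lt' h (Or.inl h') h1
      omega
    · rw [← h1] at h'; exact Reading.notB M R R h' h
    · have := R.le_of_lt h' (Or.inr h) h1
      omega
  refine ⟨?_, ?_, ?_, ?_, ?_, ?_, ?_, R.perA, ?_, ?_, R.posN⟩
  · intro c h t h0 h1
    rw [glueX]
    split_ifs with h2 h3
    · rw [← R.readB _ (pb c h) _ (by omega) (by omega)]; congr 1; ring
    · exact R.readA c h t (by omega) h3
    · rw [← R.readB _ (nb c h) _ (by omega) (by omega)]; congr 1; ring
  · rintro c ⟨h, h'⟩ t h0 h1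
    rw [glueY]
    split_ifs with h2
    · rw [← R.readB _ ((R.prev c (Or.inr h)).resolve_left h') _ (by omega) (by omega)]
      congr 1; ring
    · exact R.readB c h t (by omega) h1
  · intro c h
    have h1 := R.nextB _ (nb c h)
    have h2 := aft _ (nb c h)
    rw [← add_assoc]
    tauto
  · rintro c ⟨h, h'⟩
    have h1 := R.nextB _ h
    have h2 := aft _ h
    tauto
  · intro c h
    have h1 : B (c - Y) := by
      rcases h with h | ⟨h, h'⟩
      · exact pb c h
      · exact (R.prev c (Or.inr h)).resolve_left h'
    rw [show c - (X + Y) = c - Y - X by ring]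
    tauto
  · intro c h t h0 h1
    have key : t ≠ X → ¬ (A (c + t) ∨ B (c + t)) := by
      intro hne h2
      have h3 := R.le_of_lt h h2 (by omega)
      have := R.le_of_lt' (nb c h) h2 (by omega)
      omega
    by_cases hc : t = X
    · subst hc
      exact ⟨hA c h, fun h2 => h2.2 (by simpa using h)⟩
    · have := key hc
      tauto
  · rintro c ⟨h, h'⟩ t h0 h1
    have := R.gapB c h t h0 h1
    tauto
  · intro c
    rw [R.perB, show c + N - X = c - X + N by ring, R.perA]
  · exact hne.imp fun c h => Or.inl h

/-- If one reading is a repetition of `y`, an isolated block `x` of the other would break the period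
`Y`. -/
theorem shiftOrConst_of_noA (M : Blocks xs ys X Y G) (R : Reading xs ys X Y G W N A B)
    (R' : Reading xs ys X Y G W N A' B') (hA : ∀ c, ¬ A c) (hA' : ∀ c, A' c → ¬ A' (c + X)) :
    ShiftOrConst A B A' B' := by
  by_cases h : ∃ c, A' c
  · exfalso
    obtain ⟨c, hc⟩ := h
    have h1 : B' (c - Y) := (R'.prev c (Or.inl hc)).resolve_left fun h =>
      hA' _ h (by simpa using hc)
    obtain ⟨c0, h2, h3⟩ := R.exists_cut_le (c - Y)
    have e1 := R.swap.shift M.swap (h3.resolve_left (hA _)) (t := c) (fun _ _ _ => hA _) (by omega)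
    have e2 := R'.readA _ hc 0 (by linarith [M.nonnegG]) M.posX
    have e3 := R'.readB _ h1 0 (by linarith [M.nonnegG]) M.posY
    rw [add_zero] at e2 e3
    exact M.first (by rw [← e2, e1, e3])
  · push Not at h
    exact (shift_of_const M.swap R.swap R'.swap hA h).swap

theorem ShiftOrConst.of_glue (R : Reading xs ys X Y G W N A B)
    (R' : Reading xs ys X Y G W N A' B')
    (hA : ∀ c, A c → ¬ A (c + X)) (hne : ∃ c, A c)
    (hA' : ∀ c, A' c → ¬ A' (c + X)) (hne' : ∃ c, A' c)
    (h : ShiftOrConst A (fun c => B c ∧ ¬ A (c - X)) A' (fun c => B' c ∧ ¬ A' (c - X))) :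
    ShiftOrConst A B A' B' := by
  have nb : ∀ c, A (c - X) → B c := fun c h => by
    simpa using (R.nextA _ h).resolve_left (hA _ h)
  have nb' : ∀ c, A' (c - X) → B' c := fun c h => by
    simpa using (R'.nextA _ h).resolve_left (hA' _ h)
  rcases h with ⟨k, h⟩ | ⟨-, h⟩ | ⟨h, -⟩
  · refine Or.inl ⟨k, fun c => ⟨(h c).1, ?_⟩⟩
    have h1 := (h c).2
    have h2 := (h (c - X)).1
    rw [show c - X + k = c + k - X by ring] at h2
    have h3 := nb (c + k)
    have h4 := nb' c
    tauto
  · obtain ⟨c, hc⟩ := hne'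
    exact (h c hc).elim
  · obtain ⟨c, hc⟩ := hne
    exact (h c hc).elim

/-- Two disjoint readings of a periodic word are shifts of each other or repetitions of different
blocks. If the longer block `x` occurs squared, the overlaps decide; otherwise `x y` replaces `x`.
The longer block grows with each step, but a block is not longer than the period `N`. -/
theorem shiftOrConst_of_disj (M : Blocks xs ys X Y G) (R : Reading xs ys X Y G W N A B)
    (R' : Reading xs ys X Y G W N A' B') (hd : Disj A B A' B') : ShiftOrConst A B A' B' := by
  wlog hYX : Y ≤ X generalizing xs ys X Y A B A' B'
  · exact (this M.swap R.swap R'.swap hd.swap (by omega)).swap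
  obtain ⟨n, hn⟩ : ∃ n : ℕ, N - X ≤ n := ⟨(N - X).toNat, by omega⟩
  induction n generalizing xs ys X G B B' with
  | zero =>
    by_cases h : ∃ c, A c ∧ A (c + X)
    · obtain ⟨c, h0, h1⟩ := h
      exact shiftOrConst_of_square M R R' hd hYX h0 h1
    by_cases h' : ∃ c, A' c ∧ A' (c + X)
    · obtain ⟨c, h0, h1⟩ := h'
      exact (shiftOrConst_of_square M R' R hd.symm hYX h0 h1).symm
    push Not at h h'
    by_cases hA : ∃ c, A c
    · exfalso
      obtain ⟨c, hc⟩ := hA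
      have h1 := R.le_of_lt hc (Or.inl ((R.perA c).2 hc)) (by linarith [R.posN])
      obtain rfl : N = X := by simp at hn; omega
      exact h c hc ((R.perA c).2 hc)
    · push Not at hA
      exact shiftOrConst_of_noA M R R' hA h'
  | succ n ih =>
    by_cases h : ∃ c, A c ∧ A (c + X)
    · obtain ⟨c, h0, h1⟩ := h
      exact shiftOrConst_of_square M R R' hd hYX h0 h1
    by_cases h' : ∃ c, A' c ∧ A' (c + X)
    · obtain ⟨c, h0, h1⟩ := h'
      exact (shiftOrConst_of_square M R' R hd.symm hYX h0 h1).symm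
    push Not at h h'
    by_cases hA : ∃ c, A c
    · by_cases hA' : ∃ c, A' c
      · have hY := M.posY
        refine ShiftOrConst.of_glue R R' h hA h' hA' ?_
        exact ih M.glue (R.glue M h hA) (R'.glue M h' hA')
          (fun c h1 h2 => hd c (h1.imp id And.left) (h2.imp id And.left)) (by have := M.posX; omega)
          (by push_cast at hn; omega)
      · push Not at hA'
        exact (shiftOrConst_of_noA M R' R hA' h).symm
    · push Not at hA
      exact shiftOrConst_of_noA M R R' hA h'

/-- Two readings with a common cut have the same cuts. -/
theorem cut_of_common_cut (M : Blocks xs ys X Y G) (R : Reading xs ys X Y G W N A B)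
    (R' : Reading xs ys X Y G W N A' B') {c : ℤ} (h : A c ∨ B c) (h' : A' c ∨ B' c) {p : ℤ}
    (hp : A p ∨ B p) : A' p ∨ B' p := by
  have hX := M.posX
  have hY := M.posY
  have key : ∀ n : ℕ, ∀ p, c ≤ p → p ≤ c + n → (A p ∨ B p) → (A' p ∨ B' p) := by
    intro n
    induction n with
    | zero =>
      intro p h0 h1 _
      obtain rfl : p = c := by simp at h1; omega
      exact h'
    | succ n ih =>
      intro p h0 h1 h2
      rcases h0.eq_or_lt with h3 | h3
      · rwa [← h3]
      rcases R.prev p h2 with h4 | h4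
      · have h5 : c ≤ p - X := by
          by_contra h5
          have := R.le_of_lt h4 h (by omega)
          omega
        have h6 := ih _ h5 (by push_cast at h1; omega) (Or.inl h4)
        rcases h6 with h6 | h6
        · simpa using R'.nextA _ h6
        · exact (Reading.notB M R R' h4 h6).elim
      · have h5 : c ≤ p - Y := by
          by_contra h5
          have := R.le_of_lt' h4 h (by omega)
          omega
        have h6 := ih _ h5 (by push_cast at h1; omega) (Or.inr h4)
        rcases h6 with h6 | h6
        · exact (Reading.notB M R' R h6 h4).elim
        · simpa using R'.nextB _ h6
  have hN := R.posN
  have h2 := le_abs_self (c - p)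
  have h3 := abs_nonneg (c - p)
  have h4 : c ≤ p + |c - p| * N := by nlinarith
  have := key (p + |c - p| * N - c).toNat _ h4 (by omega) (by rwa [R.perA_mul, R.perB_mul])
  rwa [R'.perA_mul, R'.perB_mul] at this

end

/-! ### The common prefix and suffix of products of two words -/

section
variable {Γ : Type*}

theorem exists_branch {u v : List Γ} (hl : u.length = v.length) (hne : u ≠ v) :
    ∃ (α : List Γ) (a b : Γ), a ≠ b ∧ α ++ [a] <+: u ∧ α ++ [b] <+: v := by
  induction u generalizing v with
  | nil =>
    cases v with
    | nil => exact (hne rfl).elim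
    | cons b v => simp at hl
  | cons a u ih =>
    cases v with
    | nil => simp at hl
    | cons b v =>
      by_cases hab : a = b
      · subst hab
        obtain ⟨α, c, d, h1, h2, h3⟩ := ih (by simpa using hl) (by simpa using hne)
        exact ⟨a :: α, c, d, h1, by simpa using h2, by simpa using h3⟩
      · exact ⟨[], a, b, hab, by simp, by simp⟩

/-- The products `f 0 f 1` and `f 1 f 0` have the same length and differ, hence branch after a
common prefix, which is a prefix of every product that is long enough. -/
theorem exists_right_mark {f : Fin 2 → List Γ} (hf : f 0 ++ f 1 ≠ f 1 ++ f 0) :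
    ∃ (α : List Γ) (e : Fin 2 → Γ), e 0 ≠ e 1 ∧ (∀ i, α ++ [e i] <+: f i ++ α) ∧
      α.length < (f 0).length + (f 1).length := by
  have h0 : f 0 ≠ [] := fun h => hf (by simp [h])
  have h1 : f 1 ≠ [] := fun h => hf (by simp [h])
  obtain ⟨α, a, b, hab, ha, hb⟩ := exists_branch (by simp [add_comm]) hf
  have l0 := List.length_pos_iff.2 h0
  have l1 := List.length_pos_iff.2 h1
  refine ⟨α, ![a, b], hab, ?_, ?_⟩
  · intro i
    fin_cases i
    · refine List.prefix_of_prefix_length_le (l₃ := f 0 ++ (f 1 ++ f 0)) ?_ ?_ ?_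
      · exact ha.trans ⟨f 0, by simp⟩
      · refine (List.prefix_append_right_inj _).2 ?_
        exact (List.prefix_append _ _).trans hb
      · simp; omega
    · refine List.prefix_of_prefix_length_le (l₃ := f 1 ++ (f 0 ++ f 1)) ?_ ?_ ?_
      · exact hb.trans ⟨f 1, by simp⟩
      · refine (List.prefix_append_right_inj _).2 ?_
        exact (List.prefix_append _ _).trans ha
      · simp; omega
  · have := ha.length_le
    simp at this
    omega

/-- For letters with non-commuting images `f 0` and `f 1`: the words `α` and `γ` are the longest
common prefix and suffix of the long products that begin, respectively end, with different words
`f i`. -/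
structure Marks (f : Fin 2 → List Γ) (α γ : List Γ) : Prop where
  /-- After `α` the products that begin with `f 0` and those that begin with `f 1` differ. -/
  right : ∃ e : Fin 2 → Γ, e 0 ≠ e 1 ∧ ∀ i, α ++ [e i] <+: f i ++ α
  /-- Before `γ` the products that end with `f 0` and those that end with `f 1` differ. -/
  left : ∃ e : Fin 2 → Γ, e 0 ≠ e 1 ∧ ∀ i, e i :: γ <:+ γ ++ f i
  lt : α.length < (f 0).length + (f 1).length

theorem exists_marks {f : Fin 2 → List Γ} (hf : f 0 ++ f 1 ≠ f 1 ++ f 0) :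
    ∃ α γ, Marks f α γ := by
  obtain ⟨α, e, h1, h2, h3⟩ := exists_right_mark hf
  obtain ⟨γ, e', h1', h2', -⟩ := exists_right_mark (f := fun i => (f i).reverse) (by
    intro h
    apply hf
    have := congrArg List.reverse h
    simpa using this.symm)
  refine ⟨α, γ.reverse, ⟨e, h1, h2⟩, ⟨e', h1', fun i => ?_⟩, h3⟩
  have := List.reverse_suffix.2 (h2' i)
  simpa using this

variable {f : Fin 2 → List Γ} {α γ : List Γ}

theorem Marks.length_pos (M : Marks f α γ) (i : Fin 2) : 0 < (f i).length := by
  obtain ⟨e, -, h⟩ := M.right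
  have := (h i).length_le
  simp at this
  omega

theorem Marks.prefix (M : Marks f α γ) (w : List (Fin 2)) : α <+: w.flatMap f ++ α := by
  obtain ⟨e, -, h⟩ := M.right
  induction w with
  | nil => simp
  | cons i w ih =>
    rw [List.flatMap_cons, List.append_assoc]
    exact ((List.prefix_append _ _).trans (h i)).trans ((List.prefix_append_right_inj _).2 ih)

theorem Marks.suffix (M : Marks f α γ) (w : List (Fin 2)) : γ <:+ γ ++ w.flatMap f := by
  obtain ⟨e, -, h⟩ := M.left
  induction w using List.reverseRecOn with
  | nil => simp
  | append_singleton w i ih =>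
    rw [List.flatMap_append, ← List.append_assoc]
    have h1 : γ <:+ γ ++ f i := (List.suffix_cons _ _).trans (h i)
    refine h1.trans ?_
    obtain ⟨r, hr⟩ := ih
    exact ⟨r, by rw [← List.append_assoc, hr]; simp⟩

theorem Marks.prefix_of_le (M : Marks f α γ) {w : List (Fin 2)}
    (h : α.length ≤ (w.flatMap f).length) : α <+: w.flatMap f :=
  List.prefix_of_prefix_length_le (M.prefix w) (List.prefix_append _ _) h

theorem Marks.suffix_of_le (M : Marks f α γ) {w : List (Fin 2)}
    (h : γ.length ≤ (w.flatMap f).length) : γ <:+ w.flatMap f :=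
  List.suffix_of_suffix_length_le (M.suffix w) (List.suffix_append _ _) h

/-! ### The readings given by a repeated word -/

/-- The word `l` can be read in `W` at the position `c`. -/
def ReadsAt (W : ℤ → Option Γ) (c : ℤ) (l : List Γ) : Prop :=
  ∀ i : ℕ, i < l.length → W (c + i) = l[i]?

variable {W : ℤ → Option Γ} {c : ℤ} {l l' : List Γ}

theorem readsAt_append : ReadsAt W c (l ++ l') ↔ ReadsAt W c l ∧ ReadsAt W (c + l.length) l' := by
  constructor
  · intro h
    refine ⟨fun i hi => ?_, fun i hi => ?_⟩
    · rw [h i (by simp; omega), List.getElem?_append_left hi]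
    · have := h (l.length + i) (by simpa using hi)
      rw [List.getElem?_append_right (by omega)] at this
      push_cast at this
      rw [add_assoc, this]
      congr 1; omega
  · rintro ⟨h1, h2⟩ i hi
    by_cases h : i < l.length
    · rw [h1 i h, List.getElem?_append_left h]
    · have := h2 (i - l.length) (by simp at hi; omega)
      rw [List.getElem?_append_right (by omega), ← this]
      congr 1; omega

theorem ReadsAt.prefix (h : ReadsAt W c l') (hp : l <+: l') : ReadsAt W c l := by
  obtain ⟨r, rfl⟩ := hp
  exact (readsAt_append.1 h).1

theorem ReadsAt.suffix (h : ReadsAt W c l') (hp : l <:+ l') :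
    ReadsAt W (c + l'.length - l.length) l := by
  obtain ⟨r, rfl⟩ := hp
  convert (readsAt_append.1 h).2 using 1
  push_cast [List.length_append]; ring

theorem ReadsAt.eq (h : ReadsAt W c l) (h' : ReadsAt W c l') (hl : l.length = l'.length) :
    l = l' := by
  apply List.ext_getElem?
  intro i
  by_cases hi : i < l.length
  · rw [← h i hi, ← h' i (hl ▸ hi)]
  · rw [List.getElem?_eq_none (by omega), List.getElem?_eq_none (by omega)]

theorem ReadsAt.shift (h : ReadsAt W c l) {d : ℤ} (hW : Function.Periodic W d) :
    ReadsAt W (c + d) l := by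
  intro i hi
  rw [← h i hi, ← hW (c + i)]
  congr 1; ring

/-- In the two-sided repetition of the image of `g` under `f`, with an image of `g` beginning at
`o`, the place `c` is the beginning of the image of an occurrence of the letter `i`. -/
def CutAt (f : Fin 2 → List Γ) (g : List (Fin 2)) (o : ℤ) (i : Fin 2) (c : ℤ) : Prop :=
  ∃ p q, ∃ k : ℤ, g = p ++ i :: q ∧ c = o + k * (g.flatMap f).length + (p.flatMap f).length

/-- The image of the letter `i` with the context `γ`, `α` of all its occurrences, as a function on
the integers; the origin is the place after the prefix `α` of what follows the cut, as `Blocks`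
demands. -/
def block (f : Fin 2 → List Γ) (α γ : List Γ) (i : Fin 2) (t : ℤ) : Option Γ :=
  (γ ++ f i ++ α)[(t + (α.length + γ.length)).toNat]?

theorem Marks.blocks (M : Marks f α γ) :
    Blocks (block f α γ 0) (block f α γ 1) (f 0).length (f 1).length (α.length + γ.length) where
  posX := by exact_mod_cast M.length_pos 0
  posY := by exact_mod_cast M.length_pos 1
  nonnegG := by positivity
  first := by
    obtain ⟨e, h1, h2⟩ := M.right
    have key : ∀ i, block f α γ i 0 = some (e i) := by
      intro i
      obtain ⟨r, hr⟩ := h2 i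
      rw [block, List.append_assoc, ← hr, List.getElem?_append_right (by omega)]
      rw [show ((0 : ℤ) + (α.length + γ.length)).toNat - γ.length = α.length by omega]
      simp
    rw [key, key]
    simpa using h1
  last := by
    obtain ⟨e, h1, h2⟩ := M.left
    have key : ∀ i, block f α γ i ((f i).length - (α.length + γ.length) - 1) = some (e i) := by
      intro i
      obtain ⟨r, hr⟩ := h2 i
      have hl := congrArg List.length hr
      simp only [List.length_append, List.length_cons] at hl
      rw [block, ← hr,
        show ((f i).length - (α.length + γ.length : ℤ) - 1 + (α.length + γ.length)).toNat
          = r.length by omega]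
      simp
    rw [key, key]
    simpa using h1

theorem length_le_flatMap (M : Marks f α γ) (w : List (Fin 2)) :
    w.length ≤ (w.flatMap f).length := by
  induction w with
  | nil => simp
  | cons i w ih =>
    have := M.length_pos i
    simp only [List.flatMap_cons, List.length_append, List.length_cons]
    omega

theorem readsAt_power {g : List (Fin 2)} {o : ℤ}
    (hW : ∀ k : ℤ, ReadsAt W (o + k * (g.flatMap f).length) (g.flatMap f)) (n : ℕ) :
    ∀ k : ℤ, ReadsAt W (o + k * (g.flatMap f).length)
      ((List.replicate n g).flatten.flatMap f) := by
  induction n with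
  | zero => intro k i hi; simp at hi
  | succ n ih =>
    intro k
    rw [List.replicate_succ, List.flatten_cons, List.flatMap_append, readsAt_append]
    refine ⟨hW k, ?_⟩
    convert ih (k + 1) using 1
    ring

theorem length_replicate_flatMap (g : List (Fin 2)) (n : ℕ) :
    ((List.replicate n g).flatten.flatMap f).length = n * (g.flatMap f).length := by
  induction n with
  | zero => simp
  | succ n ih =>
    rw [List.replicate_succ, List.flatten_cons, List.flatMap_append, List.length_append, ih]
    ring

/-- At a cut followed by the letter `i`, the word `f i` is read together with the context that
every occurrence has. -/
theorem CutAt.readsAt (M : Marks f α γ) {g : List (Fin 2)} (hg : g ≠ []) {o : ℤ}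
    (hW : ∀ k : ℤ, ReadsAt W (o + k * (g.flatMap f).length) (g.flatMap f)) {i : Fin 2} {c : ℤ}
    (h : CutAt f g o i c) : ReadsAt W (c - γ.length) (γ ++ f i ++ α) := by
  obtain ⟨p, q, k, hpq, hc⟩ := h
  set n := α.length + γ.length with hn
  set u := (List.replicate n g).flatten with hu
  have hgl : 1 ≤ (g.flatMap f).length :=
    (List.length_pos_iff.2 hg).trans_le (length_le_flatMap M g)
  have hul : n ≤ (u.flatMap f).length := by
    rw [hu, length_replicate_flatMap]
    exact Nat.le_mul_of_pos_right n hgl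
  have hul' : (u.flatMap f).length = n * (g.flatMap f).length := by
    rw [hu, length_replicate_flatMap]
  have big : ReadsAt W (o + (k - n) * (g.flatMap f).length)
      ((u ++ p).flatMap f ++ (f i ++ (q ++ u).flatMap f)) := by
    have h1 := readsAt_power hW n (k - n)
    have h2 := hW k
    have h3 := readsAt_power hW n (k + 1)
    have h4 : (u ++ p).flatMap f ++ (f i ++ (q ++ u).flatMap f)
        = u.flatMap f ++ (g.flatMap f ++ u.flatMap f) := by
      rw [hpq]; simp
    rw [h4, readsAt_append, readsAt_append]
    refine ⟨h1, ?_, ?_⟩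
    · convert h2 using 1
      rw [hul']; push_cast; ring
    · convert h3 using 1
      rw [hul']; push_cast; ring
  rw [readsAt_append] at big
  have hs : γ <:+ (u ++ p).flatMap f := M.suffix_of_le (by
    simp only [List.flatMap_append, List.length_append]; omega)
  have hp : f i ++ α <+: f i ++ (q ++ u).flatMap f :=
    (List.prefix_append_right_inj _).2 (M.prefix_of_le (by
      simp only [List.flatMap_append, List.length_append]; omega))
  have b1 := big.1.suffix hs
  have b2 := big.2.prefix hp
  have hlen : o + (k - n) * (g.flatMap f).length + ((u ++ p).flatMap f).length = c := by
    rw [hc, List.flatMap_append, List.length_append, hul']; push_cast; ring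
  rw [hlen] at b1 b2
  rw [List.append_assoc, readsAt_append]
  refine ⟨b1, ?_⟩
  simpa using b2

/-- The repetition of the image of `g` is a reading. The cuts of the reading are those of the word
advanced by the length of `α`. -/
theorem reading_of_word (M : Marks f α γ) {g : List (Fin 2)} (hg : g ≠ []) {o : ℤ}
    (hW : ∀ k : ℤ, ReadsAt W (o + k * (g.flatMap f).length) (g.flatMap f)) {N : ℤ} (hN : 0 < N)
    (hgN : ((g.flatMap f).length : ℤ) ∣ N) :
    Reading (block f α γ 0) (block f α γ 1) (f 0).length (f 1).length (α.length + γ.length) W N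
      (fun c => CutAt f g o 0 (c - α.length)) (fun c => CutAt f g o 1 (c - α.length)) := by
  have hgl : 1 ≤ (g.flatMap f).length :=
    (List.length_pos_iff.2 hg).trans_le (length_le_flatMap M g)
  set P := (g.flatMap f).length with hP
  have read : ∀ i c, CutAt f g o i (c - α.length) → ∀ t : ℤ, -(α.length + γ.length) ≤ t →
      t < (f i).length → W (c + t) = block f α γ i t := by
    intro i c h t h0 h1
    have h2 := h.readsAt M hg hW (t + (α.length + γ.length)).toNat (by
      simp only [List.length_append]; omega)
    rw [block, ← h2]
    congr 1; omega
  have or2 : ∀ {Q : Fin 2 → Prop}, (∃ j, Q j) → Q 0 ∨ Q 1 := by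
    rintro Q ⟨j, hj⟩
    fin_cases j
    · exact Or.inl hj
    · exact Or.inr hj
  have next : ∀ i c, CutAt f g o i c → ∃ j, CutAt f g o j (c + (f i).length) := by
    rintro i c ⟨p, q, k, hpq, hc⟩
    cases q with
    | cons j q =>
      refine ⟨j, p ++ [i], q, k, by simp [hpq], ?_⟩
      rw [hc]; simp; ring
    | nil =>
      obtain ⟨j, r, hr⟩ := List.exists_cons_of_ne_nil hg
      refine ⟨j, [], r, k + 1, by simp [hr], ?_⟩
      have : P = (p.flatMap f).length + (f i).length := by rw [hP, hpq]; simp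
      rw [hc, ← hP, this]; push_cast; simp; ring
  have prev : ∀ i c, CutAt f g o i c → ∃ j, CutAt f g o j (c - (f j).length) := by
    rintro i c ⟨p, q, k, hpq, hc⟩
    induction p using List.reverseRecOn with
    | append_singleton p j _ =>
      refine ⟨j, p, i :: q, k, by simp [hpq], ?_⟩
      rw [hc, List.flatMap_append, List.length_append]
      push_cast
      simp [-List.length_flatMap]
      ring
    | nil =>
      obtain ⟨r, j, hr⟩ : ∃ r j, g = r ++ [j] :=
        ⟨_, _, (List.dropLast_concat_getLast hg).symm⟩
      refine ⟨j, r, [], k - 1, by simp [hr], ?_⟩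
      have : P = (r.flatMap f).length + (f j).length := by rw [hP, hr]; simp
      rw [hc, ← hP, this]; push_cast; simp; ring
  have gap : ∀ i c, CutAt f g o i c → ∀ t : ℤ, 0 < t → t < (f i).length →
      ∀ j, ¬ CutAt f g o j (c + t) := by
    rintro i c ⟨p, q, k, hpq, hc⟩ t h0 h1 j ⟨p', q', k', hpq', hc'⟩
    rw [← hP] at hc hc'
    have l1 : P = (p.flatMap f).length + (f i).length + (q.flatMap f).length := by
      rw [hP, hpq]; simp; ring
    have l2 : P = (p'.flatMap f).length + (f j).length + (q'.flatMap f).length := by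
      rw [hP, hpq']; simp; ring
    have l3 := M.length_pos j
    have hk : k' = k := by
      have h2 : (k' - k) * P < 1 * P := by rw [sub_mul]; omega
      have h3 : (-1) * P < (k' - k) * P := by rw [sub_mul]; omega
      have h4 := lt_of_mul_lt_mul_right h2 (by omega)
      have h5 := lt_of_mul_lt_mul_right h3 (by omega)
      omega
    subst hk
    have h4 : (p.flatMap f).length < (p'.flatMap f).length := by omega
    have h5 : p' <+: g := ⟨j :: q', hpq'.symm⟩
    have h6 : p ++ [i] <+: g := ⟨q, by simp [hpq]⟩
    rcases List.prefix_or_prefix_of_prefix h5 h6 with ⟨r, hr⟩ | ⟨r, hr⟩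
    · rcases List.eq_nil_or_concat r with h7 | ⟨r', x, h7⟩
      · subst h7
        have := congrArg (fun l => (l.flatMap f).length) hr
        simp [-List.length_flatMap] at this
        omega
      · subst h7
        rw [List.concat_eq_append, ← List.append_assoc] at hr
        have := (List.append_inj' hr rfl).1
        have := congrArg (fun l => (l.flatMap f).length) this
        simp [-List.length_flatMap] at this
        omega
    · have := congrArg (fun l => (l.flatMap f).length) hr
      simp [-List.length_flatMap] at this
      omega
  have per : ∀ i c, CutAt f g o i (c + N - α.length) ↔ CutAt f g o i (c - α.length) := by
    obtain ⟨s, hs⟩ := hgN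
    intro i c
    constructor
    · rintro ⟨p, q, k, hpq, hc⟩
      exact ⟨p, q, k - s, hpq, by rw [← hP] at hc ⊢; linarith [mul_comm s (P : ℤ)]⟩
    · rintro ⟨p, q, k, hpq, hc⟩
      exact ⟨p, q, k + s, hpq, by rw [← hP] at hc ⊢; linarith [mul_comm s (P : ℤ)]⟩
  refine ⟨read 0, read 1, ?_, ?_, ?_, ?_, ?_, per 0, per 1, ?_, hN⟩
  · intro c h
    have := or2 (next 0 _ h)
    rwa [show c - α.length + (f 0).length = c + (f 0).length - (α.length : ℤ) by ring] at this
  · intro c h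
    have := or2 (next 1 _ h)
    rwa [show c - α.length + (f 1).length = c + (f 1).length - (α.length : ℤ) by ring] at this
  · intro c h
    have h1 : ∃ j, CutAt f g o j (c - α.length - (f j).length) := by
      rcases h with h | h
      · exact prev 0 _ h
      · exact prev 1 _ h
    have := or2 h1
    rwa [sub_right_comm, sub_right_comm c (α.length : ℤ)] at this
  · intro c h t h0 h1
    have := gap 0 _ h t h0 h1
    rw [show c - α.length + t = c + t - (α.length : ℤ) by ring] at this
    exact ⟨this 0, this 1⟩
  · intro c h t h0 h1
    have := gap 1 _ h t h0 h1
    rw [show c - α.length + t = c + t - (α.length : ℤ) by ring] at this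
    exact ⟨this 0, this 1⟩
  · obtain ⟨j, r, hr⟩ := List.exists_cons_of_ne_nil hg
    exact ⟨o + α.length, or2 (Q := fun i => CutAt f g o i (o + α.length - α.length))
      ⟨j, [], r, 0, by simp [hr], by simp⟩⟩

end

/-! ### Conjugate blocks -/

section
variable {Γ : Type*} {xs ys : ℤ → Γ} {X Y G : ℤ} {W : ℤ → Γ} {N : ℤ} {A B A' B' : ℤ → Prop}

/-- Blocks of equal length: the cuts form a residue class. -/
theorem Reading.cut_iff_dvd (M : Blocks xs ys X X G) (R : Reading xs ys X X G W N A B)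
    {c0 : ℤ} (h0 : A c0 ∨ B c0) (c : ℤ) : (A c ∨ B c) ↔ X ∣ c - c0 := by
  have hX := M.posX
  have up : ∀ c, A c ∨ B c → A (c + X) ∨ B (c + X) := fun c hc =>
    hc.elim (R.nextA c) (R.nextB c)
  have down : ∀ c, A c ∨ B c → A (c - X) ∨ B (c - X) := R.prev
  have mul : ∀ n : ℤ, A (c0 + X * n) ∨ B (c0 + X * n) := by
    intro n
    induction n using Int.induction_on with
    | zero => simpa using h0
    | succ n ih => convert up _ ih using 2 <;> ring
    | pred n ih => convert down _ ih using 2 <;> ring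
  constructor
  · intro hc
    have a1 : 0 ≤ (c - c0) % X := Int.emod_nonneg _ (by omega)
    have a2 : (c - c0) % X < X := Int.emod_lt_of_pos _ (by omega)
    have a3 := Int.emod_add_mul_ediv (c - c0) X
    by_contra hnd
    have a4 : (c - c0) % X ≠ 0 := fun h => hnd (Int.dvd_of_emod_eq_zero h)
    have h1 : A (c0 + X * ((c - c0) / X) + (c - c0) % X) ∨
        B (c0 + X * ((c - c0) / X) + (c - c0) % X) := by
      convert hc using 2 <;> linarith
    rcases mul ((c - c0) / X) with h2 | h2
    · have := R.gapA _ h2 _ (by omega) a2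
      tauto
    · have := R.gapB _ h2 _ (by omega) a2
      tauto
  · rintro ⟨n, hn⟩
    convert mul n using 2 <;> linarith

/-- Let `|x| = |y|` and let `x` be primitive, which `hU` says of its repetition `U`. In two
disjoint readings of the same word, if `y` occurs in the first, then `xx` does not. Otherwise the
block of the second reading at the centre of `xx` is `y`, since `x` does not occur inside `xx`,
and comparing the same place in a factor `xy` shows that `x` and `y` begin with the same letter.
-/
theorem no_square_of_uniform (M : Blocks xs ys X X G) {U : ℤ → Γ} {N₀ : ℤ} {A₀ B₀ : ℤ → Prop}
    (R₀ : Reading xs ys X X G U N₀ A₀ B₀) (hB₀ : ∀ c, ¬ B₀ c)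
    (hU : ∀ o, Function.Periodic U o → X ∣ o)
    (R : Reading xs ys X X G W N A B) (R' : Reading xs ys X X G W N A' B')
    (hd : Disj A B A' B') (hB : ∃ c, B c) {a : ℤ} (h0 : A a) : ¬ A (a + X) := by
  intro h1
  have hX := M.posX
  have hG := M.nonnegG
  -- The cut of the second reading inside the first half of the square.
  obtain ⟨d, had, hda, hd'⟩ : ∃ d, a < d ∧ d < a + X ∧ (A' d ∨ B' d) := by
    obtain ⟨e, he, he'⟩ := R'.cover M a
    have hce : A' e ∨ B' e := by tauto
    have hce' : A' (e + X) ∨ B' (e + X) := by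
      rw [R'.cut_iff_dvd M hce]; exact ⟨1, by ring⟩
    have hne : e ≠ a := by
      rintro rfl
      exact hd _ (Or.inl h0) hce
    refine ⟨e + X, ?_, ?_, hce'⟩
    · rcases he' with h | h <;> exact h.2
    · omega
  obtain ⟨c0, hc0⟩ := R₀.ne
  replace hc0 := hc0.resolve_right (hB₀ _)
  have hUper : Function.Periodic U X := fun t => by
    obtain ⟨c, hct, hc | hc⟩ := R₀.cover M t
    · have h2 := (R₀.nextA c hc.1).resolve_right (hB₀ _)
      have e1 := R₀.readA _ hc.1 (t - c) (by omega) (by omega)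
      have e2 := R₀.readA _ h2 (t - c) (by omega) (by omega)
      rw [show c + X + (t - c) = t + X by ring] at e2
      rw [show c + (t - c) = t by ring] at e1
      rw [e1, e2]
    · exact (hB₀ _ hc.1).elim
  have hUx : ∀ t, 0 ≤ t → t < 2 * X → U (c0 + t) = W (a + t) := by
    intro t ht ht'
    by_cases h2 : t < X
    · rw [R₀.readA _ hc0 t (by omega) h2, R.readA _ h0 t (by omega) h2]
    · have e1 := R₀.readA _ hc0 (t - X) (by omega) (by omega)
      have e2 := R.readA _ h1 (t - X) (by omega) (by omega)
      have e3 := hUper (c0 + (t - X))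
      rw [show c0 + (t - X) + X = c0 + t by ring] at e3
      rw [show a + X + (t - X) = a + t by ring] at e2
      rw [e3, e1, e2]
  have hdB : B' d := by
    refine hd'.resolve_left fun hA => ?_
    have hdvd : X ∣ d - a := by
      apply hU
      intro t
      set r := (t - c0) % X with hr
      have a1 : 0 ≤ r := Int.emod_nonneg _ (by omega)
      have a2 : r < X := Int.emod_lt_of_pos _ (by omega)
      have a3 : X ∣ (t - c0) - r := Int.dvd_self_sub_emod
      have e1 : U t = U (c0 + r) := periodic_eq_of_dvd_sub hUper (by rwa [← sub_sub])
      have e2 : U (t + (d - a)) = U (c0 + (r + (d - a))) :=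
        periodic_eq_of_dvd_sub hUper (by convert a3 using 1; ring)
      rw [e1, e2, hUx _ (by omega) (by omega), R₀.readA _ hc0 r (by omega) a2,
        ← R'.readA _ hA r (by omega) a2]
      congr 1; ring
    have := Int.le_of_dvd (by omega) hdvd
    omega
  -- Since `y` occurs somewhere, `xy` does.
  obtain ⟨a', ha', hb'⟩ : ∃ a', A a' ∧ B (a' + X) := by
    by_contra hne
    push Not at hne
    obtain ⟨b, hb⟩ := hB
    have key : ∀ n : ℕ, ∀ c, a ≤ c → c ≤ a + n → ¬ B c := by
      intro n
      induction n with
      | zero =>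
        intro c h2 h3 h4
        obtain rfl : c = a := by simp at h3; omega
        exact Reading.notB M R R h0 h4
      | succ n ih =>
        intro c h2 h3 h4
        have hca : a < c := by
          rcases h2.eq_or_lt with h5 | h5
          · subst h5; exact (Reading.notB M R R h0 h4).elim
          · exact h5
        have h5 := R.le_of_lt h0 (Or.inr h4) hca
        rcases R.prev c (Or.inr h4) with h6 | h6
        · exact hne _ h6 (by simpa using h4)
        · exact ih _ (by omega) (by push_cast at h3; omega) h6
    exact R.forall_not_of_ge (c0 := a) (fun c hc => key (c - a).toNat c hc (by omega)) b hb
  have e0 : W (a + (d - a)) = W d := by congr 1; ring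
  have hb2 : B' (a' + (d - a)) := by
    refine R'.B_of M ?_ ?_
    · rw [R'.cut_iff_dvd M hd']
      have := (R.cut_iff_dvd M (Or.inl h0) a').1 (Or.inl ha')
      convert this using 1; ring
    · rw [R.readA _ ha' _ (by omega) (by omega), ← R.readA _ h0 (d - a) (by omega) (by omega), e0]
      have := R'.readB _ hdB 0 (by omega) hX
      rwa [add_zero] at this
  have e1 := R'.readB _ hb2 (X - (d - a)) (by omega) (by omega)
  have e2 := R'.readB _ hdB (X - (d - a)) (by omega) (by omega)
  have e3 := R.readB _ hb' 0 (by omega) hX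
  have e4 := R.readA _ h1 0 (by omega) hX
  apply M.first
  rw [← e3, ← e4, show a' + X + 0 = a' + (d - a) + (X - (d - a)) by ring, e1, ← e2]
  congr 1; ring

/-- Let `x` and `y` be conjugate and primitive, as witnessed by the disjoint readings of `U` as
repetitions of `x` and of `y`. A word in whose reading both blocks occur does not have a disjoint
reading that is a shift of the first by a period of the word. Without squares the readings alternate
between `x` and `y`, so that the word has the period `2X`, hence a period `2h` for which `X` is an
odd multiple of `h`; then `y` is `x` advanced by half a period and at the same time conjugate to
`x`. -/
theorem false_of_conjugate (M : Blocks xs ys X X G) {U : ℤ → Γ} {N₀ : ℤ} {A₀ B₀ A₀' B₀' : ℤ → Prop}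
    (R₀ : Reading xs ys X X G U N₀ A₀ B₀) (hB₀ : ∀ c, ¬ B₀ c)
    (R₀' : Reading xs ys X X G U N₀ A₀' B₀') (hA₀' : ∀ c, ¬ A₀' c) (hd₀ : Disj A₀ B₀ A₀' B₀')
    (hU : ∀ o, Function.Periodic U o → X ∣ o)
    (R : Reading xs ys X X G W N A B) (R' : Reading xs ys X X G W N A' B')
    (hd : Disj A B A' B') (hA : ∃ c, A c) (hB : ∃ c, B c) {ℓ : ℤ} (hW : Function.Periodic W ℓ)
    (hsh : ∀ c, A c ↔ A' (c + ℓ)) : False := by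
  have hX := M.posX
  have hG := M.nonnegG
  have ab : ∀ c, A c → B (c + X) := fun c h => (R.nextA c h).resolve_left
    (no_square_of_uniform M R₀ hB₀ hU R R' hd hB h)
  have ba : ∀ c, B c → A (c + X) := fun c h => (R.nextB c h).resolve_right
    (no_square_of_uniform M.swap R₀'.swap hA₀' hU R.swap R'.swap hd.swap hA h)
  have hW2 : Function.Periodic W (2 * X) := fun t => by
    obtain ⟨c, hct, hc | hc⟩ := R.cover M t
    · have h2 := ba _ (ab _ hc.1)
      have e1 := R.readA _ hc.1 (t - c) (by omega) (by omega)
      have e2 := R.readA _ h2 (t - c) (by omega) (by omega)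
      rw [show c + X + X + (t - c) = t + 2 * X by ring] at e2
      rw [show c + (t - c) = t by ring] at e1
      rw [e1, e2]
    · have h2 := ab _ (ba _ hc.1)
      have e1 := R.readB _ hc.1 (t - c) (by omega) (by omega)
      have e2 := R.readB _ h2 (t - c) (by omega) (by omega)
      rw [show c + X + X + (t - c) = t + 2 * X by ring] at e2
      rw [show c + (t - c) = t by ring] at e1
      rw [e1, e2]
  obtain ⟨a, ha⟩ := hA
  have hb := ab a ha
  have ra := R.readA _ ha
  have rb := R.readB _ hb
  have hℓ : ¬ X ∣ ℓ := by
    intro h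
    have h1 : A (a + ℓ) ∨ B (a + ℓ) := by
      rw [R.cut_iff_dvd M (Or.inl ha)]; convert h using 1; ring
    exact hd _ h1 (Or.inl ((hsh a).1 ha))
  -- The greatest common divisor of the periods `ℓ` and `2 * X`
  obtain ⟨g, hg0, hgl, hgX, hWg⟩ : ∃ g : ℤ, 0 < g ∧ g ∣ ℓ ∧ g ∣ 2 * X ∧ Function.Periodic W g := by
    refine ⟨Int.gcd ℓ (2 * X), ?_, Int.gcd_dvd_left .., Int.gcd_dvd_right .., ?_⟩
    · exact_mod_cast Int.gcd_pos_of_ne_zero_right _ (by omega)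
    · rw [Int.gcd_eq_gcd_ab]
      have h1 := hW.int_mul (Int.gcdA ℓ (2 * X))
      have h2 := hW2.int_mul (Int.gcdB ℓ (2 * X))
      rw [mul_comm ℓ, mul_comm (2 * X)]
      exact h1.add_period h2
  have hgnX : ¬ g ∣ X := by
    intro h
    have e1 := ra 0 (by omega) hX
    have e2 := rb 0 (by omega) hX
    apply M.first
    rw [← e1, ← e2]
    exact periodic_eq_of_dvd_sub hWg (by
      rw [show a + 0 - (a + X + 0) = -X by ring]; exact (dvd_neg).2 h)
  obtain ⟨m, hm⟩ := hgX
  obtain ⟨n, rfl | rfl⟩ := Int.even_or_odd' m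
  · exact hgnX ⟨n, by linarith⟩
  · obtain ⟨h, rfl⟩ : ∃ h, g = 2 * h := ⟨X - g * n, by linarith⟩
    have hXh : X = (2 * n + 1) * h := by linarith
    have hn : 1 ≤ n := by
      by_contra hn
      have hn0 : n = 0 := by
        have : 0 < 2 * n + 1 := by
          by_contra h1
          have : (2 * n + 1) * h ≤ 0 := mul_nonpos_of_nonpos_of_nonneg (by omega) (by omega)
          omega
        omega
      subst hn0
      exact hℓ ((show X ∣ 2 * h from ⟨2, by rw [hXh]; ring⟩).trans hgl)
    have xV : ∀ t, 0 ≤ t → t < X → xs t = W (a + t) := fun t h0 h1 => (ra t (by omega) h1).symm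
    have yV : ∀ t, 0 ≤ t → t < X → ys t = W (a + (t + h)) := fun t h0 h1 => by
      rw [← rb t (by omega) h1]
      exact periodic_eq_of_dvd_sub hWg ⟨n, by rw [hXh]; ring⟩
    -- The word `y` is the conjugate of `x` by a shift by `s`.
    obtain ⟨c0, hc0⟩ := R₀.ne
    replace hc0 := hc0.resolve_right (hB₀ _)
    obtain ⟨c1, hc1⟩ := R₀'.ne
    have hs0 : ¬ X ∣ c1 - c0 := fun h => by
      have := (R₀.cut_iff_dvd M (Or.inl hc0) c1).2 h
      exact hd₀ _ this hc1
    set s := (c1 - c0) % X with hs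
    have a1 : 0 ≤ s := Int.emod_nonneg _ (by omega)
    have a2 : s < X := Int.emod_lt_of_pos _ (by omega)
    have a3 : X ∣ (c1 - c0) - s := Int.dvd_self_sub_emod
    have a4 : s ≠ 0 := fun h => hs0 (Int.dvd_of_emod_eq_zero h)
    have hc2 : B₀' (c0 + s) := by
      refine ((R₀'.cut_iff_dvd M hc1 _).2 ?_).resolve_left (hA₀' _)
      rw [show c0 + s - c1 = -((c1 - c0) - s) by ring]
      exact (dvd_neg).2 a3
    have hc3 : A₀ (c0 + X) := (R₀.nextA _ hc0).resolve_right (hB₀ _)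
    have yx1 : ∀ t, 0 ≤ t → t < X - s → ys t = xs (t + s) := fun t h0 h1 => by
      rw [← R₀'.readB _ hc2 t (by omega) (by omega), ← R₀.readA _ hc0 (t + s) (by omega) (by omega)]
      congr 1; ring
    have yx2 : ∀ t, X - s ≤ t → t < X → ys t = xs (t + s - X) := fun t h0 h1 => by
      rw [← R₀'.readB _ hc2 t (by omega) (by omega),
        ← R₀.readA _ hc3 (t + s - X) (by omega) (by omega)]
      congr 1; ring
    have fin := eq_of_half_periods (V := fun t => W (a + (t + h))) (h := h) (D := X) (s := s)
      (j := n.toNat) (by omega) (fun t => by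
        change W _ = W _
        rw [← hWg (a + (t + h))]; congr 1; ring) (by omega)
      (by rw [hXh, Int.toNat_of_nonneg (by omega)]) (by omega) a2 (fun t h0 h1 => by
        rw [← yV t h0 (by omega), yx1 t h0 h1, xV _ (by omega) (by omega)]
        exact periodic_eq_of_dvd_sub hWg ⟨-1, by ring⟩) (fun t h0 h1 => by
        rw [← yV t (by omega) h1, yx2 t h0 h1, xV _ (by omega) (by omega)]
        exact periodic_eq_of_dvd_sub hWg ⟨-(n + 1), by rw [hXh]; ring⟩)
    apply M.first
    rw [xV 0 le_rfl hX, yV 0 le_rfl hX, fin]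
    exact periodic_eq_of_dvd_sub hWg ⟨-1, by ring⟩

end

/-! ### Repetitions and primitive words -/

section
variable {A Γ : Type*}

theorem length_pow (u : FreeMonoid A) (k : ℕ) : (u ^ k).length = k * u.length := by
  induction k with
  | zero => simp
  | succ k ih => rw [pow_succ, FreeMonoid.length_mul, ih]; ring

theorem length_pos_of_ne_one {u : FreeMonoid A} (h : u ≠ 1) : 0 < u.length :=
  Nat.pos_of_ne_zero fun h' => h (FreeMonoid.length_eq_zero.1 h')

theorem IsPrimitive.ne_one [Nonempty A] {u : FreeMonoid A} (h : IsPrimitive u) : u ≠ 1 := by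
  rintro rfl
  obtain ⟨a⟩ := ‹Nonempty A›
  have := h (FreeMonoid.of a) (FreeMonoid.of_ne_one a) 0 (by simp)
  omega

/-- Every non-empty word is a power of a primitive word. -/
theorem exists_root {v : FreeMonoid A} (hv : v ≠ 1) :
    ∃ z k, 1 ≤ k ∧ IsPrimitive z ∧ v = z ^ k := by
  obtain ⟨n, hn⟩ : ∃ n, v.length = n := ⟨_, rfl⟩
  induction n using Nat.strong_induction_on generalizing v with
  | _ n ih =>
    by_cases hp : IsPrimitive v
    · exact ⟨v, 1, le_rfl, hp, by simp⟩
    · unfold IsPrimitive at hp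
      push Not at hp
      obtain ⟨u, hu, k, hk, hk1⟩ := hp
      have hk0 : k ≠ 0 := by
        rintro rfl
        exact hv (by simpa using hk)
      have hul := length_pos_of_ne_one hu
      have hlt : u.length < n := by
        rw [← hn, hk, length_pow]
        have : 2 ≤ k := by omega
        nlinarith
      obtain ⟨z, j, hj, hz, hzu⟩ := ih _ hlt hu rfl
      exact ⟨z, j * k, Nat.one_le_iff_ne_zero.2 (by positivity), hz, by rw [hk, hzu, pow_mul]⟩

/-- The word `W` is the two-sided repetition of `v`, with a copy of `v` beginning at `o`. -/
def Repeats (W : ℤ → Option Γ) (o : ℤ) (v : FreeMonoid Γ) : Prop :=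
  ∀ k : ℤ, ReadsAt W (o + k * v.length) v.toList

variable {W : ℤ → Option Γ} {o : ℤ} {v : FreeMonoid Γ}

theorem Repeats.readsAt_pow (h : Repeats W o v) (n : ℕ) (k : ℤ) :
    ReadsAt W (o + k * v.length) (v ^ n).toList := by
  induction n generalizing k with
  | zero => intro i hi; simp at hi
  | succ n ih =>
    rw [pow_succ', FreeMonoid.toList_mul, readsAt_append]
    refine ⟨h k, ?_⟩
    convert ih (k + 1) using 1
    change _ + (v.length : ℤ) = _
    ring

theorem Repeats.pow (h : Repeats W o v) (n : ℕ) : Repeats W o (v ^ n) := by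
  intro k
  have := h.readsAt_pow n (k * n)
  rw [length_pow]
  convert this using 1
  push_cast; ring

/-- A repetition of `v ^ n` is a repetition of `v`. -/
theorem Repeats.of_pow {n : ℕ} (hn : 1 ≤ n) (h : Repeats W o (v ^ n)) : Repeats W o v := by
  intro k
  have a1 : 0 ≤ k % n := Int.emod_nonneg _ (by omega)
  have a2 : k % n < n := Int.emod_lt_of_pos _ (by omega)
  have a3 := Int.emod_add_mul_ediv k n
  have h1 := h (k / n)
  have h2 : v ^ n = v ^ (k % n).toNat * (v * v ^ (n - 1 - (k % n).toNat)) := by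
    rw [← pow_succ', ← pow_add]; congr 1; omega
  rw [h2] at h1
  rw [FreeMonoid.toList_mul, FreeMonoid.toList_mul, readsAt_append, readsAt_append] at h1
  convert h1.2.1 using 1
  rw [← h2, length_pow]
  change _ = _ + ((v ^ (k % n).toNat).length : ℤ)
  rw [length_pow]
  push_cast
  rw [Int.toNat_of_nonneg a1]
  nth_rewrite 1 [← a3]
  ring

theorem Repeats.periodic (h : Repeats W o v) (hv : v ≠ 1) :
    Function.Periodic W v.length := by
  intro t
  have hl := length_pos_of_ne_one hv
  have a1 : 0 ≤ (t - o) % v.length := Int.emod_nonneg _ (by omega)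
  have a2 : (t - o) % v.length < v.length := Int.emod_lt_of_pos _ (by omega)
  have a3 := Int.emod_add_mul_ediv (t - o) v.length
  have e1 := h ((t - o) / v.length) ((t - o) % v.length).toNat (by
    change _ < v.length; omega)
  have e2 := h ((t - o) / v.length + 1) ((t - o) % v.length).toNat (by
    change _ < v.length; omega)
  rw [Int.toNat_of_nonneg a1] at e1 e2
  rw [← e1] at e2
  convert e2 using 2
  · rw [add_mul]; linarith [mul_comm ((t - o) / v.length) (v.length : ℤ)]
  · linarith [mul_comm ((t - o) / v.length) (v.length : ℤ)]

theorem eq_pow_of_periodic {e : ℕ} (hW : Function.Periodic W e) {c : ℤ} {z : FreeMonoid Γ}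
    (hz : ReadsAt W c z.toList) (hze : z.length = e) (n : ℕ) :
    ∀ v : FreeMonoid Γ, v.length = n * e → ReadsAt W c v.toList → v = z ^ n := by
  induction n with
  | zero =>
    intro v hv _
    simpa using FreeMonoid.length_eq_zero.1 (by simpa using hv)
  | succ n ih =>
    intro v hv hr
    have hv' : v.toList.length = (n + 1) * e := hv
    have h1 : v.toList = v.toList.take e ++ v.toList.drop e := (List.take_append_drop e _).symm
    rw [h1, readsAt_append] at hr
    have hle : e ≤ v.toList.length := by rw [hv']; nlinarith
    have h2 : v.toList.take e = z.toList := hr.1.eq hz (by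
      rw [List.length_take, min_eq_left hle]; exact hze.symm)
    have h3 : FreeMonoid.ofList (v.toList.drop e) = z ^ n := by
      apply ih
      · change (v.toList.drop e).length = _
        rw [List.length_drop, hv']
        rw [add_mul]; omega
      · have := hr.2
        rw [List.length_take, min_eq_left hle] at this
        have h4 := this.shift hW.neg
        simpa using h4
    rw [pow_succ', ← h3]
    change v.toList = z.toList ++ v.toList.drop e
    rw [← h2]
    exact h1

/-- The periods of the repetition of a primitive word are the multiples of its length: otherwise the
greatest common divisor of the length and another period would exhibit the word as a power. -/
theorem Repeats.dvd_of_periodic (h : Repeats W o v) (hv : IsPrimitive v) (hv1 : v ≠ 1) {d : ℤ}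
    (hd : Function.Periodic W d) : (v.length : ℤ) ∣ d := by
  have hl := length_pos_of_ne_one hv1
  have hper := h.periodic hv1
  have hg0 : 0 < Int.gcd v.length d := Int.gcd_pos_of_ne_zero_left _ (by omega)
  have hWg : Function.Periodic W (Int.gcd v.length d) := by
    rw [Int.gcd_eq_gcd_ab]
    have h1 := hper.int_mul (Int.gcdA v.length d)
    have h2 := hd.int_mul (Int.gcdB v.length d)
    rw [mul_comm (v.length : ℤ), mul_comm d]
    exact h1.add_period h2
  have hdv : (Int.gcd v.length d : ℤ) ∣ v.length := Int.gcd_dvd_left ..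
  obtain ⟨n, hn⟩ := Int.natCast_dvd_natCast.1 hdv
  have hle : Int.gcd v.length d ≤ v.toList.length := Nat.le_of_dvd hl ⟨n, hn⟩
  have hr := h 0
  have h1 : ReadsAt W (o + 0 * v.length)
      (FreeMonoid.ofList (v.toList.take (Int.gcd v.length d))).toList :=
    hr.prefix (List.take_prefix _ _)
  have hz : (FreeMonoid.ofList (v.toList.take (Int.gcd v.length d))).length
      = Int.gcd v.length d := by
    change (v.toList.take (Int.gcd v.length d)).length = _
    rw [List.length_take, min_eq_left hle]
  have h2 := eq_pow_of_periodic hWg h1 hz n v (by rw [mul_comm]; exact hn) hr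
  have h3 := hv _ (by
    intro h4
    rw [h4] at hz
    simp at hz
    omega) n h2
  rw [h3, mul_one] at hn
  nth_rewrite 1 [hn]
  exact Int.gcd_dvd_right ..

/-- The two-sided infinite repetition of `v`, with a copy of `v` beginning at `0`. -/
def repetition (v : FreeMonoid Γ) (t : ℤ) : Option Γ := v.toList[(t % v.length).toNat]?

theorem repeats_repetition (v : FreeMonoid Γ) : Repeats (repetition v) 0 v := by
  intro k i hi
  have hi' : i < v.length := hi
  rw [repetition]
  congr 1
  rw [zero_add, add_comm, Int.add_mul_emod_self_right, Int.emod_eq_of_lt (by omega) (by omega)]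
  simp

end

/-- The images of the two letters. -/
def letters {Γ : Type*} (μ : FreeMonoid (Fin 2) →* FreeMonoid Γ) (i : Fin 2) : List Γ :=
  (μ (FreeMonoid.of i)).toList

section
variable {Γ : Type*} {μ : FreeMonoid (Fin 2) →* FreeMonoid Γ}

theorem toList_map (w : FreeMonoid (Fin 2)) :
    (μ w).toList = w.toList.flatMap (letters μ) := by
  induction w using FreeMonoid.inductionOn' with
  | one => simp
  | of_mul a w ih =>
    rw [map_mul, FreeMonoid.toList_mul, ih, FreeMonoid.toList_of_mul, List.flatMap_cons]
    rfl

theorem exists_marks_letters (hinj : Function.Injective μ) : ∃ α γ, Marks (letters μ) α γ := by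
  apply exists_marks
  intro h
  have h1 : μ (FreeMonoid.of 0 * FreeMonoid.of 1) = μ (FreeMonoid.of 1 * FreeMonoid.of 0) := by
    rw [map_mul, map_mul]; exact h
  have h2 := congrArg FreeMonoid.toList (hinj h1)
  simp at h2

theorem map_ne_one (hinj : Function.Injective μ) {w : FreeMonoid (Fin 2)} (hw : w ≠ 1) :
    μ w ≠ 1 := fun h => hw (hinj (by rw [h, map_one]))

theorem isPrimitive_map (hinj : Function.Injective μ) {w : FreeMonoid (Fin 2)}
    (hw : IsPrimitive w) (hP : w ∉ powerWords μ) : IsPrimitive (μ w) := by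
  obtain ⟨z, k, hk, hz, hzk⟩ := exists_root (map_ne_one hinj hw.ne_one)
  rcases hk.eq_or_lt with h | h
  · rw [hzk, ← h, pow_one]; exact hz
  · exact (hP ⟨hw, z, hz, k, h, hzk⟩).elim

/-- A primitive word with a single letter is that letter. -/
theorem eq_of_isPrimitive {w : FreeMonoid (Fin 2)} (hw : IsPrimitive w) {i : Fin 2}
    (h : ∀ j ∈ w.toList, j = i) : w = FreeMonoid.of i := by
  have h1 : w = FreeMonoid.of i ^ w.length := by
    have h2 := List.eq_replicate_of_mem h
    have h3 : ∀ n : ℕ, (FreeMonoid.of i ^ n).toList = List.replicate n i := by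
      intro n
      induction n with
      | zero => simp
      | succ n ih => rw [pow_succ', FreeMonoid.toList_mul, ih]; rfl
    apply FreeMonoid.toList.injective
    rw [h3]; exact h2
  have h2 := hw _ (FreeMonoid.of_ne_one i) _ h1
  rw [h2, pow_one] at h1
  exact h1

theorem CutAt.add_mul {f : Fin 2 → List Γ} {g : List (Fin 2)} {o c : ℤ} {i : Fin 2}
    (h : CutAt f g o i c) (s : ℤ) : CutAt f g o i (c + s * (g.flatMap f).length) := by
  obtain ⟨p, q, k, hpq, hc⟩ := h
  exact ⟨p, q, k + s, hpq, by rw [hc]; ring⟩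

theorem reading_of_repeats {α γ : List Γ} {W : ℤ → Option Γ} (M : Marks (letters μ) α γ)
    {g : FreeMonoid (Fin 2)} (hg : g ≠ 1) {o : ℤ} (h : Repeats W o (μ g)) {N : ℤ} (hN : 0 < N)
    (hgN : ((μ g).length : ℤ) ∣ N) :
    Reading (block (letters μ) α γ 0) (block (letters μ) α γ 1) (letters μ 0).length
      (letters μ 1).length (α.length + γ.length) W N
      (fun c => CutAt (letters μ) g.toList o 0 (c - α.length))
      (fun c => CutAt (letters μ) g.toList o 1 (c - α.length)) := by
  have e : (μ g).length = (g.toList.flatMap (letters μ)).length := by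
    rw [← toList_map]; rfl
  refine reading_of_word (g := g.toList) M (fun h0 => hg h0) (fun k => ?_) hN (by rwa [← e])
  have := h k
  rwa [toList_map, e] at this

end

/-! ### Periodic words with two disjoint factorizations -/

section
variable {Γ : Type*} {μ : FreeMonoid (Fin 2) →* FreeMonoid Γ}

theorem length_map (w : FreeMonoid (Fin 2)) :
    (μ w).length = (w.toList.flatMap (letters μ)).length := by
  rw [← toList_map]; rfl

theorem exists_cutAt_of_mem {f : Fin 2 → List Γ} {g : List (Fin 2)} {i : Fin 2} (h : i ∈ g)
    (o : ℤ) : ∃ c, CutAt f g o i c := by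
  obtain ⟨p, q, hpq⟩ := List.append_of_mem h
  exact ⟨_, p, q, 0, hpq, rfl⟩

theorem not_mem_of_forall {f : Fin 2 → List Γ} {g : List (Fin 2)} {i : Fin 2} {o a : ℤ}
    (h : ∀ c, ¬ CutAt f g o i (c - a)) : i ∉ g := fun hi => by
  obtain ⟨c, hc⟩ := exists_cutAt_of_mem (f := f) hi o
  exact h (c + a) (by simpa using hc)

/-- If the images of the letters are primitive and conjugate to each other (but not equal, by `hd`),
then `μ` preserves primitivity. If `μ w` were a proper power `z ^ K`, shifting the factorization of
the repetition of `μ w` by `|z|` would give a second one, which is disjoint from the first because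
`z` is not the image of a prefix of `w`. -/
theorem primitivityPreserving_of_conjugate {α γ : List Γ} (hinj : Function.Injective μ)
    (M : Marks (letters μ) α γ) {W : ℤ → Option Γ} {o o' : ℤ}
    (h0 : Repeats W o (μ (FreeMonoid.of 0))) (h1 : Repeats W o' (μ (FreeMonoid.of 1)))
    (p0 : IsPrimitive (μ (FreeMonoid.of 0))) (p1 : IsPrimitive (μ (FreeMonoid.of 1)))
    (hd : ∀ i j c, CutAt (letters μ) [0] o i c → ¬ CutAt (letters μ) [1] o' j c) :
    PrimitivityPreserving μ := by
  have n0 := map_ne_one hinj (FreeMonoid.of_ne_one (0 : Fin 2))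
  have n1 := map_ne_one hinj (FreeMonoid.of_ne_one (1 : Fin 2))
  have d01 := Int.natCast_dvd_natCast.1 (h0.dvd_of_periodic p0 n0 (h1.periodic n1))
  have d10 := Int.natCast_dvd_natCast.1 (h1.dvd_of_periodic p1 n1 (h0.periodic n0))
  have hXY : (letters μ 1).length = (letters μ 0).length := Nat.dvd_antisymm d10 d01
  have hX : 0 < (letters μ 0).length := M.length_pos 0
  have R₀ := reading_of_repeats M (FreeMonoid.of_ne_one (0 : Fin 2)) h0
    (N := (letters μ 0).length) (by exact_mod_cast hX) dvd_rfl
  have R₀' := reading_of_repeats M (FreeMonoid.of_ne_one (1 : Fin 2)) h1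
    (N := (letters μ 0).length) (by exact_mod_cast hX) (by exact_mod_cast d10)
  have B := M.blocks
  intro w hw
  by_contra hnp
  obtain ⟨z, K, hK, hz, hzK⟩ := exists_root (map_ne_one hinj hw.ne_one)
  have hK2 : 1 < K := by
    rcases hK.eq_or_lt with h | h
    · rw [← h, pow_one] at hzK
      exact (hnp (hzK ▸ hz)).elim
    · exact h
  have hz1 : z ≠ 1 := by
    rintro rfl
    exact map_ne_one hinj hw.ne_one (by simpa using hzK)
  have hzl := length_pos_of_ne_one hz1
  have hwl : (μ w).length = K * z.length := by rw [hzK, length_pow]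
  have hwpos := length_pos_of_ne_one (map_ne_one hinj hw.ne_one)
  have rz := repeats_repetition z
  have perz := rz.periodic hz1
  have rw0 : Repeats (repetition z) 0 (μ w) := hzK ▸ rz.pow K
  have rw1 : Repeats (repetition z) z.length (μ w) := fun k => by
    have := (rw0 k).shift perz
    rwa [zero_add, add_comm] at this
  have R := reading_of_repeats M hw.ne_one rw0 (N := (μ w).length) (by exact_mod_cast hwpos) dvd_rfl
  have R' := reading_of_repeats M hw.ne_one rw1 (N := (μ w).length) (by exact_mod_cast hwpos)
    dvd_rfl
  have mem : ∀ i : Fin 2, i ∈ w.toList := by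
    intro i
    by_contra hi
    have hone : ∃ j : Fin 2, IsPrimitive (μ (FreeMonoid.of j)) ∧ w = FreeMonoid.of j := by
      fin_cases i
      · refine ⟨1, p1, eq_of_isPrimitive hw fun j hj => ?_⟩
        fin_cases j
        · exact (hi hj).elim
        · rfl
      · refine ⟨0, p0, eq_of_isPrimitive hw fun j hj => ?_⟩
        fin_cases j
        · rfl
        · exact (hi hj).elim
    obtain ⟨j, hj, rfl⟩ := hone
    exact hnp hj
  have hdisj : Disj (fun c => CutAt (letters μ) w.toList 0 0 (c - α.length))
      (fun c => CutAt (letters μ) w.toList 0 1 (c - α.length))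
      (fun c => CutAt (letters μ) w.toList z.length 0 (c - α.length))
      (fun c => CutAt (letters μ) w.toList z.length 1 (c - α.length)) := by
    intro c hc hc'
    obtain ⟨j, r, hr⟩ := List.exists_cons_of_ne_nil (show w.toList ≠ [] from hw.ne_one)
    have hcut : CutAt (letters μ) w.toList z.length j (z.length + α.length - α.length) :=
      ⟨[], r, 0, by simp [hr], by simp⟩
    have hcut' : ∃ i, CutAt (letters μ) w.toList 0 i (z.length + α.length - α.length) := by
      have := cut_of_common_cut B R' R hc' hc (p := z.length + α.length) (by
        fin_cases j
        · exact Or.inl hcut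
        · exact Or.inr hcut)
      rcases this with h | h
      · exact ⟨0, h⟩
      · exact ⟨1, h⟩
    obtain ⟨i, p, q, k, hpq, hk⟩ := hcut'
    rw [← length_map, hwl] at hk
    have hpl : (p.flatMap (letters μ)).length + ((i :: q).flatMap (letters μ)).length
        = K * z.length := by
      rw [← hwl, length_map, hpq, List.flatMap_append, List.length_append]
    have hil : 0 < ((i :: q).flatMap (letters μ)).length :=
      Nat.lt_of_lt_of_le (by simp) (length_le_flatMap M (i :: q))
    have hzK' : z.length < K * z.length := by nlinarith
    have hk0 : k = 0 := by
      have h1 : k * ((K * z.length : ℕ) : ℤ) < 1 * ((K * z.length : ℕ) : ℤ) := by omega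
      have h2 : (-1) * ((K * z.length : ℕ) : ℤ) < k * ((K * z.length : ℕ) : ℤ) := by omega
      have h3 := lt_of_mul_lt_mul_right h1 (by omega)
      have h4 := lt_of_mul_lt_mul_right h2 (by omega)
      omega
    -- A cut at `|z|` makes `z` the image of a prefix `p` of `w`, and `w` the power `p ^ K`.
    have hpz : μ (FreeMonoid.ofList p) = z := by
      have e1 : (p.flatMap (letters μ)) <+: (z ^ K).toList := by
        rw [← hzK, toList_map, hpq, List.flatMap_append]
        exact List.prefix_append _ _
      have e2 : z.toList <+: (z ^ K).toList := by
        obtain ⟨K', rfl⟩ : ∃ K', K = K' + 1 := ⟨K - 1, by omega⟩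
        rw [pow_succ', FreeMonoid.toList_mul]
        exact List.prefix_append _ _
      have e3 : (p.flatMap (letters μ)).length = z.toList.length := by
        change _ = z.length
        subst hk0; omega
      have e4 := List.prefix_of_prefix_length_le e1 e2 e3.le
      apply FreeMonoid.toList.injective
      rw [toList_map]
      exact e4.eq_of_length e3
    have hwp : w = FreeMonoid.ofList p ^ K := hinj (by rw [map_pow, hpz, hzK])
    have := hw _ (by
      rintro h
      rw [h, map_one] at hpz
      exact hz1 hpz.symm) _ hwp
    omega
  rw [hXY] at B R₀ R₀' R R'
  refine false_of_conjugate (X := (letters μ 0).length) (G := α.length + γ.length)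
    (ℓ := z.length) B R₀ ?_ R₀' ?_ ?_ ?_ R R' hdisj
    ?_ ?_ perz ?_
  · rintro c ⟨p, q, k, hpq, -⟩
    have : (1 : Fin 2) ∈ (FreeMonoid.of (0 : Fin 2)).toList := by rw [hpq]; simp
    simp at this
  · rintro c ⟨p, q, k, hpq, -⟩
    have : (0 : Fin 2) ∈ (FreeMonoid.of (1 : Fin 2)).toList := by rw [hpq]; simp
    simp at this
  · intro c hc hc'
    rcases hc with hc | hc <;> rcases hc' with hc' | hc' <;> exact hd _ _ _ hc hc'
  · intro d hper
    exact h0.dvd_of_periodic p0 n0 hper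
  · obtain ⟨c, hc⟩ := exists_cutAt_of_mem (f := letters μ) (mem 0) 0
    exact ⟨c + α.length, by simpa using hc⟩
  · obtain ⟨c, hc⟩ := exists_cutAt_of_mem (f := letters μ) (mem 1) 0
    exact ⟨c + α.length, by simpa using hc⟩
  · intro c
    constructor
    · rintro ⟨p, q, k, hpq, hc⟩
      exact ⟨p, q, k, hpq, by linarith⟩
    · rintro ⟨p, q, k, hpq, hc⟩
      exact ⟨p, q, k, hpq, by linarith⟩

end

section
variable {Γ : Type*} {μ : FreeMonoid (Fin 2) →* FreeMonoid Γ}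

theorem periodic_of_shift {xs ys : ℤ → Γ} {X Y G : ℤ} {W : ℤ → Γ} {N k : ℤ}
    {A B A' B' : ℤ → Prop} (M : Blocks xs ys X Y G) (R : Reading xs ys X Y G W N A B)
    (R' : Reading xs ys X Y G W N A' B')
    (h : ∀ c, (A' c ↔ A (c + k)) ∧ (B' c ↔ B (c + k))) : Function.Periodic W k := by
  intro t
  have hG := M.nonnegG
  obtain ⟨c, hc, ⟨h1, h2⟩ | ⟨h1, h2⟩⟩ := R'.cover M t
  · have e1 := R'.readA c h1 (t - c) (by omega) (by omega)
    have e2 := R.readA _ ((h c).1.1 h1) (t - c) (by omega) (by omega)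
    rw [← e1] at e2
    convert e2 using 2 <;> ring
  · have e1 := R'.readB c h1 (t - c) (by omega) (by omega)
    have e2 := R.readB _ ((h c).2.1 h1) (t - c) (by omega) (by omega)
    rw [← e1] at e2
    convert e2 using 2 <;> ring

/-- If a two-sided periodic word has two factorizations into images of letters that have no cut in
common, then one of the two period words is a power word. -/
theorem mem_powerWords_of_disjoint (hinj : Function.Injective μ)
    (hμ : ¬ PrimitivityPreserving μ) {W : ℤ → Option Γ} {o o' : ℤ} {r r' : FreeMonoid (Fin 2)}
    (hr : IsPrimitive r) (hr' : IsPrimitive r') (h : Repeats W o (μ r)) (h' : Repeats W o' (μ r'))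
    (hd : ∀ i j c, CutAt (letters μ) r.toList o i c → ¬ CutAt (letters μ) r'.toList o' j c) :
    r ∈ powerWords μ ∨ r' ∈ powerWords μ := by
  by_contra hcon
  rw [not_or] at hcon
  have hp := isPrimitive_map hinj hr hcon.1
  have hp' := isPrimitive_map hinj hr' hcon.2
  obtain ⟨α, γ, M⟩ := exists_marks_letters hinj
  have n := map_ne_one hinj hr.ne_one
  have n' := map_ne_one hinj hr'.ne_one
  have l := length_pos_of_ne_one n
  have l' := length_pos_of_ne_one n'
  have hN : (0 : ℤ) < (μ r).length * (μ r').length := by positivity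
  have R := reading_of_repeats M hr.ne_one h hN (dvd_mul_right _ _)
  have R' := reading_of_repeats M hr'.ne_one h' hN (dvd_mul_left _ _)
  have eq0 : (∀ c, ¬ CutAt (letters μ) r.toList o 1 (c - α.length)) → r = FreeMonoid.of 0 := by
    intro h1
    refine eq_of_isPrimitive hr fun j hj => ?_
    fin_cases j
    · rfl
    · exact (not_mem_of_forall h1 hj).elim
  have eq0' : (∀ c, ¬ CutAt (letters μ) r'.toList o' 1 (c - α.length)) →
      r' = FreeMonoid.of 0 := by
    intro h1
    refine eq_of_isPrimitive hr' fun j hj => ?_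
    fin_cases j
    · rfl
    · exact (not_mem_of_forall h1 hj).elim
  have eq1 : (∀ c, ¬ CutAt (letters μ) r.toList o 0 (c - α.length)) → r = FreeMonoid.of 1 := by
    intro h1
    refine eq_of_isPrimitive hr fun j hj => ?_
    fin_cases j
    · exact (not_mem_of_forall h1 hj).elim
    · rfl
  have eq1' : (∀ c, ¬ CutAt (letters μ) r'.toList o' 0 (c - α.length)) →
      r' = FreeMonoid.of 1 := by
    intro h1
    refine eq_of_isPrimitive hr' fun j hj => ?_
    fin_cases j
    · exact (not_mem_of_forall h1 hj).elim
    · rfl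
  rcases shiftOrConst_of_disj M.blocks R R' (by
    rintro c (hc | hc) (hc' | hc') <;> exact hd _ _ _ hc hc') with ⟨k, hk⟩ | ⟨h1, h2⟩ | ⟨h1, h2⟩
  · obtain ⟨s, hs⟩ := h.dvd_of_periodic hp n (periodic_of_shift M.blocks R R' hk)
    have back : ∀ i c, CutAt (letters μ) r.toList o i (c + k - α.length) →
        CutAt (letters μ) r.toList o i (c - α.length) := by
      intro i c hc
      have := hc.add_mul (-s)
      rw [← length_map] at this
      convert this using 1
      rw [hs]; ring
    obtain ⟨c, hc | hc⟩ := R'.ne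
    · exact hd _ _ _ (back 0 c ((hk c).1.1 hc)) hc
    · exact hd _ _ _ (back 1 c ((hk c).2.1 hc)) hc
  · obtain rfl := eq0 h1
    obtain rfl := eq1' h2
    exact hμ (primitivityPreserving_of_conjugate hinj M h h' hp hp' hd)
  · obtain rfl := eq1 h1
    obtain rfl := eq0' h2
    exact hμ (primitivityPreserving_of_conjugate hinj M h' h hp' hp
      fun i j c hc hc' => hd j i c hc' hc)

end

section
variable {Γ : Type*} {μ : FreeMonoid (Fin 2) →* FreeMonoid Γ}

/-- The cuts in a repetition of `r` are cuts in the same word as a repetition of `r ^ n`. -/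
theorem CutAt.pow {r : FreeMonoid (Fin 2)} {o c : ℤ} {i : Fin 2}
    (h : CutAt (letters μ) r.toList o i c) {n : ℕ} (hn : 1 ≤ n) :
    CutAt (letters μ) (r ^ n).toList o i c := by
  obtain ⟨p, q, k, hpq, hc⟩ := h
  have a1 : 0 ≤ k % n := Int.emod_nonneg _ (by omega)
  have a2 : k % n < n := Int.emod_lt_of_pos _ (by omega)
  have a3 := Int.emod_add_mul_ediv k n
  have h2 : r ^ n = r ^ (k % n).toNat * (r * r ^ (n - 1 - (k % n).toNat)) := by
    rw [← pow_succ', ← pow_add]; congr 1; omega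
  refine ⟨(r ^ (k % n).toNat).toList ++ p, q ++ (r ^ (n - 1 - (k % n).toNat)).toList, k / n,
    ?_, ?_⟩
  · rw [h2, FreeMonoid.toList_mul, FreeMonoid.toList_mul, hpq]
    simp
  · rw [← length_map, map_pow, length_pow, List.flatMap_append, List.length_append, ← length_map,
      map_pow, length_pow, hc, ← length_map]
    push_cast
    rw [Int.toNat_of_nonneg a1]
    nth_rewrite 1 [← a3]
    ring

theorem Repeats.rotate {W : ℤ → Option Γ} {o : ℤ} {σ τ : FreeMonoid Γ}
    (h : Repeats W o (σ * τ)) : Repeats W (o + σ.length) (τ * σ) := by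
  intro k
  have h1 := h k
  have h2 := h (k + 1)
  rw [FreeMonoid.toList_mul, readsAt_append] at h1 h2 ⊢
  constructor
  · convert h1.2 using 1
    change _ = _ + (σ.length : ℤ)
    simp only [FreeMonoid.length_mul]
    push_cast; ring
  · convert h2.1 using 1
    change _ + (τ.length : ℤ) = _
    simp only [FreeMonoid.length_mul]
    push_cast; ring

/-- If the images of `g` and `g'` are conjugate by a short word `σ` in such a way that the two
factorizations have no cut in common, then `g` or `g'` is a power of a power word. -/
theorem mem_powersOf_of_conj (hinj : Function.Injective μ) (hμ : ¬ PrimitivityPreserving μ)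
    {g g' : FreeMonoid (Fin 2)} {σ : FreeMonoid Γ} (hg : g ≠ 1) (hg' : g' ≠ 1)
    (he : σ * μ g = μ g' * σ)
    (hσ : ∀ p q, g' = p * q → p ≠ 1 → σ.length < (μ p).length)
    (hd : ∀ p q p' q', g = p * q → g' = p' * q' → σ.length + (μ p).length ≠ (μ p').length) :
    g ∈ powersOf (powerWords μ) ∨ g' ∈ powersOf (powerWords μ) := by
  have hlt : σ.length < (μ g').length := hσ g' 1 (by simp) hg'
  -- Both images are read in the repetition of `μ g'`, that of `g` beginning after `σ`.
  obtain ⟨τ, hτ⟩ : ∃ τ, μ g' = σ * τ := by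
    have h1 : σ.toList <+: (μ g' * σ).toList := ⟨(μ g).toList, congrArg FreeMonoid.toList he⟩
    have h2 : (μ g').toList <+: (μ g' * σ).toList := List.prefix_append _ _
    obtain ⟨τ, hτ⟩ := List.prefix_of_prefix_length_le h1 h2 hlt.le
    exact ⟨FreeMonoid.ofList τ, hτ.symm⟩
  have hτ' : μ g = τ * σ := by
    rw [hτ, mul_assoc] at he
    exact mul_left_cancel he
  have r' := repeats_repetition (μ g')
  have r : Repeats (repetition (μ g')) σ.length (μ g) := by
    have := r'
    nth_rewrite 2 [hτ] at this
    have := this.rotate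
    rwa [← hτ', zero_add] at this
  have hl : (μ g).length = (μ g').length := by
    rw [hτ, hτ', FreeMonoid.length_mul, FreeMonoid.length_mul, add_comm]
  obtain ⟨w, n, hn, hw, rfl⟩ := exists_root hg
  obtain ⟨w', n', hn', hw', rfl⟩ := exists_root hg'
  have rw1 : Repeats (repetition (μ (w' ^ n'))) σ.length (μ w) := by
    rw [map_pow μ w] at r; exact r.of_pow hn
  have rw2 : Repeats (repetition (μ (w' ^ n'))) 0 (μ w') := by
    nth_rewrite 2 [map_pow] at r'; exact r'.of_pow hn'
  suffices hdis : ∀ i j c, CutAt (letters μ) w.toList σ.length i c →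
      ¬ CutAt (letters μ) w'.toList 0 j c by
    rcases mem_powerWords_of_disjoint hinj hμ hw hw' rw1 rw2 hdis with h | h
    · exact Or.inl ⟨w, h, n, rfl⟩
    · exact Or.inr ⟨w', h, n', rfl⟩
  intro i j c hc hc'
  obtain ⟨p, q, k, hpq, hk⟩ := hc.pow hn
  obtain ⟨p', q', k', hpq', hk'⟩ := hc'.pow hn'
  have e1 : (μ (w ^ n)).length = (p.flatMap (letters μ)).length
      + ((i :: q).flatMap (letters μ)).length := by
    rw [length_map, hpq, List.flatMap_append, List.length_append]
  have e2 : (μ (w' ^ n')).length = (p'.flatMap (letters μ)).length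
      + ((j :: q').flatMap (letters μ)).length := by
    rw [length_map, hpq', List.flatMap_append, List.length_append]
  obtain ⟨α, γ, M⟩ := exists_marks_letters hinj
  have l1 : 0 < ((i :: q).flatMap (letters μ)).length :=
    Nat.lt_of_lt_of_le (by simp) (length_le_flatMap M (i :: q))
  have l2 : 0 < ((j :: q').flatMap (letters μ)).length :=
    Nat.lt_of_lt_of_le (by simp) (length_le_flatMap M (j :: q'))
  rw [← length_map] at hk hk'
  have m1 : (μ (FreeMonoid.ofList p)).length = (p.flatMap (letters μ)).length := length_map _
  have m2 : (μ (FreeMonoid.ofList p')).length = (p'.flatMap (letters μ)).length := length_map _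
  have d1 := hd (FreeMonoid.ofList p) (FreeMonoid.ofList (i :: q)) (FreeMonoid.ofList p')
    (FreeMonoid.ofList (j :: q')) hpq hpq'
  have d2 := hd (FreeMonoid.ofList p) (FreeMonoid.ofList (i :: q)) (w' ^ n') 1 hpq (by simp)
  rw [hl] at hk e1
  rw [m1] at d1 d2
  rw [m2] at d1
  -- Two equal cuts differ by no period or by one, as `σ` and both prefixes are shorter than a
  -- period.
  have h1 : (k' - k) * ((μ (w' ^ n')).length : ℤ) < 2 * ((μ (w' ^ n')).length : ℤ) := by
    rw [sub_mul]; omega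
  have h2 : (-1) * ((μ (w' ^ n')).length : ℤ) < (k' - k) * ((μ (w' ^ n')).length : ℤ) := by
    rw [sub_mul]; omega
  have h3 := lt_of_mul_lt_mul_right h1 (by omega)
  have h4 := lt_of_mul_lt_mul_right h2 (by omega)
  obtain h5 | h5 : k' = k ∨ k' = k + 1 := by omega
  · subst h5; omega
  · subst h5
    rw [add_mul, one_mul] at hk'
    by_cases hp' : p' = []
    · subst hp'
      simp only [List.flatMap_nil, List.length_nil] at hk'
      omega
    · have := hσ (FreeMonoid.ofList p') (FreeMonoid.ofList (j :: q')) hpq' hp'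
      omega

end

/-! ### Words with two interpretations -/

section
variable {A : Type*}

theorem eq_mul_of_length_le {p q p' q' : FreeMonoid A} (h : p * q = p' * q')
    (hl : p.length ≤ p'.length) : ∃ r, p' = p * r := by
  have h1 : p.toList <+: (p' * q').toList := ⟨q.toList, congrArg FreeMonoid.toList h⟩
  have h2 : p'.toList <+: (p' * q').toList := List.prefix_append _ _
  obtain ⟨r, hr⟩ := List.prefix_of_prefix_length_le h1 h2 hl
  exact ⟨FreeMonoid.ofList r, hr.symm⟩

theorem eq_of_mul_eq {p q p' q' : FreeMonoid A} (h : p * q = p' * q')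
    (hl : p.length = p'.length) : p = p' := by
  obtain ⟨r, rfl⟩ := eq_mul_of_length_le h hl.le
  rw [FreeMonoid.length_mul] at hl
  rw [FreeMonoid.length_eq_zero.1 (by omega : r.length = 0), mul_one]

theorem exists_mul_of_le (u : FreeMonoid A) {c : ℕ} (hc : c ≤ u.length) :
    ∃ x y, u = x * y ∧ x.length = c :=
  ⟨FreeMonoid.ofList (u.toList.take c), FreeMonoid.ofList (u.toList.drop c),
    (List.take_append_drop c u.toList).symm, List.length_take_of_le hc⟩

theorem eq_of_mul_of_ne_one {a : A} {x p y : FreeMonoid A} (h : FreeMonoid.of a * x = p * y)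
    (hp : p ≠ 1) : ∃ z, p = FreeMonoid.of a * z := by
  have := length_pos_of_ne_one hp
  exact eq_mul_of_length_le h (by rw [FreeMonoid.length_of]; omega)

theorem mem_circFactorsOf_of_mul {L : Set (FreeMonoid A)} {x u y : FreeMonoid A}
    (h : x * u * y ∈ circFactorsOf L) : u ∈ circFactorsOf L := by
  simp only [circFactorsOf, Set.mem_iUnion] at h ⊢
  obtain ⟨w, hw, w', hr, a, b, hab⟩ := h
  exact ⟨w, hw, w', hr, a * x, y * b, by rw [hab]; simp only [mul_assoc]⟩

end

section
variable {Γ : Type*} {μ : FreeMonoid (Fin 2) →* FreeMonoid Γ}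

theorem length_map_le {s : ℕ} (hs : ∀ i, (letters μ i).length ≤ s) (w : FreeMonoid (Fin 2)) :
    (μ w).length ≤ s * w.length := by
  induction w using FreeMonoid.inductionOn' with
  | one => simp
  | of_mul a w ih =>
    rw [map_mul, FreeMonoid.length_mul, FreeMonoid.length_mul, FreeMonoid.length_of]
    have : (μ (FreeMonoid.of a)).length ≤ s := hs a
    rw [mul_add, mul_one]
    omega

theorem eq_mul_of_length_map_le (hinj : Function.Injective μ) {p q p' q' : FreeMonoid (Fin 2)}
    (h : p * q = p' * q') (hl : (μ p).length ≤ (μ p').length) : ∃ r, p' = p * r := by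
  rcases le_total p.length p'.length with h1 | h1
  · exact eq_mul_of_length_le h h1
  · obtain ⟨r, rfl⟩ := eq_mul_of_length_le h.symm h1
    refine ⟨1, ?_⟩
    rw [map_mul, FreeMonoid.length_mul] at hl
    by_cases hr : r = 1
    · simp [hr]
    · have := length_pos_of_ne_one (map_ne_one hinj hr)
      omega

/-- The letter of `f` whose image contains the place `n` of `μ f`. -/
theorem exists_cut_before (f : FreeMonoid (Fin 2)) :
    ∀ n < (μ f).length, ∃ p i q, f = p * FreeMonoid.of i * q ∧ (μ p).length ≤ n ∧
      n < (μ p).length + (letters μ i).length := by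
  induction f using FreeMonoid.inductionOn' with
  | one => intro n hn; simp at hn
  | of_mul a w ih =>
    intro n hn
    by_cases h : n < (letters μ a).length
    · exact ⟨1, a, w, by simp, by simp, by simpa using h⟩
    · have e : (μ (FreeMonoid.of a)).length = (letters μ a).length := rfl
      rw [map_mul, FreeMonoid.length_mul, e] at hn
      obtain ⟨p, i, q, h1, h2, h3⟩ := ih (n - (letters μ a).length) (by omega)
      refine ⟨FreeMonoid.of a * p, i, q, by rw [h1]; simp only [mul_assoc], ?_, ?_⟩ <;>
      · rw [map_mul, FreeMonoid.length_mul, e]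
        omega

theorem exists_cut_after {s : ℕ} (hs : ∀ i, (letters μ i).length < s) (f : FreeMonoid (Fin 2))
    {n : ℕ} (hn : n ≤ (μ f).length) :
    ∃ p q, f = p * q ∧ n ≤ (μ p).length ∧ (μ p).length < n + s := by
  rcases hn.eq_or_lt with h | h
  · exact ⟨f, 1, by simp, hn, by have := hs 0; omega⟩
  · obtain ⟨p, i, q, h1, h2, h3⟩ := exists_cut_before f n h
    have e : (μ (FreeMonoid.of i)).length = (letters μ i).length := rfl
    have := hs i
    exact ⟨p * FreeMonoid.of i, q, h1, by rw [map_mul, FreeMonoid.length_mul, e]; omega,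
      by rw [map_mul, FreeMonoid.length_mul, e]; omega⟩

/-- Two interpretations of a long word by circular factors of `L` have a cut in common, if the
circular factors of `L` that are powers of power words are short. Otherwise, among widely spaced
cuts of the first interpretation, two have the same position relative to the next cut on the left
of the second interpretation and the same letter there. The parts of the two interpretations
between them have conjugate images, and `mem_powersOf_of_conj` applies. -/
theorem exists_common_cut (hinj : Function.Injective μ) (hμ : ¬ PrimitivityPreserving μ) {s b : ℕ}
    (hs : ∀ i, (letters μ i).length < s) {L : Set (FreeMonoid (Fin 2))}
    (hb : ∀ f ∈ circFactorsOf L ∩ powersOf (powerWords μ), f.length ≤ b)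
    {f₀ f : FreeMonoid (Fin 2)} (hf₀ : f₀ ∈ circFactorsOf L) (hf : f ∈ circFactorsOf L)
    {v v' u w : FreeMonoid Γ} (h₀ : v * u = μ f₀) (h : v' * u * w = μ f) (hw : w ≠ 1)
    (hl : 2 * s * (s * (b + 2)) + s ≤ u.length) :
    ∃ c ≤ u.length, ∃ p q p' q', f₀ = p * q ∧ f = p' * q' ∧ (μ p).length = v.length + c ∧
      (μ p').length = v'.length + c := by
  by_contra hno
  have l0 : (μ f₀).length = v.length + u.length := by rw [← h₀, FreeMonoid.length_mul]
  have lw := length_pos_of_ne_one hw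
  have lf : (μ f).length = v'.length + u.length + w.length := by
    rw [← h, FreeMonoid.length_mul, FreeMonoid.length_mul]
  have hs0 : 0 < s := (Nat.zero_le _).trans_lt (hs 0)
  -- Widely spaced cuts of the first interpretation, with the place of each in the second.
  have cuts : ∀ k : Fin (2 * s + 1), ∃ p q p' q' : FreeMonoid (Fin 2), ∃ i : Fin 2, ∃ c d : ℕ,
      f₀ = p * q ∧ f = p' * FreeMonoid.of i * q' ∧ c ≤ u.length ∧
      (μ p).length = v.length + c ∧ (μ p').length + d = v'.length + c ∧
      d < (letters μ i).length ∧ k * (s * (b + 2)) ≤ c ∧ c < k * (s * (b + 2)) + s := by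
    intro k
    have hk : (k : ℕ) * (s * (b + 2)) ≤ 2 * s * (s * (b + 2)) :=
      Nat.mul_le_mul_right _ (by omega)
    obtain ⟨p, q, h1, h2, h3⟩ := exists_cut_after hs f₀
      (n := v.length + k * (s * (b + 2))) (by omega)
    obtain ⟨p', i, q', h4, h5, h6⟩ := exists_cut_before (μ := μ) f
      (v'.length + ((μ p).length - v.length)) (by omega)
    exact ⟨p, q, p', q', i, (μ p).length - v.length,
      v'.length + ((μ p).length - v.length) - (μ p').length, h1, h4, by omega, by omega,
      by omega, by omega, by omega, by omega⟩
  choose p q p' q' i c d hp hp' hcu hpc hpd hdi hc1 hc2 using cuts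
  obtain ⟨k, k', hkk, heq⟩ : ∃ k k', k < k' ∧ (d k, i k) = (d k', i k') := by
    have hcard : Fintype.card (Fin s × Fin 2) < Fintype.card (Fin (2 * s + 1)) := by
      simp; omega
    obtain ⟨k, k', hne, he⟩ := Fintype.exists_ne_map_eq_of_card_lt
      (fun k => ((⟨d k, (hdi k).trans (hs _)⟩ : Fin s), i k)) hcard
    simp only [Prod.mk.injEq, Fin.mk.injEq] at he
    rcases lt_or_gt_of_ne hne with hlt | hlt
    · exact ⟨k, k', hlt, by rw [he.1, he.2]⟩
    · exact ⟨k', k, hlt, by rw [he.1, he.2]⟩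
  simp only [Prod.mk.injEq] at heq
  obtain ⟨hd, hi⟩ := heq
  have hstep : ((k : ℕ) + 1) * (s * (b + 2)) ≤ k' * (s * (b + 2)) :=
    Nat.mul_le_mul_right _ (by exact_mod_cast hkk)
  rw [add_mul, one_mul] at hstep
  have hgap : c k + s * (b + 1) ≤ c k' := by
    have e1 := hc2 k
    have e2 := hc1 k'
    have : s * (b + 2) = s * (b + 1) + s := by ring
    omega
  have le1 : (μ (p k)).length ≤ (μ (p k')).length := by rw [hpc, hpc]; omega
  have le2 : (μ (p' k)).length ≤ (μ (p' k')).length := by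
    have := hpd k; have := hpd k'; omega
  obtain ⟨g, hg⟩ := eq_mul_of_length_map_le hinj ((hp k).symm.trans (hp k')) le1
  obtain ⟨g', hg'⟩ := eq_mul_of_length_map_le hinj
    (q := FreeMonoid.of (i k) * q' k) (q' := FreeMonoid.of (i k') * q' k')
    (by rw [← mul_assoc, ← mul_assoc]; exact (hp' k).symm.trans (hp' k')) le2
  have lg : (μ g).length + c k = c k' := by
    have e1 := hpc k
    have e2 := hpc k'
    rw [hg, map_mul, FreeMonoid.length_mul] at e2
    omega
  have lg' : (μ g').length + c k = c k' := by
    have e1 := hpd k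
    have e2 := hpd k'
    rw [hg', map_mul, FreeMonoid.length_mul] at e2
    omega
  have big : ∀ {x : FreeMonoid (Fin 2)}, (μ x).length + c k = c k' → b < x.length := by
    intro x hx
    have h1 := length_map_le (fun i => (hs i).le) x
    have h2 : s * (b + 1) ≤ s * x.length := by omega
    have := Nat.le_of_mul_le_mul_left h2 hs0
    omega
  have ne : ∀ {x : FreeMonoid (Fin 2)}, b < x.length → x ≠ 1 := by
    rintro x hx rfl
    simp at hx
  have mg : g ∈ circFactorsOf L := by
    refine mem_circFactorsOf_of_mul (x := p k) (y := q k') ?_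
    rwa [← hg, ← hp k']
  have mg' : g' ∈ circFactorsOf L := by
    refine mem_circFactorsOf_of_mul (x := p' k) (y := FreeMonoid.of (i k') * q' k') ?_
    rwa [← hg', ← mul_assoc, ← hp' k']
  obtain ⟨σ, τ, hστ, hσl⟩ := exists_mul_of_le (μ (FreeMonoid.of (i k))) (hdi k).le
  have e_f : ∀ {j : Fin (2 * s + 1)}, i j = i k →
      (μ (p' j) * σ) * (τ * μ (q' j)) = v' * (u * w) := by
    intro j hj
    rw [← mul_assoc v', h]
    rw [hp' j, map_mul, map_mul, hj, hστ]
    simp only [mul_assoc]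
  -- The word `x` is the part of `u` before the first of the two cuts, `y` the part between them.
  obtain ⟨xy, z, hu, lxy⟩ := exists_mul_of_le u (hcu k')
  obtain ⟨x, y, rfl, lx⟩ := exists_mul_of_le xy (c := c k) (by omega)
  have a1 : μ (p k) = v * x := by
    refine eq_of_mul_eq (q := μ (q k)) (q' := y * z) ?_ (by
      rw [hpc, FreeMonoid.length_mul, lx])
    rw [← map_mul, ← hp k, ← h₀, hu]
    simp only [mul_assoc]
  have a2 : μ (p k') = v * (x * y) := by
    refine eq_of_mul_eq (q := μ (q k')) (q' := z) ?_ (by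
      rw [hpc, FreeMonoid.length_mul, lxy])
    rw [← map_mul, ← hp k', ← h₀, hu]
    simp only [mul_assoc]
  have a3 : μ (p' k) * σ = v' * x := by
    refine eq_of_mul_eq (q := τ * μ (q' k)) (q' := y * (z * w)) ?_ (by
      rw [FreeMonoid.length_mul, FreeMonoid.length_mul, lx, hσl, hpd])
    rw [e_f rfl, hu]
    simp only [mul_assoc]
  have a4 : μ (p' k') * σ = v' * (x * y) := by
    refine eq_of_mul_eq (q := τ * μ (q' k')) (q' := z * w) ?_ (by
      rw [FreeMonoid.length_mul, FreeMonoid.length_mul, lxy, hσl, hd, hpd])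
    rw [e_f hi.symm, hu]
    simp only [mul_assoc]
  have hy : μ g = y := by
    rw [hg, map_mul, a1, mul_assoc] at a2
    exact mul_left_cancel (mul_left_cancel a2)
  have conj : σ * μ g = μ g' * σ := by
    rw [hg', map_mul, ← mul_assoc v', ← a3, ← hy, mul_assoc, mul_assoc] at a4
    exact (mul_left_cancel a4).symm
  have hσ : ∀ a a', g' = a * a' → a ≠ 1 → σ.length < (μ a).length := by
    rintro a a' rfl ha
    obtain ⟨t, rfl⟩ := eq_of_mul_of_ne_one (a := i k) (x := q' k) (p := a)
      (y := a' * (FreeMonoid.of (i k') * q' k')) (by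
        apply mul_left_cancel (a := p' k)
        rw [← mul_assoc, ← hp' k, hp' k', hg']
        simp only [mul_assoc]) ha
    have e : (μ (FreeMonoid.of (i k))).length = (letters μ (i k)).length := rfl
    have := hdi k
    rw [map_mul, FreeMonoid.length_mul, e]
    omega
  have hdis : ∀ a a' e e', g = a * a' → g' = e * e' →
      σ.length + (μ a).length ≠ (μ e).length := by
    rintro a a' e e' rfl rfl hlen
    have l1 := hpc k
    have l2 := hpd k
    rw [map_mul, FreeMonoid.length_mul] at lg
    have := hcu k'
    refine hno ⟨c k + (μ a).length, by omega, p k * a, a' * q k', p' k * e,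
      e' * (FreeMonoid.of (i k') * q' k'), ?_, ?_, ?_, ?_⟩
    · rw [hp k', hg]; simp only [mul_assoc]
    · rw [hp' k', hg']; simp only [mul_assoc]
    · rw [map_mul, FreeMonoid.length_mul]; omega
    · rw [map_mul, FreeMonoid.length_mul]; omega
  rcases mem_powersOf_of_conj hinj hμ (ne (big lg)) (ne (big lg')) conj hσ hdis with h1 | h1
  · exact absurd (hb g ⟨mg, h1⟩) (by have := big lg; omega)
  · exact absurd (hb g' ⟨mg', h1⟩) (by have := big lg'; omega)

end

/-! ### Existence of synchronization pairs -/

section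
variable {Γ : Type*} {μ : FreeMonoid (Fin 2) →* FreeMonoid Γ}

theorem Marks.prefix_cons {f : Fin 2 → List Γ} {α γ : List Γ} {e : Fin 2 → Γ} {i : Fin 2}
    {w : List (Fin 2)} (M : Marks f α γ) (he : α ++ [e i] <+: f i ++ α)
    (h : α.length ≤ (w.flatMap f).length) : α ++ [e i] <+: (i :: w).flatMap f := by
  rw [List.flatMap_cons]
  exact he.trans ((List.prefix_append_right_inj _).2 (M.prefix_of_le h))

/-- Words whose images agree on a long prefix start with the same letters, up to a bounded part
at the end. -/
theorem exists_mul_of_common_prefix (hinj : Function.Injective μ) {s : ℕ}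
    (hs : ∀ i, (letters μ i).length < s) (p : FreeMonoid (Fin 2)) :
    ∀ (q h : FreeMonoid (Fin 2)) (u v v' : FreeMonoid Γ), u * v = μ (p * q) → u * v' = μ h →
      (μ p).length + 3 * s ≤ u.length → ∃ t, h = p * t := by
  obtain ⟨α, γ, M⟩ := exists_marks_letters hinj
  obtain ⟨e, hne, he⟩ := M.right
  induction p using FreeMonoid.inductionOn' with
  | one => exact fun q h _ _ _ _ _ _ => ⟨h, (one_mul h).symm⟩
  | of_mul i p ih =>
    intro q h u v v' h1 h2 hl
    have hα := M.lt
    have s0 := hs 0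
    have s1 := hs 1
    have ll : ∀ j, (μ (FreeMonoid.of j)).length = (letters μ j).length := fun j => rfl
    have l2 := congrArg FreeMonoid.length h2
    have l1 := congrArg FreeMonoid.length h1
    rw [mul_assoc, map_mul, FreeMonoid.length_mul, FreeMonoid.length_mul, ll, length_map] at l1
    rw [map_mul, FreeMonoid.length_mul, ll] at hl
    rw [FreeMonoid.length_mul] at l2
    cases h using FreeMonoid.casesOn with
    | one =>
      rw [map_one, FreeMonoid.length_one] at l2
      omega
    | of_mul j h =>
      rw [map_mul, FreeMonoid.length_mul, ll, length_map] at l2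
      have si := hs i
      have sj := hs j
      have e1 := M.prefix_cons (he i) (w := (p * q).toList) (by omega)
      have e2 := M.prefix_cons (he j) (w := h.toList) (by omega)
      have c1 : (i :: (p * q).toList).flatMap (letters μ) = u.toList ++ v.toList := by
        rw [mul_assoc] at h1
        exact (toList_map (FreeMonoid.of i * (p * q))).symm.trans
          (congrArg FreeMonoid.toList h1).symm
      have c2 : (j :: h.toList).flatMap (letters μ) = u.toList ++ v'.toList :=
        (toList_map (FreeMonoid.of j * h)).symm.trans (congrArg FreeMonoid.toList h2).symm
      rw [c1] at e1
      rw [c2] at e2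
      have hlu : u.toList.length = u.length := rfl
      have f1 := List.prefix_of_prefix_length_le e1 (List.prefix_append u.toList v.toList)
        (by simp; omega)
      have f2 := List.prefix_of_prefix_length_le e2 (List.prefix_append u.toList v'.toList)
        (by simp; omega)
      have f3 := (List.prefix_of_prefix_length_le f1 f2 (by simp)).eq_of_length (by simp)
      have f4 : e i = e j := by simpa using f3
      have hij : i = j := by
        by_contra hij
        fin_cases i <;> fin_cases j
        · exact hij rfl
        · exact hne f4
        · exact hne f4.symm
        · exact hij rfl
      subst hij
      obtain ⟨u', hu'⟩ : ∃ u', u = μ (FreeMonoid.of i) * u' := by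
        refine eq_mul_of_length_le (q := μ h) (q' := v') ?_ (by rw [ll]; omega)
        rw [h2, map_mul]
      subst hu'
      rw [mul_assoc, mul_assoc (FreeMonoid.of i), map_mul μ (FreeMonoid.of i)] at h1
      rw [mul_assoc, map_mul μ (FreeMonoid.of i)] at h2
      obtain ⟨t, rfl⟩ := ih q h u' v v' (mul_left_cancel h1) (mul_left_cancel h2) (by
        rw [FreeMonoid.length_mul, ll] at hl; omega)
      exact ⟨t, (mul_assoc _ _ _).symm⟩

/-- Every long word has a synchronization pair: the last cut of one interpretation that is not too
close to the right end is a cut of all of them, since every other interpretation has a cut in common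
with the given one further on the left, and from there on they agree. -/
theorem exists_isSyncPair (hinj : Function.Injective μ) (hμ : ¬ PrimitivityPreserving μ) {s b : ℕ}
    (hs : ∀ i, (letters μ i).length < s) {L : Set (FreeMonoid (Fin 2))}
    (hb : ∀ f ∈ circFactorsOf L ∩ powersOf (powerWords μ), f.length ≤ b) {u : FreeMonoid Γ}
    (hu : 2 * s * (s * (b + 2)) + 5 * s ≤ u.length) : ∃ u₁ u₂, IsSyncPair μ L u u₁ u₂ := by
  have hs0 : 0 < s := (Nat.zero_le _).trans_lt (hs 0)
  by_cases hint : ∃ v w f₀, f₀ ∈ circFactorsOf L ∧ v * u * w = μ f₀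
  swap
  · -- A word without interpretations has every pair as a synchronization pair.
    exact ⟨1, u, (one_mul u).symm, fun v w f hf h => (hint ⟨v, w, f, hf, h⟩).elim⟩
  obtain ⟨v, w, f₀, hf₀, h₀⟩ := hint
  have l₀ := congrArg FreeMonoid.length h₀
  rw [FreeMonoid.length_mul, FreeMonoid.length_mul] at l₀
  obtain ⟨p₀, i, q₀, hp₀, hle, hlt⟩ := exists_cut_before (μ := μ) f₀
    (v.length + u.length - 3 * s) (by omega)
  have hi := hs i
  obtain ⟨u₁, u₂, rfl, hu₁⟩ := exists_mul_of_le u (c := (μ p₀).length - v.length) (by omega)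
  rw [FreeMonoid.length_mul] at *
  have hv : v * u₁ = μ p₀ := by
    refine (eq_of_mul_eq (q := μ (FreeMonoid.of i * q₀)) (q' := u₂ * w) ?_ ?_).symm
    · rw [← map_mul, ← mul_assoc p₀, ← hp₀, ← h₀]
      simp only [mul_assoc]
    · rw [FreeMonoid.length_mul]; omega
  refine ⟨u₁, u₂, rfl, fun v' w' f hf h => ?_⟩
  have mp₀ : p₀ ∈ circFactorsOf L := by
    refine mem_circFactorsOf_of_mul (x := 1) (y := FreeMonoid.of i * q₀) ?_
    rwa [one_mul, ← mul_assoc, ← hp₀]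
  have hw : u₂ * w' ≠ 1 := by
    intro h1
    have := congrArg FreeMonoid.length h1
    rw [FreeMonoid.length_mul, FreeMonoid.length_one] at this
    omega
  obtain ⟨c, hc, p, q, p', q', hpq, hpq', hl, hl'⟩ := exists_common_cut hinj hμ hs hb mp₀ hf hv
    (v' := v') (w := u₂ * w') (by rw [← h]; simp only [mul_assoc]) hw (by omega)
  obtain ⟨x, y, rfl, hx⟩ := exists_mul_of_le u₁ hc
  have a1 : μ p = v * x := by
    refine eq_of_mul_eq (q := μ q) (q' := y) ?_ (by rw [hl, FreeMonoid.length_mul, hx])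
    rw [← map_mul, ← hpq, ← hv, mul_assoc]
  have a2 : μ q = y := by
    rw [hpq, map_mul, a1, mul_assoc] at hv
    exact (mul_left_cancel (mul_left_cancel hv)).symm
  have a3 : μ p' = v' * x := by
    refine eq_of_mul_eq (q := μ q') (q' := y * (u₂ * w')) ?_ (by
      rw [hl', FreeMonoid.length_mul, hx])
    rw [← map_mul, ← hpq', ← h]
    simp only [mul_assoc]
  have a4 : y * u₂ * w' = μ q' := by
    rw [hpq', map_mul, a3] at h
    apply mul_left_cancel (a := v' * x)
    rw [← h]
    simp only [mul_assoc]
  have a5 : y * u₂ * w = μ (q * (FreeMonoid.of i * q₀)) := by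
    have : f₀ = p * (q * (FreeMonoid.of i * q₀)) := by
      rw [hp₀, hpq]; simp only [mul_assoc]
    rw [this, map_mul, a1] at h₀
    apply mul_left_cancel (a := v * x)
    rw [← h₀]
    simp only [mul_assoc]
  obtain ⟨t, rfl⟩ := exists_mul_of_common_prefix hinj hs q _ q' (y * u₂) w w' a5 a4 (by
    rw [a2, FreeMonoid.length_mul]
    rw [FreeMonoid.length_mul x y] at hu₁ hlt hle hu
    omega)
  have e1 : v' * (x * y) = μ (p' * q) := by
    rw [map_mul, a3, a2, mul_assoc]
  refine ⟨p' * q, ?_, t, ?_, e1, ?_, ?_⟩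
  · refine mem_circFactorsOf_of_mul (x := 1) (y := t) ?_
    rwa [one_mul, mul_assoc, ← hpq']
  · refine mem_circFactorsOf_of_mul (x := p' * q) (y := 1) ?_
    rwa [mul_one, mul_assoc, ← hpq']
  · rw [map_mul, a2, mul_assoc] at a4
    exact mul_left_cancel a4
  · rw [hpq', mul_assoc]

end

/-! ### Long powers of power words -/

section
variable {A B : Type*}

theorem exists_rotation_of_mul_eq {w v f : FreeMonoid A} (hw : w ≠ 1) (h : w * f = f * v) :
    ∃ x y, w = x * y ∧ v = y * x := by
  obtain ⟨n, hn⟩ : ∃ n, f.length = n := ⟨_, rfl⟩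
  induction n using Nat.strong_induction_on generalizing f with
  | _ n ih =>
    rcases le_total f.length w.length with hl | hl
    · obtain ⟨y, rfl⟩ := eq_mul_of_length_le h.symm hl
      rw [mul_assoc] at h
      exact ⟨f, y, rfl, (mul_left_cancel h).symm⟩
    · obtain ⟨f', rfl⟩ := eq_mul_of_length_le h hl
      rw [mul_assoc w f'] at h
      have := length_pos_of_ne_one hw
      rw [FreeMonoid.length_mul] at hn
      exact ih f'.length (by omega) (mul_left_cancel h) rfl

/-- A primitive word is not conjugate to a proper power. -/
theorem IsPrimitive.not_mul_eq_mul_pow {w f g : FreeMonoid A} (hw : IsPrimitive w) (hw1 : w ≠ 1)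
    {k : ℕ} (hk : 1 < k) : w * f ≠ f * g ^ k := by
  intro h
  obtain ⟨x, y, hxy, hg⟩ := exists_rotation_of_mul_eq hw1 h
  have hl : w.length = k * g.length := by
    rw [← length_pow, hxy, hg, FreeMonoid.length_mul, FreeMonoid.length_mul, add_comm]
  have hwl := length_pos_of_ne_one hw1
  have hg1 : g ≠ 1 := by
    rintro rfl
    simp at hl
    exact hw1 hl
  have hgl := length_pos_of_ne_one hg1
  have r := repeats_repetition w
  have r' := r
  nth_rewrite 2 [hxy] at r'
  have r'' := r'.rotate
  rw [← hg] at r''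
  have h1 := Int.natCast_dvd_natCast.1
    (r.dvd_of_periodic hw hw1 ((r''.of_pow hk.le).periodic hg1))
  have := Nat.le_of_dvd hgl h1
  nlinarith

/-- A factor of the image of a circular factor is a circular factor of the image. -/
theorem map_mem_circFactors (μ : FreeMonoid A →* FreeMonoid B) {x w : FreeMonoid A}
    (h : w ∈ circFactors x) {u a b : FreeMonoid B} (hu : μ w = a * u * b) :
    u ∈ circFactors (μ x) := by
  obtain ⟨w', ⟨y, z, rfl, rfl⟩, c, d, hcd⟩ := h
  refine ⟨μ (z * y), ⟨μ y, μ z, map_mul _ _ _, map_mul _ _ _⟩, μ c * a, b * μ d, ?_⟩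
  rw [hcd, map_mul, map_mul, hu]
  simp only [mul_assoc]

theorem exists_syncWordWithDelay_le {μ : FreeMonoid A →* FreeMonoid B} {L : Set (FreeMonoid A)}
    {K : ℕ} (h : SyncWithDelay μ L K) {x : FreeMonoid A} (hx : x ∈ L) :
    ∃ k ≤ K, SyncWordWithDelay μ L k (μ x) := by
  by_contra hno
  push Not at hno
  have h1 : minDelay μ L (μ x) ≤ K :=
    (le_iSup₂ (f := fun x (_ : x ∈ L) => minDelay μ L (μ x)) x hx).trans h.2.2
  have h2 : ((K + 1 : ℕ) : ℕ∞) ≤ minDelay μ L (μ x) := by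
    refine le_iInf₂ fun k hk => ?_
    have : K < k := by
      by_contra hkK
      exact hno k (by omega) hk
    exact_mod_cast this
  have h3 := h2.trans h1
  norm_cast at h3
  omega

theorem syncWithDelay_of_forall {μ : FreeMonoid A →* FreeMonoid B} {L : Set (FreeMonoid A)}
    {K : ℕ} (hK : 0 < K)
    (h : ∀ u : FreeMonoid B, K ≤ u.length → ∃ u₁ u₂, IsSyncPair μ L u u₁ u₂) :
    SyncWithDelay μ L K :=
  ⟨hK, fun _ _ => ⟨K, hK, fun u _ hu => h u hu⟩,
    iSup₂_le fun _ _ => iInf₂_le K ⟨hK, fun u _ hu => h u hu⟩⟩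

end

section
variable {Γ : Type*} {μ : FreeMonoid (Fin 2) →* FreeMonoid Γ}

/-- Let `μ w = z ^ k` with `k > 1`. A word that occurs in `μ f` both as the
prefix before a last `z` and as the suffix after a first `z` has no synchronization pair: its
positions in the two occurrences would be images of words `a` and `a g` with `μ (a g) = z μ a`, so
that `w a = a g ^ k`. -/
theorem not_isSyncPair_of_power (hinj : Function.Injective μ) {L : Set (FreeMonoid (Fin 2))}
    {w : FreeMonoid (Fin 2)} (hw : IsPrimitive w) {z u : FreeMonoid Γ} {k : ℕ} (hk : 1 < k)
    (hz : μ w = z ^ k) {f : FreeMonoid (Fin 2)} (hf : f ∈ circFactorsOf L)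
    (h : u * z = μ f) (h' : z * u = μ f) (u₁ u₂ : FreeMonoid Γ) : ¬ IsSyncPair μ L u u₁ u₂ := by
  rintro ⟨hu, hs⟩
  obtain ⟨a, -, b, -, ha, -, hab⟩ := hs 1 z f hf (by rwa [one_mul])
  obtain ⟨a', -, b', -, ha', -, hab'⟩ := hs z 1 f hf (by rwa [mul_one])
  rw [one_mul] at ha
  obtain ⟨g, rfl⟩ := eq_mul_of_length_map_le hinj (hab.trans hab'.symm) (by
    rw [← ha, ← ha', FreeMonoid.length_mul]; omega)
  have hc : SemiconjBy (μ a) (μ g) z := by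
    rw [SemiconjBy, ← map_mul, ← ha', ha]
  refine hw.not_mul_eq_mul_pow hw.ne_one hk (f := a) (g := g) (hinj ?_)
  rw [map_mul, map_mul, map_pow, hz]
  exact (hc.pow_right k).eq.symm

/-- If `w` is a power word with `μ w = z ^ k`, then `z ^ (k n - 1)` occurs twice in `μ (w ^ n)`, at
the distance `z`, hence has no synchronization pair and is shorter than the delay. -/
theorem length_lt_of_syncWithDelay (hinj : Function.Injective μ) {L : Set (FreeMonoid (Fin 2))}
    {K : ℕ} (h : SyncWithDelay μ L K) {f : FreeMonoid (Fin 2)} (hf : f ∈ circFactorsOf L)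
    (hp : f ∈ powersOf (powerWords μ)) : f.length < 2 * K := by
  obtain ⟨w, ⟨hw, z, -, k, hk, hz⟩, n, rfl⟩ := hp
  have hK := h.1
  rcases Nat.eq_zero_or_pos n with rfl | hn
  · simp; omega
  obtain ⟨m, hm⟩ : ∃ m, k * n = m + 1 + 1 := ⟨k * n - 2, by
    have : 2 ≤ k * n := by nlinarith
    omega⟩
  have hmap : μ (w ^ n) = z ^ (m + 1 + 1) := by rw [map_pow, hz, ← pow_mul, hm]
  have hmem := hf
  simp only [circFactorsOf, Set.mem_iUnion] at hf
  obtain ⟨x, hx, hwx⟩ := hf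
  obtain ⟨k', hk', -, hsync⟩ := exists_syncWordWithDelay_le h hx
  have hlt : (z ^ (m + 1)).length < K := by
    by_contra hge
    obtain ⟨u₁, u₂, hu⟩ := hsync (z ^ (m + 1))
      (map_mem_circFactors μ hwx (a := 1) (b := z) (by rw [one_mul, ← pow_succ, hmap]))
      (by omega)
    exact not_isSyncPair_of_power hinj hw hk hz hmem (by rw [← pow_succ, hmap])
      (by rw [← pow_succ', hmap]) u₁ u₂ hu
  obtain ⟨α, γ, M⟩ := exists_marks_letters hinj
  have h1 : (w ^ n).length ≤ (μ (w ^ n)).length := by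
    rw [length_map]
    exact length_le_flatMap M _
  rw [hmap, length_pow z] at h1
  rw [length_pow] at hlt
  have := Nat.zero_le (m * z.length)
  linarith

end
end WordSync

theorem mainTheorem4 {Γ : Type*} (μ : FreeMonoid (Fin 2) →* FreeMonoid Γ)
    (hinj : Function.Injective μ) (hμ : ¬ WordSync.PrimitivityPreserving μ)
    (L : Set (FreeMonoid (Fin 2))) :
    WordSync.SyncWithFiniteDelay μ L ↔
      (WordSync.circFactorsOf L ∩ WordSync.powersOf (WordSync.powerWords μ)).Finite := by
  constructor
  · rintro ⟨K, hK⟩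
    have hfin : {l : List (Fin 2) | l.length < 2 * K}.Finite := List.finite_length_lt _ _
    exact hfin.subset fun f hf => WordSync.length_lt_of_syncWithDelay hinj hK hf.1 hf.2
  · intro hfin
    -- The delay depends only on the lengths of the images of the letters and on the bound `b`.
    obtain ⟨b, hb⟩ := (hfin.image FreeMonoid.length).bddAbove
    set s := max (WordSync.letters μ 0).length (WordSync.letters μ 1).length + 1 with hs
    have hs' : ∀ i, (WordSync.letters μ i).length < s := by
      intro i
      fin_cases i
      · exact Nat.lt_succ_of_le (le_max_left _ _)
      · exact Nat.lt_succ_of_le (le_max_right _ _)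
    exact ⟨2 * s * (s * (b + 2)) + 5 * s, WordSync.syncWithDelay_of_forall (by omega)
      fun u hu => WordSync.exists_isSyncPair hinj hμ hs'
        (fun f hf => hb (Set.mem_image_of_mem _ hf)) hu⟩
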